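/- Let $\kappa\ge 3$ and let $K\subset\mathbb{R}^2$ be a convex polygon with non-empty interior and exactly $\kappa$ vertices $\mathsf v_1,\dots,\mathsf v_\kappa$, listed counterclockwise. All indices $j$ are cyclic modulo $\kappa$. Let $r_j=|\mathsf v_j-\mathsf v_{j+1}|$ be the length of the $j$-th side $[\mathsf v_j,\mathsf v_{j+1}]$, and let $\theta_j\in(0,\pi)$ be the internal angle of $K$ at $\mathsf v_{j+1}$, between the $j$-th and the $(j+1)$-st sides. Let $n\ge1$. **Notation.** An $n$-tuple $z=(z_1,\dots,z_n)$ of points of $K$ is in *convex position* if no $z_i$ is in the convex hull of the others. It is in *canonical order* if moreover $z_1$ is its lowest point (the leftmost one among the lowest) and $z_1,\dots,z_n$ are listed counterclockwise. The polygon $\mathsf{PCP}(z)$ is the intersection of all polygons that contain $z_1,\dots,z_n$ and whose sides are parallel to those of $K$, with the same inner normals. Let $c_j(z)\ge 0$ be the length of its $j$-th side (possibly reduced to a point); $\mathsf{PCP}(z)$ is *full-sided* if $c_j(z)>0$ for all $j$. The side distance $\ell_j(z)$ is the smallest distance from a point of $z$ to the line containing the $j$-th side of $K$. The contact point $\mathsf{cp}_j(z)$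 is the lexicographically smallest of the points $z_i$ on the $j$-th side of $\mathsf{PCP}(z)$. The size vector $s(z)=(s_1(z),\dots,s_\kappa(z))$ is defined by $0\le s_j(z)<n$ and $z_{k+s_j(z)}=\mathsf{cp}_{j+1}(z)$ where $z_k=\mathsf{cp}_j(z)$, the indices of $z$ being modulo $n$. Let $\widetilde{\mathbb P}_K(n)$ be the probability that $n$ independent uniform points of $K$ are in convex position and have a full-sided $\mathsf{PCP}$; assume $\widetilde{\mathbb P}_K(n)>0$. Let $\mathbb D_K^{(n)}$ be the law of $n$ independent uniform points of $K$ conditioned to be in convex position in canonical order and to have a full-sided $\mathsf{PCP}$. Let $\mathbb N_\kappa(n)$ be the set of $s\in\mathbb Z_{\ge0}^\kappa$ with $s_1+\dots+s_\kappa=n$ and $s_{j-1}+s_j\ne0$ for all $j$. For $\ell\in\mathbb R^\kappa$ put $$c_j(\ell)=r_j-\frac{\ell_{j-1}}{\sin\theta_{j-1}}-\frac{\ell_{j+1}}{\sin\theta_j}-\ell_j\,(\cot\theta_{j-1}+\cot\theta_j),\qquad \mathcal L_K=\{\ell\in\mathbb R^\kappa:\ \ell_j\ge0\text{ and }c_j(\ell)\ge0\text{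 for all }j\}.$$ **Theorem.** $\mathbb D_K^{(n)}$ is a probability measure under which, almost surely, $s(z)\in\mathbb N_\kappa(n)$ and $c_j(z)=c_j(\ell(z))$ for all $j$. The joint law under $\mathbb D_K^{(n)}$ of $\ell(z)=(\ell_1(z),\dots,\ell_\kappa(z))$ and $s(z)$ is given, for every $s\in\mathbb N_\kappa(n)$ and every Borel set $A\subset\mathbb R^\kappa$, by $$\mathbb D_K^{(n)}\big(\ell(z)\in A,\ s(z)=s\big)=\int_A f_K^{(n)}(\ell,s)\,d\ell_1\cdots d\ell_\kappa,$$ $$f_K^{(n)}(\ell,s)=\frac{n!}{\mathrm{Area}(K)^n\,\widetilde{\mathbb P}_K(n)}\,\mathbf 1_{\ell\in\mathcal L_K}\prod_{j=1}^{\kappa}\frac{\sin(\theta_j)^{s_j-1}\,c_j(\ell)^{s_{j-1}+s_j-1}}{s_j!\,(s_{j-1}+s_j-1)!}.$$ In particular, if $K$ has area $1$, the prefactor is $n!/\widetilde{\mathbb P}_K(n)$. -/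

import Mathlib

open MeasureTheory ProbabilityTheory
open scoped Nat

noncomputable section

namespace PCP

/-- The Euclidean plane, with its Lebesgue measure `volume`. -/
abbrev Plane : Type := EuclideanSpace ℝ (Fin 2)

/-- Twice the signed area of the triangle `a b c`; it is positive exactly when `a, b, c` is a
counterclockwise triangle. -/
def cross (a b c : Plane) : ℝ :=
  (b 0 - a 0) * (c 1 - a 1) - (b 1 - a 1) * (c 0 - a 0)

/-! ### The polygon

A polygon with `κ` sides is given by its vertices `v : Fin κ → Plane`. Indices in `Fin κ` are cyclic:
`j + 1` and `j - 1` are taken modulo `κ`. The side `j` goes from `v j` to `v (j + 1)`. -/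

/-- The points `v 0, v 1, …` are the vertices, in counterclockwise order, of a convex polygon:
every triple of them is positively oriented (so no three of them are on a line). -/
def IsConvexPolygon {κ : ℕ} (v : Fin κ → Plane) : Prop :=
  ∀ i j k : Fin κ, i < j → j < k → 0 < cross (v i) (v j) (v k)

/-- The polygon itself, a compact convex set. -/
def body {κ : ℕ} (v : Fin κ → Plane) : Set Plane :=
  convexHull ℝ (Set.range v)

section Polygon

variable {κ : ℕ} [NeZero κ] (v : Fin κ → Plane)

/-- The length `r_j` of the side `j`. -/
def sideLength (j : Fin κ) : ℝ := dist (v j) (v (j + 1))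

/-- The internal angle `θ_j` between the side `j` and the side `j + 1`. -/
def interiorAngle (j : Fin κ) : ℝ :=
  EuclideanGeometry.angle (v j) (v (j + 1)) (v (j + 1 + 1))

/-- The signed distance from `x` to the line that contains the side `j`; it is positive on the same
side of this line as the polygon. -/
def signedDist (j : Fin κ) (x : Plane) : ℝ :=
  cross (v j) (v (j + 1)) x / sideLength v j

/-- The polygon cut out by lines parallel to the sides of the polygon `v` (with the same inner
normals), the line `j` being at signed distance `a j` from the side `j`. -/
def parallelPolygon (a : Fin κ → ℝ) : Set Plane :=
  {x | ∀ j, a j ≤ signedDist v j x}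

variable {n : ℕ} (z : Fin n → Plane)

/-- The parallel containing polygon of `z`: the intersection of all the polygons parallel to `v` that
contain the points of `z`. -/
def pcp : Set Plane :=
  ⋂₀ {P | (∃ a : Fin κ → ℝ, P = parallelPolygon v a) ∧ Set.range z ⊆ P}

/-- The side `j` of the parallel containing polygon: the set of its points that are extremal in the
direction normal to the side `j`. It may be reduced to a point. -/
def pcpSide (j : Fin κ) : Set Plane :=
  {x | x ∈ pcp v z ∧ ∀ y ∈ pcp v z, signedDist v j x ≤ signedDist v j y}

/-- The length `c_j` of the side `j` (a segment or a point) of the parallel containing polygon. -/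
def pcpSideLength (j : Fin κ) : ℝ := Metric.diam (pcpSide v z j)

/-- The parallel containing polygon has `κ` nondegenerate sides. -/
def IsFullSided : Prop := ∀ j, 0 < pcpSideLength v z j

/-- The side-distance `ℓ_j`: the smallest distance from a point of `z` to the line that contains the
side `j` of the polygon. -/
def sideDistance (j : Fin κ) : ℝ :=
  ⨅ i, Metric.infDist (z i) (line[ℝ, v j, v (j + 1)] : Set Plane)

/-- The lexicographic order of the plane. -/
def LexLE (x y : Plane) : Prop := x 0 < y 0 ∨ (x 0 = y 0 ∧ x 1 ≤ y 1)

/-- `z k` is the contact point `cp_j`: the lexicographically smallest point of `z` among those on the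
side `j` of the parallel containing polygon. -/
def IsContact (j : Fin κ) (k : Fin n) : Prop :=
  z k ∈ pcpSide v z j ∧ ∀ i, z i ∈ pcpSide v z j → LexLE (z k) (z i)

/-- The index of the contact point of the side `j`. -/
def contactIndex [NeZero n] (j : Fin κ) : Fin n :=
  Classical.epsilon (IsContact v z j)

/-- The size-vector: `s_j` is the number of steps, in the cyclic order of the indices, from the contact
point of the side `j` to that of the side `j + 1` (the subtraction is modulo `n`). -/
def sizeVector [NeZero n] (j : Fin κ) : ℕ :=
  (contactIndex v z (j + 1) - contactIndex v z j : Fin n).val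

end Polygon

/-! ### The laws -/

section Laws

variable {κ : ℕ} [NeZero κ] (v : Fin κ → Plane) (n : ℕ)

/-- The law of `n` independent uniform points of the polygon. -/
def uniformLaw : Measure (Fin n → Plane) :=
  Measure.pi fun _ => ProbabilityTheory.cond (volume : Measure Plane) (body v)

/-- The `n`-tuples of points of the polygon that are in convex position: no point is in the convex hull
of the others. -/
def convexTuples : Set (Fin n → Plane) :=
  {z | (∀ i, z i ∈ body v) ∧ ConvexIndependent ℝ z}

/-- The `n`-tuples in convex position in canonical order: the first point is the lowest one (the
leftmost one among the lowest), and the points are listed counterclockwise. -/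
def canonicalTuples [NeZero n] : Set (Fin n → Plane) :=
  {z | z ∈ convexTuples v n ∧
    (∀ i, z 0 1 < z i 1 ∨ (z 0 1 = z i 1 ∧ z 0 0 ≤ z i 0)) ∧
    ∀ i j k : Fin n, i < j → j < k → 0 < cross (z i) (z j) (z k)}

/-- The probability that `n` independent uniform points of the polygon are in convex position and have
a full-sided parallel containing polygon. -/
def fullSidedProb : ℝ :=
  (uniformLaw v n).real {z | z ∈ convexTuples v n ∧ IsFullSided v z}

/-- The law of `n` independent uniform points, conditioned to be in convex position and in canonical
order. -/
def convexLaw [NeZero n] : Measure (Fin n → Plane) :=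
  ProbabilityTheory.cond (uniformLaw v n) (canonicalTuples v n)

/-- The preceding law, conditioned on the parallel containing polygon being full-sided. -/
def fullSidedLaw [NeZero n] : Measure (Fin n → Plane) :=
  ProbabilityTheory.cond (convexLaw v n) {z | IsFullSided v z}

end Laws

/-! ### The density -/

/-- The vectors of `κ` nonnegative integers with sum `n`, without two cyclically consecutive zeros. -/
def sizeVectors (κ n : ℕ) [NeZero κ] : Set (Fin κ → ℕ) :=
  {s | ∑ j, s j = n ∧ ∀ j, s (j - 1) + s j ≠ 0}

section Density

variable {κ : ℕ} [NeZero κ] (v : Fin κ → Plane)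

/-- The side-length `c_j` as an affine function of the side-distances. -/
def cOf (l : Fin κ → ℝ) (j : Fin κ) : ℝ :=
  sideLength v j -
    (l (j - 1) / Real.sin (interiorAngle v (j - 1)) + l (j + 1) / Real.sin (interiorAngle v j) +
      l j * (Real.cot (interiorAngle v (j - 1)) + Real.cot (interiorAngle v j)))

/-- The set of admissible side-distances. -/
def admissible : Set (Fin κ → ℝ) :=
  {l | (∀ j, 0 ≤ l j) ∧ ∀ j, 0 ≤ cOf v l j}

/-- The joint density of the side-distances and the size-vector. The exponent `s j - 1` is an integer,
equal to `-1` when `s j = 0`; the exponents `s (j - 1) + s j - 1` are natural numbers as soon as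
`s ∈ sizeVectors κ n`. -/
def jointDensity (n : ℕ) (l : Fin κ → ℝ) (s : Fin κ → ℕ) : ℝ :=
  (n ! : ℝ) / (volume.real (body v) ^ n * fullSidedProb v n) *
    (admissible v).indicator (fun l => ∏ j,
      Real.sin (interiorAngle v j) ^ ((s j : ℤ) - 1) * cOf v l j ^ (s (j - 1) + s j - 1) /
        ((s j) ! * (s (j - 1) + s j - 1) !)) l

end Density

end PCP

end

noncomputable section

namespace PCP

/-! ### Planar algebra -/

/-! The contact points cut a convex tuple into κ chains. The chain from cp_j to cp_{j+1} has s_j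
steps, and its ends are the extremal points for two consecutive sides, so its steps turn to the left
inside the open sector between the directions of the sides j and j+1. Numbered from cp_0, such a
tuple is an `IsBlockChain` (`isBlockChain_shift`, `sizeVector_mem`). Conversely, along any closed
line made of such chains, a functional d ∧ · whose d lies in one of the sectors first increases and
then decreases (`IsBlockChain.wedge_step_neg`). Hence the line is convex (`IsBlockChain.isCCW`), its
contact points are the ends of the chains (`IsBlockChain.signedDist_lt`), and all c_j are positive
(`IsBlockChain.cOf_pos`).

The theorem is thus a volume computation, `volume_isBlockChain`. Once the contact points are fixed,
the chains are independent. By induction on the first vertex, the chains with m inner vertices and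
total displacement X d + Y f, with X, Y > 0, fill the volume (d ∧ f)^m / (m+1)! · X^m/m! · Y^m/m!
(`volume_isChain`). For the block j, X is the part of the side j of the PCP after cp_j and Y is the
part of the side j+1 before cp_{j+1}. Regrouped by sides, the factor of the side j is y^{s_{j-1}-1}
(c_j - y)^{s_j-1} up to factorials, where y is the position of cp_j. A Beta integral in y gives
c_j^{s_{j-1}+s_j-1}, and the coordinates that remain are the ℓ_j (`lintegral_sides`). If s_j = 0,
the points cp_j and cp_{j+1} merge at a corner of the PCP. There is then one integration less, which
explains the factor sin(θ_j)^{-1} (`prod_constants`).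

Two symmetries lead back to the law. Cyclic shifts preserve the measure and match the numbering from
the lowest point with the numbering from cp_0, without any factor n
(`volume_fullSidedTuples_inter`). The n! relabellings relate the probability to the volume of the
canonical tuples, whose inverse is the prefactor of the density (`volume_convexTuples_isFullSided`).
Ties of heights or of side distances are negligible (`ae_isGeneric`). -/

/-- The determinant of two vectors of the plane. -/
def wedge (a b : Plane) : ℝ := a 0 * b 1 - a 1 * b 0

lemma plane_ext {a b : Plane} (h0 : a 0 = b 0) (h1 : a 1 = b 1) : a = b := by
  ext i; fin_cases i <;> assumption

lemma wedge_add_left (a b c : Plane) : wedge (a + b) c = wedge a c + wedge b c := by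
  simp only [wedge, PiLp.add_apply]; ring

lemma wedge_add_right (a b c : Plane) : wedge a (b + c) = wedge a b + wedge a c := by
  simp only [wedge, PiLp.add_apply]; ring

lemma wedge_sub_left (a b c : Plane) : wedge (a - b) c = wedge a c - wedge b c := by
  simp only [wedge, PiLp.sub_apply]; ring

lemma wedge_sub_right (a b c : Plane) : wedge a (b - c) = wedge a b - wedge a c := by
  simp only [wedge, PiLp.sub_apply]; ring

lemma wedge_smul_left (t : ℝ) (a b : Plane) : wedge (t • a) b = t * wedge a b := by
  simp only [wedge, PiLp.smul_apply, smul_eq_mul]; ring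

lemma wedge_smul_right (t : ℝ) (a b : Plane) : wedge a (t • b) = t * wedge a b := by
  simp only [wedge, PiLp.smul_apply, smul_eq_mul]; ring

@[simp] lemma wedge_self (a : Plane) : wedge a a = 0 := by simp only [wedge]; ring

@[simp] lemma wedge_zero_right (a : Plane) : wedge a 0 = 0 := by simp [wedge]

@[simp] lemma wedge_zero_left (a : Plane) : wedge 0 a = 0 := by simp [wedge]

lemma wedge_comm (a b : Plane) : wedge a b = -wedge b a := by simp only [wedge]; ring

/-- The Plücker relation. -/
lemma wedge_pluecker (a b c d : Plane) :
    wedge a c * wedge b d = wedge a b * wedge c d + wedge a d * wedge b c := by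
  simp only [wedge]; ring

lemma cross_eq_wedge (a b c : Plane) : cross a b c = wedge (b - a) (c - a) := by
  simp only [wedge, cross, PiLp.sub_apply]

lemma cross_rotate (a b c : Plane) : cross a b c = cross b c a := by
  simp only [cross]; ring

lemma cross_eq_wedge' (a b c : Plane) : cross a b c = wedge (b - a) (c - b) := by
  simp only [wedge, cross, PiLp.sub_apply]; ring

/-- Expansion of a vector in a basis of the plane. -/
lemma eq_smul_add_smul {d f : Plane} (h : wedge d f ≠ 0) (w : Plane) :
    w = (wedge w f / wedge d f) • d + (wedge d w / wedge d f) • f := by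
  apply plane_ext <;> simp only [PiLp.add_apply, PiLp.smul_apply, smul_eq_mul] <;>
    field_simp <;> simp only [wedge] <;> ring

lemma eq_zero_of_wedge_eq_zero {d f w : Plane} (h : wedge d f ≠ 0) (h1 : wedge w f = 0)
    (h2 : wedge d w = 0) : w = 0 := by
  rw [eq_smul_add_smul h w, h1, h2]; simp

/-- Being to the left is transitive only within a half-plane. Here f bounds all the directions, and
the Plücker relation e∧b · a∧f = e∧a · b∧f + e∧f · a∧b concludes. -/
lemma wedge_pos_trans {e f a b : Plane} (hef : 0 < wedge e f) (haf : 0 < wedge a f)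
    (hbf : 0 < wedge b f) (hea : 0 < wedge e a) (hab : 0 < wedge a b) : 0 < wedge e b := by
  have h := wedge_pluecker e a b f
  have : 0 < wedge e b * wedge a f := by rw [h]; positivity
  exact pos_of_mul_pos_left this haf.le

/-! ### Cyclic sequences -/

/-- The periodic extension to the natural numbers of a cyclic sequence. -/
def cyc {α : Type*} {n : ℕ} [NeZero n] (z : Fin n → α) (k : ℕ) : α := z (Fin.ofNat n k)

section cyc

variable {α : Type*} {n : ℕ} [NeZero n]

lemma ofNat_add_self (k : ℕ) : Fin.ofNat n (k + n) = Fin.ofNat n k := by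
  ext; simp

lemma ofNat_succ (k : ℕ) : Fin.ofNat n (k + 1) = Fin.ofNat n k + 1 := by
  ext; simp [Fin.val_add]

lemma ofNat_add' (a b : ℕ) : Fin.ofNat n (a + b) = Fin.ofNat n a + Fin.ofNat n b := by
  ext; simp [Fin.val_add]

lemma ofNat_eq_iff (a b : ℕ) : Fin.ofNat n a = Fin.ofNat n b ↔ a ≡ b [MOD n] := by
  rw [Fin.ext_iff]; simp [Nat.ModEq]

@[simp] lemma cyc_val (z : Fin n → α) (i : Fin n) : cyc z i.val = z i := by simp [cyc]

lemma cyc_of_lt (z : Fin n → α) {k : ℕ} (h : k < n) : cyc z k = z ⟨k, h⟩ := by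
  rw [← cyc_val z ⟨k, h⟩]

@[simp] lemma cyc_add_self (z : Fin n → α) (k : ℕ) : cyc z (k + n) = cyc z k := by
  simp only [cyc, ofNat_add_self]

@[simp] lemma cyc_add_self' (z : Fin n → α) (k : ℕ) : cyc z (n + k) = cyc z k := by
  rw [add_comm, cyc_add_self]

lemma cyc_mod (z : Fin n → α) (k : ℕ) : cyc z (k % n) = cyc z k := by
  rw [cyc, cyc, (ofNat_eq_iff _ _).2 (Nat.mod_modEq k n)]

lemma cyc_add_mul (z : Fin n → α) (k q : ℕ) : cyc z (k + n * q) = cyc z k := by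
  rw [← cyc_mod, Nat.add_mul_mod_self_left, cyc_mod]

lemma cyc_congr (z : Fin n → α) {a b : ℕ} (h : a ≡ b [MOD n]) : cyc z a = cyc z b := by
  simp only [cyc, (ofNat_eq_iff a b).2 h]

end cyc

/-- The points of a finite sequence are the vertices of a strictly convex counterclockwise polygon. -/
def IsCCW {n : ℕ} (z : Fin n → Plane) : Prop :=
  ∀ i j k : Fin n, i < j → j < k → 0 < cross (z i) (z j) (z k)

/-- After reducing i modulo n, the indices that pass n are brought back by one period. This permutes
the triple cyclically, which leaves `cross` unchanged. -/
lemma IsCCW.cyc_pos {n : ℕ} [NeZero n] {z : Fin n → Plane} (hz : IsCCW z) {i j k : ℕ}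
    (hij : i < j) (hjk : j < k) (hki : k < i + n) :
    0 < cross (cyc z i) (cyc z j) (cyc z k) := by
  have hn : 0 < n := NeZero.pos n
  have key : ∀ i j k : ℕ, i < n → i < j → j < k → k < i + n →
      0 < cross (cyc z i) (cyc z j) (cyc z k) := by
    intro i j k hi hij hjk hki
    rcases lt_or_ge k n with hk | hk
    · rw [cyc_of_lt z hi, cyc_of_lt z hk, cyc_of_lt z (hjk.trans hk)]
      exact hz _ _ _ hij hjk
    · obtain ⟨k', rfl⟩ := Nat.exists_eq_add_of_le hk
      rw [cyc_add_self']
      rcases lt_or_ge j n with hj | hj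
      · rw [← cross_rotate, cyc_of_lt z hi, cyc_of_lt z hj, cyc_of_lt z (by omega : k' < n)]
        exact hz _ _ _ (by simp; omega) hij
      · obtain ⟨j', rfl⟩ := Nat.exists_eq_add_of_le hj
        rw [cyc_add_self', cross_rotate, cyc_of_lt z hi, cyc_of_lt z (by omega : j' < n),
          cyc_of_lt z (by omega : k' < n)]
        exact hz _ _ _ (by simp; omega) (by simp; omega)
  have hm := Nat.mod_add_div i n
  have e : ∀ m, i ≤ m → cyc z m = cyc z (m - n * (i / n)) := by
    intro m h
    conv_lhs => rw [show m = (m - n * (i / n)) + n * (i / n) by omega]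
    rw [cyc_add_mul]
  rw [e i le_rfl, e j hij.le, e k (by omega)]
  have := Nat.mod_lt i hn
  apply key <;> omega

lemma IsCCW.shift {n : ℕ} [NeZero n] {z : Fin n → Plane} (hz : IsCCW z) (k : Fin n) :
    IsCCW (fun i => z (i + k)) := by
  intro a b c hab hbc
  have h : ∀ i : Fin n, z (i + k) = cyc z (i.val + k.val) := fun i => by
    rw [cyc, ofNat_add', Fin.ofNat_val_eq_self, Fin.ofNat_val_eq_self]
  simp only [h]
  apply hz.cyc_pos <;> omega

/-! ### Sums of sign-changing sequences -/

/-- If a partial sum were nonpositive, some earlier term would be, hence all the later terms would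
be negative and the total could not vanish. Applied to the increments of a linear functional along a
closed line, this says that the functional is smallest at the starting point. -/
lemma sum_range_pos_of_sign_change {g : ℕ → ℝ} {N m : ℕ}
    (hg : ∀ a b, a < b → b < N → g a ≤ 0 → g b < 0) (hsum : ∑ i ∈ Finset.range N, g i = 0)
    (hm : 0 < m) (hmN : m < N) : 0 < ∑ i ∈ Finset.range m, g i := by
  by_contra! hle
  obtain ⟨a, ha, hga⟩ : ∃ a < m, g a ≤ 0 := by
    by_contra! hpos
    exact absurd hle (not_le.2 (Finset.sum_pos (fun i hi => hpos i (Finset.mem_range.1 hi))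
      ⟨0, Finset.mem_range.2 hm⟩))
  have h2 : ∑ i ∈ Finset.Ico m N, g i < 0 :=
    Finset.sum_neg (fun i hi => hg a i (by have := (Finset.mem_Ico.1 hi).1; omega)
      (Finset.mem_Ico.1 hi).2 hga) ⟨m, Finset.mem_Ico.2 ⟨le_rfl, hmN⟩⟩
  have := Finset.sum_range_add_sum_Ico g hmN.le
  linarith

lemma sum_range_nonneg_of_sign_change {g : ℕ → ℝ} {N m : ℕ}
    (hg : ∀ a b, a < b → b < N → g a ≤ 0 → g b ≤ 0) (hsum : ∑ i ∈ Finset.range N, g i = 0)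
    (hmN : m ≤ N) : 0 ≤ ∑ i ∈ Finset.range m, g i := by
  by_contra! hlt
  obtain ⟨a, ha, hga⟩ : ∃ a < m, g a < 0 := by
    by_contra! hpos
    exact absurd hlt (not_lt.2 (Finset.sum_nonneg (fun i hi => hpos i (Finset.mem_range.1 hi))))
  have h2 : ∑ i ∈ Finset.Ico m N, g i ≤ 0 :=
    Finset.sum_nonpos (fun i hi => hg a i (by have := (Finset.mem_Ico.1 hi).1; omega)
      (Finset.mem_Ico.1 hi).2 hga.le)
  have := Finset.sum_range_add_sum_Ico g hmN
  linarith

/-! ### Geometry of a convex polygon -/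

section Polygon

variable {κ : ℕ} [NeZero κ] (v : Fin κ → Plane)

/-- The unit vector that directs the side `j`. -/
def edge (j : Fin κ) : Plane := (sideLength v j)⁻¹ • (v (j + 1) - v j)

/-- The sine of the angle between consecutive sides. -/
def turn (j : Fin κ) : ℝ := wedge (edge v j) (edge v (j + 1))

/-- The point at signed distance `a` from the side `j` and `b` from the side `j + 1`. -/
def corner (j : Fin κ) (a b : ℝ) : Plane :=
  v (j + 1) + ((a / turn v j) • edge v (j + 1) - (b / turn v j) • edge v j)

lemma signedDist_eq (j : Fin κ) (x : Plane) :
    signedDist v j x = wedge (edge v j) (x - v j) := by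
  rw [signedDist, cross_eq_wedge, edge, wedge_smul_left]; ring

lemma signedDist_sub (j : Fin κ) (x y : Plane) :
    signedDist v j x - signedDist v j y = wedge (edge v j) (x - y) := by
  simp only [signedDist_eq, wedge_sub_right]; ring

lemma signedDist_self (j : Fin κ) : signedDist v j (v j) = 0 := by
  rw [signedDist_eq]; simp

lemma signedDist_succ_self (j : Fin κ) : signedDist v j (v (j + 1)) = 0 := by
  rw [signedDist, cross]; ring

lemma continuous_signedDist (j : Fin κ) : Continuous (signedDist v j) := by
  unfold signedDist cross; fun_prop

variable {v}

lemma cyc_cross_pos (hv : IsConvexPolygon v) {i j k : ℕ} (hij : i < j) (hjk : j < k)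
    (hki : k < i + κ) : 0 < cross (cyc v i) (cyc v j) (cyc v k) :=
  IsCCW.cyc_pos (z := v) hv hij hjk hki

lemma inner_neg_edge (j : Fin κ) : inner ℝ (-edge v j) (edge v (j + 1)) =
    -(edge v j 0 * edge v (j + 1) 0 + edge v j 1 * edge v (j + 1) 1) := by
  rw [inner_neg_left, PiLp.inner_apply, Fin.sum_univ_two]
  simp; ring

/-! ### Lengths, angles and corner coordinates -/

section

variable (hκ : 3 ≤ κ) (hv : IsConvexPolygon v)
include hκ hv

lemma cross_succ_pos (j : Fin κ) : 0 < cross (v j) (v (j + 1)) (v (j + 1 + 1)) := by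
  have := cyc_cross_pos hv (i := j.val) (j := j.val + 1) (k := j.val + 1 + 1) (by omega) (by omega)
    (by omega)
  simpa only [cyc, ofNat_succ, Fin.ofNat_val_eq_self] using this

lemma sideLength_pos (j : Fin κ) : 0 < sideLength v j := by
  rw [sideLength, dist_pos]
  intro h
  have := cross_succ_pos hκ hv j
  rw [← h] at this
  simp [cross] at this

lemma smul_edge (j : Fin κ) : sideLength v j • edge v j = v (j + 1) - v j := by
  rw [edge, smul_smul, mul_inv_cancel₀ (sideLength_pos hκ hv j).ne', one_smul]

lemma norm_edge (j : Fin κ) : ‖edge v j‖ = 1 := by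
  rw [edge, norm_smul, norm_inv, Real.norm_of_nonneg (sideLength_pos hκ hv j).le, sideLength,
    dist_comm, dist_eq_norm]
  apply inv_mul_cancel₀
  have := sideLength_pos hκ hv j
  rw [sideLength, dist_comm, dist_eq_norm] at this
  exact this.ne'

lemma turn_pos (j : Fin κ) : 0 < turn v j := by
  have h := cross_succ_pos hκ hv j
  rw [cross_eq_wedge', ← smul_edge hκ hv, ← smul_edge hκ hv, wedge_smul_left,
    wedge_smul_right] at h
  have h1 := sideLength_pos hκ hv j
  have h2 := sideLength_pos hκ hv (j + 1)
  exact pos_of_mul_pos_right (pos_of_mul_pos_right h h1.le) h2.le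

lemma edge_sq (j : Fin κ) : edge v j 0 ^ 2 + edge v j 1 ^ 2 = 1 := by
  have := norm_edge hκ hv j
  rw [EuclideanSpace.norm_eq, Real.sqrt_eq_one, Fin.sum_univ_two] at this
  simpa using this

lemma interiorAngle_eq (j : Fin κ) :
    interiorAngle v j = InnerProductGeometry.angle (-edge v j) (edge v (j + 1)) := by
  have h : v j - v (j + 1) = sideLength v j • (-edge v j) := by
    rw [smul_neg, smul_edge hκ hv]; abel
  rw [interiorAngle, EuclideanGeometry.angle, vsub_eq_sub, vsub_eq_sub, h, ← smul_edge hκ hv,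
    InnerProductGeometry.angle_smul_left_of_pos _ _ (sideLength_pos hκ hv j),
    InnerProductGeometry.angle_smul_right_of_pos _ _ (sideLength_pos hκ hv (j + 1))]

lemma cos_interiorAngle (j : Fin κ) : Real.cos (interiorAngle v j) =
    -(edge v j 0 * edge v (j + 1) 0 + edge v j 1 * edge v (j + 1) 1) := by
  rw [interiorAngle_eq hκ hv, InnerProductGeometry.cos_angle, norm_neg, norm_edge hκ hv,
    norm_edge hκ hv, inner_neg_edge]
  simp

/-- Both sides are nonnegative, and their squares agree by Lagrange's identity for two unit vectors.
-/
lemma sin_interiorAngle (j : Fin κ) : Real.sin (interiorAngle v j) = turn v j := by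
  have h1 : 0 ≤ Real.sin (interiorAngle v j) := by
    rw [interiorAngle_eq hκ hv]; exact InnerProductGeometry.sin_angle_nonneg _ _
  have h2 : Real.sin (interiorAngle v j) ^ 2 = turn v j ^ 2 := by
    rw [Real.sin_sq, cos_interiorAngle hκ hv, turn, wedge]
    have e1 := edge_sq hκ hv j
    have e2 := edge_sq hκ hv (j + 1)
    have : (1 : ℝ) = (edge v j 0 ^ 2 + edge v j 1 ^ 2) *
      (edge v (j + 1) 0 ^ 2 + edge v (j + 1) 1 ^ 2) := by rw [e1, e2]; norm_num
    rw [this]; ring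
  exact (sq_eq_sq₀ h1 (turn_pos hκ hv j).le).1 h2

lemma signedDist_corner (j : Fin κ) (a b : ℝ) : signedDist v j (corner v j a b) = a := by
  have h := (turn_pos hκ hv j).ne'
  have h0 : signedDist v j (corner v j a b) - signedDist v j (v (j + 1)) = a := by
    rw [signedDist_sub, corner, add_sub_cancel_left, wedge_sub_right, wedge_smul_right,
      wedge_smul_right, ← turn, wedge_self]
    field_simp; ring
  rwa [signedDist_succ_self, sub_zero] at h0

lemma signedDist_succ_corner (j : Fin κ) (a b : ℝ) :
    signedDist v (j + 1) (corner v j a b) = b := by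
  have h := (turn_pos hκ hv j).ne'
  have h0 : signedDist v (j + 1) (corner v j a b) - signedDist v (j + 1) (v (j + 1)) = b := by
    rw [signedDist_sub, corner, add_sub_cancel_left, wedge_sub_right, wedge_smul_right,
      wedge_smul_right, wedge_self, wedge_comm, ← turn]
    field_simp; ring
  rwa [signedDist_self, sub_zero] at h0

lemma eq_of_signedDist_eq {j : Fin κ} {x y : Plane} (h1 : signedDist v j x = signedDist v j y)
    (h2 : signedDist v (j + 1) x = signedDist v (j + 1) y) : x = y := by
  rw [← sub_eq_zero]
  apply eq_zero_of_wedge_eq_zero (turn_pos hκ hv j).ne'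
  · rw [wedge_comm, ← signedDist_sub, h2]; simp
  · rw [← signedDist_sub, h1]; simp

/-- This is where the affine formula for c_j comes from: it measures the displacement between
consecutive corners of the polygon at side distances l. -/
lemma corner_sub_corner (l : Fin κ → ℝ) (j : Fin κ) :
    corner v (j + 1) (l (j + 1)) (l (j + 1 + 1)) - corner v j (l j) (l (j + 1)) =
      cOf v l (j + 1) • edge v (j + 1) := by
  have hs := smul_edge hκ hv (j + 1)
  have t1 := (turn_pos hκ hv j).ne'
  have t2 := (turn_pos hκ hv (j + 1)).ne'
  have e := edge_sq hκ hv (j + 1)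
  have s0 : v (j + 1 + 1) 0 - v (j + 1) 0 = sideLength v (j + 1) * edge v (j + 1) 0 := by
    have := congrArg (fun x : Plane => x 0) hs
    simpa using this.symm
  have s1 : v (j + 1 + 1) 1 - v (j + 1) 1 = sideLength v (j + 1) * edge v (j + 1) 1 := by
    have := congrArg (fun x : Plane => x 1) hs
    simpa using this.symm
  simp only [cOf, Real.cot_eq_cos_div_sin, add_sub_cancel_right, sin_interiorAngle hκ hv,
    cos_interiorAngle hκ hv]
  have d1 : turn v j = edge v j 0 * edge v (j + 1) 1 - edge v j 1 * edge v (j + 1) 0 := rfl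
  have d2 : turn v (j + 1) = edge v (j + 1) 0 * edge v (j + 1 + 1) 1 -
    edge v (j + 1) 1 * edge v (j + 1 + 1) 0 := rfl
  apply plane_ext
  · simp only [corner, PiLp.sub_apply, PiLp.add_apply, PiLp.smul_apply, smul_eq_mul]
    generalize hT1 : turn v j = T1 at *
    generalize hT2 : turn v (j + 1) = T2 at *
    rw [eq_comm, ← sub_eq_zero]
    rw [show v (j + 1 + 1) 0 = v (j + 1) 0 + sideLength v (j + 1) * edge v (j + 1) 0 by linarith]
    field_simp
    rw [d1, d2]
    generalize edge v j 0 = a0 at *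
    generalize edge v j 1 = a1 at *
    generalize edge v (j + 1) 0 = b0 at *
    generalize edge v (j + 1) 1 = b1 at *
    generalize edge v (j + 1 + 1) 0 = c0 at *
    generalize edge v (j + 1 + 1) 1 = c1 at *
    -- The cotangents bring in scalar products, so the identity holds only modulo the relation that
    -- the middle direction is a unit vector.
    have : b1 ^ 2 = 1 - b0 ^ 2 := by linarith
    ring_nf
    simp only [this]
    ring
  · simp only [corner, PiLp.sub_apply, PiLp.add_apply, PiLp.smul_apply, smul_eq_mul]
    generalize hT1 : turn v j = T1 at *
    generalize hT2 : turn v (j + 1) = T2 at *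
    rw [eq_comm, ← sub_eq_zero]
    rw [show v (j + 1 + 1) 1 = v (j + 1) 1 + sideLength v (j + 1) * edge v (j + 1) 1 by linarith]
    field_simp
    rw [d1, d2]
    generalize edge v j 0 = a0 at *
    generalize edge v j 1 = a1 at *
    generalize edge v (j + 1) 0 = b0 at *
    generalize edge v (j + 1) 1 = b1 at *
    generalize edge v (j + 1 + 1) 0 = c0 at *
    generalize edge v (j + 1 + 1) 1 = c1 at *
    have : b0 ^ 2 = 1 - b1 ^ 2 := by linarith
    ring_nf
    simp only [this]
    ring

end

/-! ### How the directions of the sides turn -/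

section

variable (hκ : 3 ≤ κ) (hv : IsConvexPolygon v)
include hκ hv

lemma cyc_smul_edge (m : ℕ) :
    cyc (sideLength v) m • cyc (edge v) m = cyc v (m + 1) - cyc v m := by
  simp only [cyc, ofNat_succ, smul_edge hκ hv]

lemma cyc_turn_pos (m : ℕ) : 0 < wedge (cyc (edge v) m) (cyc (edge v) (m + 1)) := by
  have := turn_pos hκ hv (Fin.ofNat κ m)
  rwa [turn, ← ofNat_succ] at this

/-- In the directions of a closed angular sector between two consecutive sides, the sides turn only
once from the left to the right. -/
lemma wedge_edge_succ_nonpos {j m : ℕ} {d : Plane} (hd : 0 < wedge d (cyc (edge v) (j + 1)))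
    (hd' : 0 ≤ wedge (cyc (edge v) j) d) (hjm : j < m) (hm : m < j + κ)
    (h : wedge d (cyc (edge v) m) ≤ 0) : wedge d (cyc (edge v) (m + 1)) ≤ 0 := by
  have hT := cyc_turn_pos hκ hv j
  have hr : ∀ i, 0 < cyc (sideLength v) i := fun i => sideLength_pos hκ hv _
  set e := cyc (edge v)
  rcases eq_or_lt_of_le (show j + 1 ≤ m from hjm) with rfl | hjm
  · linarith
  -- When the turn is complete, the next side is the side j itself, and `hd'` concludes.
  rcases eq_or_lt_of_le (show m + 1 ≤ j + κ from hm) with hm | hm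
  · rw [hm, show e (j + κ) = e j from cyc_add_self _ _, wedge_comm]; linarith
  have h4 : 0 < cross (cyc v (j + 1)) (cyc v m) (cyc v (m + 1)) :=
    cyc_cross_pos hv (by omega) (by omega) (by omega)
  have h1 : 0 < cross (cyc v (j + 1)) (cyc v (m + 1)) (cyc v (m + 2)) :=
    cyc_cross_pos hv (by omega) (by omega) (by omega)
  have h2 : 0 < cross (cyc v m) (cyc v (m + 1)) (cyc v (m + 2)) :=
    cyc_cross_pos hv (by omega) (by omega) (by omega)
  have e1 := cyc_smul_edge hκ hv m
  have e2 := cyc_smul_edge hκ hv (m + 1)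
  have ej := cyc_smul_edge hκ hv j
  have ej1 := cyc_smul_edge hκ hv (j + 1)
  -- the functional `d ∧ ·` is positive at the vertex `m + 1`
  have p1 : 0 < wedge (e j) (cyc v (m + 1) - cyc v (j + 1)) := by
    have : 0 < cross (cyc v j) (cyc v (j + 1)) (cyc v (m + 1)) :=
      cyc_cross_pos hv (by omega) (by omega) (by omega)
    rw [cross_eq_wedge', ← ej, wedge_smul_left] at this
    exact pos_of_mul_pos_right this (hr j).le
  have p2 : 0 < wedge (e (j + 1)) (cyc v (m + 1) - cyc v (j + 1)) := by
    have : 0 < cross (cyc v (j + 1)) (cyc v (j + 2)) (cyc v (m + 1)) :=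
      cyc_cross_pos hv (by omega) (by omega) (by omega)
    rw [cross_eq_wedge, ← ej1, wedge_smul_left] at this
    exact pos_of_mul_pos_right this (hr (j + 1)).le
  have p : 0 < wedge d (cyc v (m + 1) - cyc v (j + 1)) := by
    have := eq_smul_add_smul hT.ne' d
    rw [this, wedge_add_left, wedge_smul_left, wedge_smul_left]
    have := div_pos hd hT
    have := div_nonneg hd' hT.le
    positivity
  by_contra! hc
  have q1 : wedge d (cyc v (m + 1) - cyc v m) ≤ 0 := by
    rw [← e1, wedge_smul_right]; exact mul_nonpos_of_nonneg_of_nonpos (hr m).le h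
  have q2 : 0 < wedge d (cyc v (m + 2) - cyc v (m + 1)) := by
    rw [← e2, wedge_smul_right]; exact mul_pos (hr (m + 1)) hc
  -- An identity between the values of d ∧ · at four vertices. A nonpositive increment followed by a
  -- positive one would make its left side negative, while its right side is positive because the
  -- functional exceeds its value at the vertex j+1.
  have key : cross (cyc v (j + 1)) (cyc v (m + 1)) (cyc v (m + 2)) *
        wedge d (cyc v (m + 1) - cyc v m) -
      cross (cyc v (j + 1)) (cyc v m) (cyc v (m + 1)) *
        wedge d (cyc v (m + 2) - cyc v (m + 1)) =
      cross (cyc v m) (cyc v (m + 1)) (cyc v (m + 2)) *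
        wedge d (cyc v (m + 1) - cyc v (j + 1)) := by
    simp only [cross, wedge, PiLp.sub_apply]; ring
  have := mul_pos h2 p
  have := mul_pos h4 q2
  have := mul_nonneg_of_nonpos_of_nonpos q1 (by linarith : -cross (cyc v (j + 1)) (cyc v (m + 1)) (cyc v (m + 2)) ≤ 0)
  linarith

lemma wedge_edge_nonpos_of_le {j m m' : ℕ} {d : Plane}
    (hd : 0 < wedge d (cyc (edge v) (j + 1)))
    (hd' : 0 ≤ wedge (cyc (edge v) j) d) (hjm : j < m) (hmm : m ≤ m') (hm : m' ≤ j + κ)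
    (h : wedge d (cyc (edge v) m) ≤ 0) : wedge d (cyc (edge v) m') ≤ 0 := by
  induction m', hmm using Nat.le_induction with
  | base => exact h
  | succ k hk ih => exact wedge_edge_succ_nonpos hκ hv hd hd' (by omega) (by omega) (ih (by omega))

end

end Polygon

section Polygon

variable {κ : ℕ} [NeZero κ] {v : Fin κ → Plane}

lemma sum_three_mem {s : Set Plane} (hs : Convex ℝ s) {a b c x : Plane} (ha : a ∈ s) (hb : b ∈ s)
    (hc : c ∈ s) {p q r : ℝ} (hp : 0 ≤ p) (hq : 0 ≤ q) (hr : 0 ≤ r) (h : p + q + r = 1)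
    (hx : p • a + q • b + r • c = x) : x ∈ s := by
  have := hs.sum_mem (t := (Finset.univ : Finset (Fin 3))) (w := ![p, q, r]) (z := ![a, b, c])
    (by intro i _; fin_cases i <;> simpa) (by simpa [Fin.sum_univ_three] using h)
    (by intro i _; fin_cases i <;> simpa)
  simpa [Fin.sum_univ_three, hx] using this

lemma signedDist_comb (j : Fin κ) (x y : Plane) {a b : ℝ} (hab : a + b = 1) :
    signedDist v j (a • x + b • y) = a * signedDist v j x + b * signedDist v j y := by
  obtain rfl : b = 1 - a := by linarith
  simp only [signedDist, cross, PiLp.add_apply, PiLp.smul_apply, smul_eq_mul]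
  ring

section

variable (hκ : 3 ≤ κ) (hv : IsConvexPolygon v)

include hκ hv in
lemma signedDist_vertex_nonneg (j k : Fin κ) : 0 ≤ signedDist v j (v k) := by
  apply div_nonneg _ (sideLength_pos hκ hv j).le
  by_cases h : k = j
  · subst h; simp [cross]
  by_cases h' : k = j + 1
  · subst h'; apply le_of_eq; simp only [cross]; ring
  obtain ⟨m, hm1, hm2, rfl⟩ : ∃ m, j.val < m ∧ m < j.val + κ ∧ Fin.ofNat κ m = k := by
    rcases lt_or_ge j.val k.val with hjk | hjk
    · exact ⟨k.val, hjk, by omega, by simp⟩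
    · refine ⟨k.val + κ, by omega, ?_, by rw [ofNat_add_self]; simp⟩
      have : k.val ≠ j.val := fun e => h (Fin.ext e)
      omega
  have hne : m ≠ j.val + 1 := by
    rintro rfl; exact h' (by rw [ofNat_succ, Fin.ofNat_val_eq_self])
  have := cyc_cross_pos hv (i := j.val) (j := j.val + 1) (k := m) (by omega) (by omega) hm2
  simp only [cyc, ofNat_succ, Fin.ofNat_val_eq_self] at this
  exact this.le

include hκ hv in
-- For the inclusion of the half-plane intersection in the hull, the polygon is cut into triangles
-- with apex `v 0`. The first diagonal that does not have x strictly on its left closes a triangle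
-- containing x, and the barycentric coordinates are quotients of `cross` values.
lemma body_eq : body v = {x | ∀ j, 0 ≤ signedDist v j x} := by
  apply Set.Subset.antisymm
  · apply convexHull_min
    · rintro _ ⟨k, rfl⟩ j
      exact signedDist_vertex_nonneg hκ hv j k
    · intro x hx y hy a b ha hb hab j
      rw [signedDist_comb j x y hab]
      exact add_nonneg (mul_nonneg ha (hx j)) (mul_nonneg hb (hy j))
  · intro x hx
    have hx' : ∀ m : ℕ, 0 ≤ cross (cyc v m) (cyc v (m + 1)) x := fun m => by
      have := mul_nonneg (hx (Fin.ofNat κ m)) (sideLength_pos hκ hv (Fin.ofNat κ m)).le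
      rwa [signedDist, div_mul_cancel₀ _ (sideLength_pos hκ hv _).ne', ← ofNat_succ] at this
    have hex : ∃ m, cross (cyc v 0) (cyc v (m + 2)) x ≤ 0 := by
      refine ⟨κ - 3, ?_⟩
      have h := hx' (κ - 1)
      rw [show κ - 1 + 1 = 0 + κ by omega, cyc_add_self] at h
      rw [show κ - 3 + 2 = κ - 1 by omega]
      have : cross (cyc v 0) (cyc v (κ - 1)) x = -cross (cyc v (κ - 1)) (cyc v 0) x := by
        simp only [cross]; ring
      linarith
    classical
    have hf := Nat.find_spec hex
    have hlt : ∀ m, m < Nat.find hex → 0 < cross (cyc v 0) (cyc v (m + 2)) x :=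
      fun m hm => not_le.1 (Nat.find_min hex hm)
    have hle : Nat.find hex ≤ κ - 3 := by
      apply Nat.find_min'
      have h := hx' (κ - 1)
      rw [show κ - 1 + 1 = 0 + κ by omega, cyc_add_self] at h
      rw [show κ - 3 + 2 = κ - 1 by omega]
      have : cross (cyc v 0) (cyc v (κ - 1)) x = -cross (cyc v (κ - 1)) (cyc v 0) x := by
        simp only [cross]; ring
      linarith
    set m := Nat.find hex
    have h0 : 0 ≤ cross (cyc v 0) (cyc v (m + 1)) x := by
      rcases Nat.eq_zero_or_pos m with h | h
      · rw [h]; exact hx' 0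
      · have := hlt (m - 1) (by omega)
        rw [show m - 1 + 2 = m + 1 by omega] at this
        exact this.le
    have hT : 0 < cross (cyc v 0) (cyc v (m + 1)) (cyc v (m + 2)) :=
      cyc_cross_pos hv (by omega) (by omega) (by omega)
    have h1 := hx' (m + 1)
    have hmem : ∀ k, cyc v k ∈ convexHull ℝ (Set.range v) :=
      fun k => subset_convexHull ℝ _ ⟨_, rfl⟩
    refine sum_three_mem (convex_convexHull ℝ _) (hmem 0) (hmem (m + 1)) (hmem (m + 2))
      (div_nonneg h1 hT.le) (div_nonneg (neg_nonneg.2 hf) hT.le) (div_nonneg h0 hT.le) ?_ ?_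
    · field_simp; simp only [cross]; ring
    · apply plane_ext <;> simp only [PiLp.add_apply, PiLp.smul_apply, smul_eq_mul] <;>
        field_simp <;> simp only [cross] <;> ring

/-! ### The parallel containing polygon -/

variable (v) in
/-- The smallest signed distance of a point of `z` to the side `j`. -/
def minDist {n : ℕ} (z : Fin n → Plane) (j : Fin κ) : ℝ := ⨅ i, signedDist v j (z i)

variable {n : ℕ} [NeZero n] {z : Fin n → Plane}

omit [NeZero n] in
lemma minDist_le (j : Fin κ) (i : Fin n) : minDist v z j ≤ signedDist v j (z i) :=
  ciInf_le (Set.finite_range _).bddBelow i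

lemma exists_minDist_eq (v : Fin κ → Plane) (z : Fin n → Plane) (j : Fin κ) :
    ∃ i, signedDist v j (z i) = minDist v z j :=
  exists_eq_ciInf_of_finite

lemma minDist_eq_of_forall_le {j : Fin κ} {k : Fin n}
    (h : ∀ i, signedDist v j (z k) ≤ signedDist v j (z i)) :
    minDist v z j = signedDist v j (z k) :=
  le_antisymm (minDist_le j k) (le_ciInf h)

omit [NeZero n] in
lemma minDist_comp_equiv (σ : Equiv.Perm (Fin n)) : minDist v (fun i => z (σ i)) = minDist v z := by
  funext j
  exact σ.iInf_comp (g := fun i => signedDist v j (z i))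

lemma pcp_eq : pcp v z = {x | ∀ j, minDist v z j ≤ signedDist v j x} := by
  apply Set.Subset.antisymm
  · intro x hx
    exact hx _ ⟨⟨minDist v z, rfl⟩, by rintro _ ⟨i, rfl⟩ j; exact minDist_le j i⟩
  · rintro x hx _ ⟨⟨a, rfl⟩, ha⟩ j
    exact le_trans (le_ciInf fun i => ha ⟨i, rfl⟩ j) (hx j)

lemma mem_pcp (i : Fin n) : z i ∈ pcp v z := by
  rw [pcp_eq]; exact fun j => minDist_le j i

lemma mem_pcpSide_iff {j : Fin κ} {x : Plane} :
    x ∈ pcpSide v z j ↔ x ∈ pcp v z ∧ signedDist v j x = minDist v z j := by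
  constructor
  · rintro ⟨h, h'⟩
    obtain ⟨i, hi⟩ := exists_minDist_eq v z j
    refine ⟨h, le_antisymm (hi ▸ h' _ (mem_pcp i)) ?_⟩
    rw [pcp_eq] at h; exact h j
  · rintro ⟨h, h'⟩
    refine ⟨h, fun y hy => ?_⟩
    rw [pcp_eq] at hy; rw [h']; exact hy j

/-- With a unique closest point the lexicographic tie-break plays no role, so the choice operator
has only one candidate. -/
lemma contactIndex_eq {j : Fin κ} {k : Fin n}
    (h : ∀ i, i ≠ k → signedDist v j (z k) < signedDist v j (z i)) :
    contactIndex v z j = k := by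
  have hle : ∀ i, signedDist v j (z k) ≤ signedDist v j (z i) := fun i => by
    by_cases hi : i = k
    · rw [hi]
    · exact (h i hi).le
  have hm := minDist_eq_of_forall_le hle
  have hu : ∀ i, z i ∈ pcpSide v z j → i = k := fun i hi => by
    by_contra hne
    have := (mem_pcpSide_iff.1 hi).2
    rw [hm] at this
    exact (h i hne).ne' this
  have hk : IsContact v z j k :=
    ⟨mem_pcpSide_iff.2 ⟨mem_pcp k, hm.symm⟩, fun i hi => by
      rw [hu i hi]; exact Or.inr ⟨rfl, le_rfl⟩⟩
  exact hu _ (Classical.epsilon_spec (p := IsContact v z j) ⟨k, hk⟩).1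

include hκ hv in
lemma eq_corner_add {l : Fin κ → ℝ} {j : Fin κ} {x : Plane}
    (hx : signedDist v (j + 1) x = l (j + 1)) :
    x = corner v j (l j) (l (j + 1)) +
      ((signedDist v j x - l j) / turn v j) • edge v (j + 1) := by
  have hT := (turn_pos hκ hv j).ne'
  refine eq_of_signedDist_eq hκ hv (j := j) ?_ ?_
  · have := signedDist_sub v j (corner v j (l j) (l (j + 1)) +
      ((signedDist v j x - l j) / turn v j) • edge v (j + 1)) (corner v j (l j) (l (j + 1)))
    rw [add_sub_cancel_left, wedge_smul_right, ← turn, div_mul_cancel₀ _ hT,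
      signedDist_corner hκ hv] at this
    linarith
  · have := signedDist_sub v (j + 1) (corner v j (l j) (l (j + 1)) +
      ((signedDist v j x - l j) / turn v j) • edge v (j + 1)) (corner v j (l j) (l (j + 1)))
    rw [add_sub_cancel_left, wedge_smul_right, wedge_self,
      signedDist_succ_corner hκ hv] at this
    linarith

include hκ hv in
-- A point on the line of a side of the PCP divides that side: its distances to the two end corners,
-- measured along the side with signs, add up to the side length.
lemma add_eq_cOf {l : Fin κ → ℝ} {j : Fin κ} {x : Plane}
    (hx : signedDist v (j + 1) x = l (j + 1)) :
    (signedDist v j x - l j) / turn v j +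
      (signedDist v (j + 1 + 1) x - l (j + 1 + 1)) / turn v (j + 1) = cOf v l (j + 1) := by
  have hT := (turn_pos hκ hv (j + 1)).ne'
  have h1 := eq_corner_add hκ hv hx
  have h2 := corner_sub_corner hκ hv l j
  have h3 : x - corner v (j + 1) (l (j + 1)) (l (j + 1 + 1)) =
      ((signedDist v j x - l j) / turn v j - cOf v l (j + 1)) • edge v (j + 1) := by
    rw [sub_smul, ← h2]; nth_rewrite 1 [h1]; abel
  have h4 := signedDist_sub v (j + 1 + 1) x (corner v (j + 1) (l (j + 1)) (l (j + 1 + 1)))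
  rw [h3, signedDist_succ_corner hκ hv, wedge_smul_right, wedge_comm, ← turn] at h4
  rw [h4]; field_simp; ring

include hκ hv in
/-- The polygon with positive side lengths is on the left of each of its sides. -/
lemma le_signedDist_corner {l : Fin κ → ℝ} (hl : ∀ j, 0 < cOf v l j) (j m : Fin κ) :
    l j ≤ signedDist v j (corner v m (l m) (l (m + 1))) := by
  -- The values of the j-th signed distance at the successive corners, starting from the corner that
  -- ends the side j. The increments sum to zero around the polygon and change sign at most once.
  set q : ℕ → ℝ := fun i => signedDist v j
    (cyc (fun m : Fin κ => corner v m (l m) (l (m + 1))) (j.val + i)) with hq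
  have hstep : ∀ i, q (i + 1) - q i = cyc (cOf v l) (j.val + (i + 1)) *
      wedge (cyc (edge v) j.val) (cyc (edge v) (j.val + (i + 1))) := fun i => by
    have := corner_sub_corner hκ hv l (Fin.ofNat κ (j.val + i))
    simp only [hq, signedDist_sub, cyc, ← add_assoc, ofNat_succ, this, wedge_smul_right,
      Fin.ofNat_val_eq_self]
  have htel : ∀ N, ∑ i ∈ Finset.range N, (q (i + 1) - q i) = q N - q 0 :=
    fun N => Finset.sum_range_sub q N
  have hd := cyc_turn_pos hκ hv j.val
  have hc : ∀ i, 0 < cyc (cOf v l) i := fun i => hl _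
  obtain ⟨i, hi, hm⟩ : ∃ i < κ, Fin.ofNat κ (j.val + i) = m := by
    refine ⟨(m - j).val, (m - j).isLt, ?_⟩
    rw [ofNat_add', Fin.ofNat_val_eq_self, Fin.ofNat_val_eq_self, add_sub_cancel]
  -- The weak version is needed: the last increment is along the side j itself and vanishes.
  have h := sum_range_nonneg_of_sign_change (g := fun i => q (i + 1) - q i) (N := κ) (m := i) ?_ ?_
    hi.le
  · rw [htel] at h
    have h0 : q 0 = l j := by
      simp only [hq, add_zero, cyc_val, signedDist_corner hκ hv]
    have hi : q i = signedDist v j (corner v m (l m) (l (m + 1))) := by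
      simp only [hq, cyc, hm]
    linarith
  · intro a b hab hb ha
    simp only [hstep] at ha ⊢
    have ha' : wedge (cyc (edge v) j.val) (cyc (edge v) (j.val + (a + 1))) ≤ 0 :=
      nonpos_of_mul_nonpos_right ha (hc _)
    exact mul_nonpos_of_nonneg_of_nonpos (hc _).le
      (wedge_edge_nonpos_of_le hκ hv hd (by simp) (by omega) (by omega) (by omega) ha')
  · rw [htel, hq]
    simp

include hκ hv in
-- Two points of the side have nonnegative distances to both end corners, with the same sum c_{j+1}.
-- The maximum with 0 makes the bound usable for a diameter, whatever the sign of c_{j+1}.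
lemma dist_le_of_mem_pcpSide {j : Fin κ} {x y : Plane} (hx : x ∈ pcpSide v z (j + 1))
    (hy : y ∈ pcpSide v z (j + 1)) : dist x y ≤ max 0 (cOf v (minDist v z) (j + 1)) := by
  rw [mem_pcpSide_iff, pcp_eq] at hx hy
  obtain ⟨hx, hx'⟩ := hx
  obtain ⟨hy, hy'⟩ := hy
  have hT := turn_pos hκ hv j
  have hT' := turn_pos hκ hv (j + 1)
  have e : x - y = ((signedDist v j x - minDist v z j) / turn v j -
      (signedDist v j y - minDist v z j) / turn v j) • edge v (j + 1) := by
    rw [sub_smul]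
    nth_rewrite 1 [eq_corner_add hκ hv hx', eq_corner_add hκ hv hy']
    abel
  have cx := add_eq_cOf hκ hv hx'
  have cy := add_eq_cOf hκ hv hy'
  have x1 := div_nonneg (sub_nonneg.2 (hx j)) hT.le
  have y1 := div_nonneg (sub_nonneg.2 (hy j)) hT.le
  have x2 := div_nonneg (sub_nonneg.2 (hx (j + 1 + 1))) hT'.le
  have y2 := div_nonneg (sub_nonneg.2 (hy (j + 1 + 1))) hT'.le
  rw [dist_eq_norm, e, norm_smul, norm_edge hκ hv, mul_one, Real.norm_eq_abs]
  apply le_max_of_le_right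
  rw [abs_le]; constructor <;> linarith

include hκ hv in
lemma pcpSideLength_le (j : Fin κ) :
    pcpSideLength v z (j + 1) ≤ max 0 (cOf v (minDist v z) (j + 1)) :=
  Metric.diam_le_of_forall_dist_le (le_max_left _ _)
    fun _ hx _ hy => dist_le_of_mem_pcpSide hκ hv hx hy

include hκ hv in
-- The two end corners realize the bound on the diameter, since positivity of all the c_j places
-- every corner in the PCP (`le_signedDist_corner`).
lemma pcpSideLength_eq_of_pos (hc : ∀ j, 0 < cOf v (minDist v z) j) (j : Fin κ) :
    pcpSideLength v z j = cOf v (minDist v z) j := by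
  obtain ⟨j, rfl⟩ : ∃ i, i + 1 = j := ⟨j - 1, sub_add_cancel _ _⟩
  apply le_antisymm
  · have := pcpSideLength_le (z := z) hκ hv j
    rwa [max_eq_right (hc _).le] at this
  · have hb : Bornology.IsBounded (pcpSide v z (j + 1)) :=
      Metric.isBounded_iff.2 ⟨_, fun x hx y hy => dist_le_of_mem_pcpSide hκ hv hx hy⟩
    have hmem : ∀ m, corner v m (minDist v z m) (minDist v z (m + 1)) ∈ pcp v z := fun m => by
      rw [pcp_eq]; exact fun i => le_signedDist_corner hκ hv hc i m
    have h1 := Metric.dist_le_diam_of_mem hb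
      (mem_pcpSide_iff.2 ⟨hmem (j + 1), signedDist_corner hκ hv _ _ _⟩)
      (mem_pcpSide_iff.2 ⟨hmem j, signedDist_succ_corner hκ hv _ _ _⟩)
    rwa [dist_eq_norm, corner_sub_corner hκ hv, norm_smul, norm_edge hκ hv, mul_one,
      Real.norm_of_nonneg (hc _).le] at h1

include hκ hv in
lemma isFullSided_iff : IsFullSided v z ↔ ∀ j, 0 < cOf v (minDist v z) j := by
  constructor
  · intro h j
    obtain ⟨j, rfl⟩ : ∃ i, i + 1 = j := ⟨j - 1, sub_add_cancel _ _⟩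
    have := (h (j + 1)).trans_le (pcpSideLength_le hκ hv j)
    rcases lt_max_iff.1 this with h | h
    · exact absurd h (lt_irrefl _)
    · exact h
  · intro h j
    rw [pcpSideLength_eq_of_pos hκ hv h]
    exact h j

omit [NeZero n] in
lemma pcp_comp_equiv (σ : Equiv.Perm (Fin n)) : pcp v (fun i => z (σ i)) = pcp v z := by
  have : Set.range (fun i => z (σ i)) = Set.range z := EquivLike.range_comp z σ
  rw [pcp, pcp, this]

omit [NeZero n] in
lemma isFullSided_comp_equiv (σ : Equiv.Perm (Fin n)) :
    IsFullSided v (fun i => z (σ i)) ↔ IsFullSided v z := by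
  simp only [IsFullSided, pcpSideLength, pcpSide, pcp_comp_equiv]

lemma abs_wedge_le {e w : Plane} (he : e 0 ^ 2 + e 1 ^ 2 = 1) : |wedge e w| ≤ ‖w‖ := by
  rw [EuclideanSpace.norm_eq, Fin.sum_univ_two]
  apply Real.abs_le_sqrt
  simp only [Real.norm_eq_abs, sq_abs, wedge]
  have : w 0 ^ 2 + w 1 ^ 2 = (e 0 ^ 2 + e 1 ^ 2) * (w 0 ^ 2 + w 1 ^ 2) := by rw [he, one_mul]
  rw [this]
  nlinarith [sq_nonneg (e 0 * w 0 + e 1 * w 1)]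

include hκ hv in
-- The orthogonal projection attains the distance. The lower bound holds because e ∧ · is
-- 1-Lipschitz for a unit vector e.
lemma infDist_side {j : Fin κ} {x : Plane} (hx : 0 ≤ signedDist v j x) :
    Metric.infDist x (line[ℝ, v j, v (j + 1)] : Set Plane) = signedDist v j x := by
  have he := edge_sq hκ hv j
  have hr := (sideLength_pos hκ hv j).ne'
  have hs := smul_edge hκ hv j
  have hline : ∀ t : ℝ, v j + t • edge v j ∈ (line[ℝ, v j, v (j + 1)] : Set Plane) := fun t => by
    have := AffineMap.lineMap_mem_affineSpan_pair (k := ℝ) (t / sideLength v j) (v j) (v (j + 1))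
    rw [AffineMap.lineMap_apply, vsub_eq_sub, ← hs, smul_smul, div_mul_cancel₀ _ hr,
      vadd_eq_add, add_comm _ (v j)] at this
    exact this
  apply le_antisymm
  · set t := edge v j 0 * (x 0 - v j 0) + edge v j 1 * (x 1 - v j 1)
    refine (Metric.infDist_le_dist_of_mem (hline t)).trans (le_of_eq ?_)
    rw [dist_eq_norm, EuclideanSpace.norm_eq, Fin.sum_univ_two, Real.sqrt_eq_iff_mul_self_eq
      (by positivity) hx]
    simp only [Real.norm_eq_abs, sq_abs, PiLp.sub_apply, PiLp.add_apply, PiLp.smul_apply,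
      smul_eq_mul, signedDist_eq, wedge, t]
    generalize edge v j 0 = a at *
    generalize edge v j 1 = b at *
    have : b ^ 2 = 1 - a ^ 2 := by linarith
    have h4 : b ^ 4 = (1 - a ^ 2) ^ 2 := by rw [← this]; ring
    have h3 : b ^ 3 = b * (1 - a ^ 2) := by rw [← this]; ring
    ring_nf
    simp only [this, h4, h3]
    ring
  · rw [Metric.le_infDist ⟨_, hline 0⟩]
    intro y hy
    obtain ⟨t, rfl⟩ := mem_affineSpan_pair_iff_exists_lineMap_eq.1 hy
    rw [dist_eq_norm]
    refine le_trans (le_of_eq ?_) ((le_abs_self _).trans (abs_wedge_le he))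
    rw [← signedDist_sub, AffineMap.lineMap_apply_module, signedDist_comb _ _ _ (by ring),
      signedDist_self, signedDist_succ_self]
    ring

include hκ hv in
omit [NeZero n] in
lemma sideDistance_eq (hz : ∀ i, z i ∈ body v) : sideDistance v z = minDist v z := by
  funext j
  simp only [sideDistance, minDist]
  congr 1
  funext i
  have := hz i
  rw [body_eq hκ hv] at this
  exact infDist_side hκ hv (this j)

end

end Polygon

/-! ### Chains of steps along the sides -/

/-- The partial sums of a size-vector. -/
def partialSum {κ : ℕ} [NeZero κ] (s : Fin κ → ℕ) (j : ℕ) : ℕ := ∑ i ∈ Finset.range j, cyc s i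

/-- The `k`-th side, as a vector, of the closed polygonal line with vertices `z`. -/
def step {n : ℕ} [NeZero n] (z : Fin n → Plane) (k : ℕ) : Plane := cyc z (k + 1) - cyc z k

section

variable {κ : ℕ} [NeZero κ] {s : Fin κ → ℕ}

lemma partialSum_succ (j : ℕ) : partialSum s (j + 1) = partialSum s j + cyc s j :=
  Finset.sum_range_succ _ _

lemma partialSum_zero : partialSum s 0 = 0 := rfl

lemma partialSum_self : partialSum s κ = ∑ j, s j := by
  rw [partialSum, Finset.sum_range]; simp

lemma partialSum_mono : Monotone (partialSum s) :=
  monotone_nat_of_le_succ fun j => by rw [partialSum_succ]; omega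

lemma partialSum_add_self (j : ℕ) : partialSum s (j + κ) = partialSum s j + ∑ j, s j := by
  induction j with
  | zero => rw [zero_add, partialSum_self, partialSum_zero, zero_add]
  | succ j ih => rw [add_right_comm, partialSum_succ, ih, cyc_add_self, partialSum_succ]; ring

lemma partialSum_add_mul (j q : ℕ) :
    partialSum s (j + κ * q) = partialSum s j + (∑ j, s j) * q := by
  induction q with
  | zero => simp
  | succ q ih => rw [Nat.mul_succ, ← add_assoc, partialSum_add_self, ih]; ring

/-- Every index belongs to exactly one block. -/
lemma exists_block (hs : 0 < ∑ j, s j) (k : ℕ) :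
    ∃ j t, t < cyc s j ∧ k = partialSum s j + t := by
  have hex : ∃ j, k < partialSum s j := by
    refine ⟨0 + κ * (k + 1), ?_⟩
    rw [partialSum_add_mul, partialSum_zero]
    nlinarith
  classical
  have h := Nat.find_spec hex
  have hmin := fun j => Nat.find_min hex (m := j)
  rcases hj : Nat.find hex with _ | j
  · rw [hj, partialSum_zero] at h; omega
  · rw [hj] at h
    have := hmin j (by omega)
    rw [partialSum_succ] at h
    exact ⟨j, k - partialSum s j, by omega, by omega⟩

/-- As κ ≥ 3, the entries s_j, s_{j+1}, s_{j+2} are distinct terms of the sum n, and the last two do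
not both vanish. Strictness makes s_j recoverable from its residue modulo n. -/
lemma lt_of_mem_sizeVectors {n : ℕ} (hκ : 3 ≤ κ) (hs : s ∈ sizeVectors κ n) (j : Fin κ) :
    s j < n := by
  have h1 := partialSum_add_self (s := s) j.val
  have h2 : partialSum s (j.val + 3) ≤ partialSum s (j.val + κ) := partialSum_mono (by omega)
  have h3 := hs.2 (j + 1 + 1)
  rw [add_sub_cancel_right] at h3
  rw [hs.1] at h1
  have h4 : partialSum s (j.val + 3) = partialSum s j.val + s j + s (j + 1) + s (j + 1 + 1) := by
    rw [show j.val + 3 = j.val + 1 + 1 + 1 by omega]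
    simp only [partialSum_succ, cyc, ofNat_succ, Fin.ofNat_val_eq_self]
  omega

end

section

variable {n : ℕ} [NeZero n] {z : Fin n → Plane}

lemma step_add_self (k : ℕ) : step z (k + n) = step z k := by
  rw [step, step, add_right_comm, cyc_add_self, cyc_add_self]

lemma step_add_mul (k q : ℕ) : step z (k + n * q) = step z k := by
  rw [step, step, add_right_comm, cyc_add_mul, cyc_add_mul]

lemma step_congr {a b : ℕ} (h : a ≡ b [MOD n]) : step z a = step z b := by
  rw [step, step, cyc_congr z h, cyc_congr z (h.add_right 1)]

lemma sum_wedge_step (d : Plane) (a m : ℕ) :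
    ∑ i ∈ Finset.range m, wedge d (step z (a + i)) = wedge d (cyc z (a + m) - cyc z a) := by
  induction m with
  | zero => simp
  | succ m ih =>
    rw [Finset.sum_range_succ, ih, ← wedge_add_right, step]
    congr 1; rw [← add_assoc]; abel

/-- A closed polygonal line is a convex polygon as soon as it is on the left of its sides. -/
lemma isCCW_of_step (h : ∀ i k, i + 1 < k → k < i + n →
    0 < wedge (step z i) (cyc z k - cyc z (i + 1))) : IsCCW z := by
  -- Measuring from z i instead of z (i+1) changes nothing, since the step i has zero wedge with
  -- itself.
  have hA : ∀ i k, i + 1 < k → k < i + n → 0 < wedge (step z i) (cyc z k - cyc z i) := by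
    intro i k h1 h2
    have := h i k h1 h2
    rw [show cyc z k - cyc z (i + 1) = cyc z k - cyc z i - step z i by rw [step]; abel,
      wedge_sub_right, wedge_self, sub_zero] at this
    exact this
  have key : ∀ i j k, i < j → j < k → k < i + n →
      0 < wedge (cyc z j - cyc z i) (cyc z k - cyc z i) := by
    intro i j k hij hjk
    induction k, hjk using Nat.le_induction with
    | base =>
      intro hk
      have := hA j (i + n) (by omega) (by omega)
      rw [cyc_add_self, step] at this
      have e : wedge (cyc z j - cyc z i) (cyc z (j + 1) - cyc z i) =
        wedge (cyc z (j + 1) - cyc z j) (cyc z i - cyc z j) := by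
        simp only [wedge, PiLp.sub_apply]; ring
      rwa [Nat.succ_eq_add_one, e]
    | succ k hjk ih =>
      intro hk
      rcases eq_or_lt_of_le (show i + 1 ≤ j from hij) with rfl | hij'
      · exact hA i (k + 1) (by omega) hk
      · have h1 := ih (by omega)
        have h2 := hA k (i + n) (by omega) (by omega)
        rw [cyc_add_self, step] at h2
        have e : wedge (cyc z k - cyc z i) (cyc z (k + 1) - cyc z i) =
          wedge (cyc z (k + 1) - cyc z k) (cyc z i - cyc z k) := by
          simp only [wedge, PiLp.sub_apply]; ring
        rw [← e] at h2
        have a1 := hA i j hij' (by omega)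
        have a2 := hA i k (by omega) (by omega)
        have a3 := hA i (k + 1) (by omega) hk
        -- All the vectors from z i are to the left of the step i, so the Plücker relation adds the
        -- angle from j to k and the angle from k to k+1.
        have hp := wedge_pluecker (step z i) (cyc z j - cyc z i) (cyc z k - cyc z i)
          (cyc z (k + 1) - cyc z i)
        have : 0 < wedge (step z i) (cyc z k - cyc z i) *
          wedge (cyc z j - cyc z i) (cyc z (k + 1) - cyc z i) := by rw [hp]; positivity
        exact pos_of_mul_pos_right this a2.le
  intro i j k hij hjk
  have := key i j k hij hjk (by omega)
  rwa [cyc_val, cyc_val, cyc_val, ← cross_eq_wedge] at this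

end

section Chain

variable {κ : ℕ} [NeZero κ] {n : ℕ} [NeZero n]

/-- From the index `partialSum s j` to the index `partialSum s (j + 1)`, the points of `z` are a convex
chain whose steps have their directions between those of the sides `j` and `j + 1`. -/
def IsBlockChain (v : Fin κ → Plane) (s : Fin κ → ℕ) (z : Fin n → Plane) : Prop :=
  ∀ j : Fin κ, ∀ t, t < s j →
    0 < wedge (step z (partialSum s j + t)) (edge v (j + 1)) ∧
    0 < wedge (if t = 0 then edge v j else step z (partialSum s j + t - 1))
      (step z (partialSum s j + t))

variable {v : Fin κ → Plane} {s : Fin κ → ℕ} {z : Fin n → Plane}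

section

variable (hκ : 3 ≤ κ) (hv : IsConvexPolygon v) (hs : s ∈ sizeVectors κ n)
  (hz : IsBlockChain v s z)

include hs hz in
-- Shifting the block index by κ shifts the point index by the sum of s, which is n. Blocks may
-- therefore be indexed by natural numbers in arguments that wrap around.
lemma IsBlockChain.lift {j t : ℕ} (ht : t < cyc s j) :
    0 < wedge (step z (partialSum s j + t)) (cyc (edge v) (j + 1)) ∧
    0 < wedge (if t = 0 then cyc (edge v) j else step z (partialSum s j + t - 1))
      (step z (partialSum s j + t)) := by
  have hj := Nat.mod_add_div j κ
  have hS := partialSum_add_mul (s := s) (j % κ) (j / κ)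
  rw [hj, hs.1] at hS
  have h := hz (Fin.ofNat κ j) t ht
  have hval : (Fin.ofNat κ j).val = j % κ := rfl
  rw [hval, ← ofNat_succ] at h
  have e1 : step z (partialSum s j + t) = step z (partialSum s (j % κ) + t) := by
    rw [hS, add_right_comm, step_add_mul]
  rw [e1]
  refine ⟨h.1, ?_⟩
  by_cases h0 : t = 0
  · simpa only [h0, if_true, cyc] using h.2
  · have e2 : step z (partialSum s j + t - 1) = step z (partialSum s (j % κ) + t - 1) := by
      rw [hS, ← step_add_mul (z := z) (partialSum s (j % κ) + t - 1) (j / κ)]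
      congr 1; omega
    rw [e2]
    simpa only [h0, if_false] using h.2

include hκ hv hs hz

/-- The first step starts to the left of the side j. The later ones stay there by transitivity,
since none of them reaches the direction of the side j+1. -/
lemma IsBlockChain.cone {j t : ℕ} (ht : t < cyc s j) :
    0 < wedge (cyc (edge v) j) (step z (partialSum s j + t)) ∧
    0 < wedge (step z (partialSum s j + t)) (cyc (edge v) (j + 1)) := by
  refine ⟨?_, (hz.lift hs ht).1⟩
  induction t with
  | zero => simpa using (hz.lift hs ht).2
  | succ t ih =>
    have h := hz.lift hs ht
    have h' := hz.lift hs (show t < cyc s j by omega)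
    simp only [Nat.succ_ne_zero, if_false] at h
    exact wedge_pos_trans (cyc_turn_pos hκ hv j) h'.1 h.1 (ih (by omega)) h.2

omit hκ hv in
lemma IsBlockChain.wedge_pos {j t t' : ℕ} (htt : t < t') (ht : t' < cyc s j) :
    0 < wedge (step z (partialSum s j + t)) (step z (partialSum s j + t')) := by
  induction t', htt using Nat.le_induction with
  | base =>
    have h := (hz.lift hs ht).2
    simp only [Nat.succ_ne_zero, if_false] at h
    exact h
  | succ k hk ih =>
    have h := (hz.lift hs ht).2
    simp only [Nat.succ_ne_zero, if_false] at h
    exact wedge_pos_trans (hz.lift hs (show t < cyc s j by omega)).1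
      (hz.lift hs (show k < cyc s j by omega)).1 (hz.lift hs ht).1 (ih (by omega)) h

/-- In a direction between those of the sides `j` and `j + 1`, the steps of the following blocks turn
only once from the left to the right. -/
lemma IsBlockChain.wedge_step_neg {j m m' t t' : ℕ} {d : Plane}
    (hd : 0 < wedge d (cyc (edge v) (j + 1))) (hd' : 0 ≤ wedge (cyc (edge v) j) d)
    (hjm : j < m) (hm : m' < j + κ) (ht : t < cyc s m) (ht' : t' < cyc s m')
    (hlt : partialSum s m + t < partialSum s m' + t')
    (h : wedge d (step z (partialSum s m + t)) ≤ 0) :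
    wedge d (step z (partialSum s m' + t')) < 0 := by
  have hT := cyc_turn_pos hκ hv
  have hmm : m ≤ m' := by
    by_contra! hlt'
    have h1 : partialSum s (m' + 1) ≤ partialSum s m := partialSum_mono hlt'
    rw [partialSum_succ] at h1
    omega
  obtain ⟨c1, c2⟩ := hz.cone hκ hv hs ht
  obtain ⟨c1', c2'⟩ := hz.cone hκ hv hs ht'
  -- A nonzero d cannot be parallel to two consecutive sides. This turns weak signs into strict ones
  -- below.
  have hd0 : ∀ i, ¬ (wedge d (cyc (edge v) i) = 0 ∧ wedge d (cyc (edge v) (i + 1)) = 0) := by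
    rintro i ⟨h1, h2⟩
    have := eq_zero_of_wedge_eq_zero (hT i).ne' h2 (by rw [wedge_comm, h1, neg_zero])
    rw [this] at hd; simp at hd
  set E := cyc (edge v) with hE
  set w := step z (partialSum s m + t)
  set w' := step z (partialSum s m' + t')
  have hw := eq_smul_add_smul (hT m).ne' w
  have hle := fun a b => wedge_edge_nonpos_of_le hκ hv hd hd' (m := a) (m' := b)
  -- The step w is a positive combination of the sides m and m+1. If the side m still points to the
  -- left of d, only the side m+1 can account for the sign of w.
  have hA : wedge d (E (m + 1)) ≤ 0 := by
    by_cases hc : wedge d (E m) ≤ 0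
    · exact hle m (m + 1) hjm (by omega) (by omega) hc
    · rw [hw, wedge_add_right, wedge_smul_right, wedge_smul_right] at h
      have h1 := mul_pos (div_pos c2 (hT m)) (not_le.1 hc)
      have h2 : wedge (E m) w / wedge (E m) (E (m + 1)) * wedge d (E (m + 1)) < 0 := by linarith
      exact (neg_of_mul_neg_right h2 (div_pos c1 (hT m)).le).le
  rcases eq_or_lt_of_le hmm with rfl | hmm'
  · have hww : 0 < wedge w w' := hz.wedge_pos hs (by omega) ht'
    -- Within one block, the later step is a positive combination of w and of the side m+1.
    have hw' := eq_smul_add_smul c2.ne' w'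
    have q1 := div_pos c2' c2
    have q2 := div_pos hww c2
    rw [hw', wedge_add_right, wedge_smul_right, wedge_smul_right]
    rcases lt_or_eq_of_le h with h | h
    · have := mul_neg_of_pos_of_neg q1 h
      have := mul_nonpos_of_nonneg_of_nonpos q2.le hA
      linarith
    · have hA' : wedge d (E (m + 1)) < 0 := by
        refine lt_of_le_of_ne hA fun h0 => ?_
        have := eq_zero_of_wedge_eq_zero c2.ne' h0 (by rw [wedge_comm, h, neg_zero])
        rw [this] at hd; simp at hd
      have := mul_neg_of_pos_of_neg q2 hA'
      rw [h]; linarith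
  · have a1 := hle (m + 1) m' (by omega) hmm' (by omega) hA
    have a2 := hle (m + 1) (m' + 1) (by omega) (by omega) (by omega) hA
    have hw' := eq_smul_add_smul (hT m').ne' w'
    rw [hw', wedge_add_right, wedge_smul_right, wedge_smul_right]
    have q1 := div_pos c2' (hT m')
    have q2 := div_pos c1' (hT m')
    rcases lt_or_eq_of_le a1 with a1 | a1
    · have := mul_neg_of_pos_of_neg q1 a1
      have := mul_nonpos_of_nonneg_of_nonpos q2.le a2
      linarith
    · have a2' : wedge d (E (m' + 1)) < 0 := lt_of_le_of_ne a2 fun h0 => hd0 m' ⟨a1, h0⟩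
      have := mul_neg_of_pos_of_neg q2 a2'
      rw [a1]; linarith

omit hκ hv hz [NeZero n] in
-- Locates the steps of one full turn that begins a places into the block j. The block j+κ is
-- reached only if a > 0, by the steps that come before the starting place.
lemma block_bounds {j m t a : ℕ} (ht : t < cyc s m)
    (h1 : partialSum s j ≤ partialSum s m + t) (h2 : partialSum s m + t < partialSum s j + n + a)
    (ha : a ≤ cyc s j) : j ≤ m ∧ m ≤ j + κ ∧ (a = 0 → m < j + κ) := by
  refine ⟨?_, ?_, ?_⟩
  · by_contra! hlt
    have := partialSum_mono (s := s) hlt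
    rw [Nat.succ_eq_add_one, partialSum_succ] at this
    omega
  · by_contra! hlt
    have := partialSum_mono (s := s) hlt
    rw [Nat.succ_eq_add_one, partialSum_succ, partialSum_add_self, cyc_add_self, hs.1] at this
    omega
  · rintro rfl
    by_contra! hlt
    have := partialSum_mono (s := s) hlt
    rw [partialSum_add_self, hs.1] at this
    omega

/-- The first point of the block `j` is the closest one to the side `j`. -/
lemma IsBlockChain.signedDist_lt (j : ℕ) {a : ℕ} (ha : 0 < a) (han : a < n) :
    signedDist v (Fin.ofNat κ j) (cyc z (partialSum s j)) <
      signedDist v (Fin.ofNat κ j) (cyc z (partialSum s j + a)) := by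
  have hn : 0 < ∑ j, s j := by rw [hs.1]; exact NeZero.pos n
  rw [← sub_pos, signedDist_sub, ← sum_wedge_step]
  refine sum_range_pos_of_sign_change (N := n) ?_ ?_ ha han
  · intro b c hbc hc hb
    obtain ⟨m, t, ht, e⟩ := exists_block hn (partialSum s j + b)
    obtain ⟨m', t', ht', e'⟩ := exists_block hn (partialSum s j + c)
    rw [e] at hb
    rw [e']
    have B := block_bounds hs (j := j) (a := 0) ht (by omega) (by omega) (by omega)
    have B' := block_bounds hs (j := j) (a := 0) ht' (by omega) (by omega) (by omega)
    -- Steps of the block j move strictly away from the side j, so the sign change can occur only in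
    -- a later block.
    rcases eq_or_lt_of_le B.1 with rfl | hjm
    · exact absurd hb (not_le.2 (hz.cone hκ hv hs ht).1)
    · exact hz.wedge_step_neg hκ hv hs (cyc_turn_pos hκ hv j) (by simp [cyc]) hjm (B'.2.2 rfl) ht ht'
        (by omega) hb
  · rw [sum_wedge_step, cyc_add_self]; simp

lemma IsBlockChain.isCCW : IsCCW z := by
  have hn : 0 < ∑ j, s j := by rw [hs.1]; exact NeZero.pos n
  apply isCCW_of_step
  intro i k hik hk
  obtain ⟨j, t, ht, rfl⟩ := exists_block hn i
  obtain ⟨b, rfl⟩ := Nat.exists_eq_add_of_lt hik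
  have hC := hz.cone hκ hv hs ht
  rw [show partialSum s j + t + 1 + b + 1 = partialSum s j + t + 1 + (b + 1) by ring,
    ← sum_wedge_step]
  -- Here d is the step i itself, and the n-1 other steps sum to its opposite, whose wedge with d
  -- vanishes.
  refine sum_range_pos_of_sign_change (N := n - 1) ?_ ?_ (by omega) (by omega)
  · intro b c hbc hc hb
    obtain ⟨m, u, hu, e⟩ := exists_block hn (partialSum s j + t + 1 + b)
    obtain ⟨m', u', hu', e'⟩ := exists_block hn (partialSum s j + t + 1 + c)
    rw [e] at hb
    rw [e']
    have B := block_bounds hs (j := j) (a := t) hu (by omega) (by omega) (by omega)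
    have B' := block_bounds hs (j := j) (a := t) hu' (by omega) (by omega) (by omega)
    rcases eq_or_lt_of_le B.1 with rfl | hjm
    · exact absurd hb (not_le.2 (hz.wedge_pos hs (by omega) hu))
    -- At the end of the turn come the steps of the initial block that precede the step i. They are
    -- to the right of it.
    rcases eq_or_lt_of_le B'.2.1 with rfl | hm'
    · rw [cyc_add_self] at hu'
      rw [partialSum_add_self, hs.1] at e' ⊢
      rw [add_right_comm, step_add_self, wedge_comm, neg_lt_zero]
      exact hz.wedge_pos hs (by omega) ht
    · exact hz.wedge_step_neg hκ hv hs hC.2 hC.1.le hjm hm' hu hu' (by omega) hb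
  · rw [sum_wedge_step, show partialSum s j + t + 1 + (n - 1) = partialSum s j + t + n by omega,
      cyc_add_self, ← neg_sub, ← step, wedge_comm, neg_eq_zero, ← neg_one_smul ℝ (step z _), wedge_smul_left]
    simp

lemma IsBlockChain.signedDist_lt_of_ne (j : Fin κ) {i : Fin n}
    (hi : i ≠ Fin.ofNat n (partialSum s j)) :
    signedDist v j (z (Fin.ofNat n (partialSum s j))) < signedDist v j (z i) := by
  set k := Fin.ofNat n (partialSum s j) with hk
  have hne : (i - k).val ≠ 0 := by
    intro h
    exact hi (sub_eq_zero.1 (Fin.ext h))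
  have h := hz.signedDist_lt hκ hv hs j.val (Nat.pos_of_ne_zero hne) (i - k).isLt
  rw [Fin.ofNat_val_eq_self, cyc, cyc, ofNat_add', Fin.ofNat_val_eq_self, ← hk,
    add_sub_cancel] at h
  exact h

lemma IsBlockChain.minDist_eq (j : Fin κ) :
    minDist v z j = signedDist v j (z (Fin.ofNat n (partialSum s j))) := by
  apply minDist_eq_of_forall_le
  intro i
  by_cases hi : i = Fin.ofNat n (partialSum s j)
  · rw [hi]
  · exact (hz.signedDist_lt_of_ne hκ hv hs j hi).le

omit hκ hv hz in
-- For the last block the index j+1 wraps to 0, where the partial sum is 0 instead of n; the two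
-- agree modulo n.
lemma ofNat_partialSum_succ (j : Fin κ) : Fin.ofNat n (partialSum s (j + 1 : Fin κ)) =
    Fin.ofNat n (partialSum s j + s j) := by
  have h : partialSum s (j.val + 1) = partialSum s j + s j := by
    rw [partialSum_succ, cyc_val]
  rw [← h]
  rcases lt_or_ge (j.val + 1) κ with hj | hj
  · congr 2
    rw [Fin.val_add_one_of_lt']
    exact hj
  · have e : j.val + 1 = 0 + κ := by omega
    have e' : (j + 1 : Fin κ) = 0 := by
      ext
      have : (j + 1 : Fin κ) = Fin.ofNat κ (j.val + 1) := by
        rw [ofNat_succ, Fin.ofNat_val_eq_self]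
      rw [this, e]; simp
    rw [e, e', partialSum_add_self, hs.1, ofNat_add_self]
    simp

/-- The contact point of the side j+1 splits c_{j+1} into two nonnegative parts. Since s_j or
s_{j+1} is nonzero, this point differs from the previous or from the next contact point, which makes
a part positive. -/
lemma IsBlockChain.cOf_pos (j : Fin κ) : 0 < cOf v (minDist v z) j := by
  obtain ⟨j, rfl⟩ : ∃ i, i + 1 = j := ⟨j - 1, sub_add_cancel _ _⟩
  rw [← add_eq_cOf hκ hv (hz.minDist_eq hκ hv hs (j + 1)).symm]
  have hT := turn_pos hκ hv j
  have hT' := turn_pos hκ hv (j + 1)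
  have h0 := hs.2 (j + 1)
  rw [add_sub_cancel_right] at h0
  set x := z (Fin.ofNat n (partialSum s (j + 1 : Fin κ))) with hx
  have l1 : minDist v z j ≤ signedDist v j x := minDist_le _ _
  have l2 : minDist v z (j + 1 + 1) ≤ signedDist v (j + 1 + 1) x := minDist_le _ _
  have key : ∀ (i : Fin κ), s i ≠ 0 → Fin.ofNat n (partialSum s (i + 1 : Fin κ)) ≠
      Fin.ofNat n (partialSum s i) := by
    intro i hi h
    rw [ofNat_partialSum_succ hs, ofNat_add'] at h
    have := add_eq_left.1 h
    have h2 := congrArg Fin.val this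
    rw [Fin.val_ofNat, Nat.mod_eq_of_lt (lt_of_mem_sizeVectors hκ hs i)] at h2
    exact hi (by simpa using h2)
  by_cases h1 : s j = 0
  · have h2 : s (j + 1) ≠ 0 := by omega
    have := hz.signedDist_lt_of_ne hκ hv hs (j + 1 + 1) (key _ h2).symm
    rw [← hz.minDist_eq hκ hv hs] at this
    have := div_pos (sub_pos.2 this) hT'
    have := div_nonneg (sub_nonneg.2 l1) hT.le
    linarith
  · have := hz.signedDist_lt_of_ne hκ hv hs j (key _ h1)
    rw [← hz.minDist_eq hκ hv hs] at this
    have := div_pos (sub_pos.2 this) hT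
    have := div_nonneg (sub_nonneg.2 l2) hT'.le
    linarith

end

end Chain

/-! ### The chains of a convex polygon -/

/-- A linear functional with a strict minimum at z i keeps it out of the convex hull of the other
points. -/
lemma convexIndependent_of_wedge {n : ℕ} {z : Fin n → Plane}
    (h : ∀ i, ∃ d, ∀ m, m ≠ i → 0 < wedge d (z m - z i)) : ConvexIndependent ℝ z := by
  rw [convexIndependent_iff_notMem_convexHull_sdiff]
  intro i s hi
  obtain ⟨d, hd⟩ := h i
  have hsub : convexHull ℝ (z '' (s \ {i})) ⊆ {x | 0 < wedge d (x - z i)} := by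
    apply convexHull_min
    · rintro _ ⟨m, hm, rfl⟩
      exact hd m hm.2
    · intro x hx y hy a b ha hb hab
      have e : wedge d (a • x + b • y - z i) =
          a * wedge d (x - z i) + b * wedge d (y - z i) := by
        obtain rfl : b = 1 - a := by linarith
        simp only [wedge, PiLp.sub_apply, PiLp.add_apply, PiLp.smul_apply, smul_eq_mul]; ring
      change 0 < wedge d (a • x + b • y - z i)
      rw [e]
      rcases eq_or_lt_of_le ha with rfl | ha
      · rw [zero_add] at hab
        simpa [hab] using hy
      · exact add_pos_of_pos_of_nonneg (mul_pos ha hx) (mul_nonneg hb (le_of_lt hy))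
  have := hsub hi
  simp at this

lemma IsCCW.convexIndependent {n : ℕ} [NeZero n] {z : Fin n → Plane} (hz : IsCCW z)
    (hinj : Function.Injective z) : ConvexIndependent ℝ z := by
  apply convexIndependent_of_wedge
  intro i
  have hlift : ∀ m : Fin n, m ≠ i → ∃ a, 0 < a ∧ a < n ∧ z m = cyc z (i.val + n + a) := by
    intro m hm
    refine ⟨(m - i).val, Nat.pos_of_ne_zero fun h => hm (sub_eq_zero.1 (Fin.ext h)),
      (m - i).isLt, ?_⟩
    rw [add_right_comm, cyc_add_self, cyc, ofNat_add', Fin.ofNat_val_eq_self,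
      Fin.ofNat_val_eq_self, add_sub_cancel]
  have hi : z i = cyc z (i.val + n) := by rw [cyc_add_self, cyc_val]
  rcases lt_or_ge n 3 with hn | hn
  · by_cases hex : ∃ m, m ≠ i
    · obtain ⟨m, hm⟩ := hex
      -- With w = z m - z i, this is the quarter turn of w for which d ∧ w = |w|².
      refine ⟨WithLp.toLp 2 ![z m 1 - z i 1, -(z m 0 - z i 0)], fun k hk => ?_⟩
      have hkm : k = m := by
        have := Fin.val_ne_of_ne hk
        have := Fin.val_ne_of_ne hm
        ext; omega
      subst hkm
      have hne : z k ≠ z i := fun h => hk (hinj h)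
      simp only [wedge, PiLp.sub_apply, Matrix.cons_val_zero, Matrix.cons_val_one]
      have : z k 0 - z i 0 ≠ 0 ∨ z k 1 - z i 1 ≠ 0 := by
        by_contra! h
        exact hne (plane_ext (by linarith [h.1]) (by linarith [h.2]))
      rcases this with h | h
      · nlinarith [sq_nonneg (z k 1 - z i 1), mul_self_pos.2 h]
      · nlinarith [sq_nonneg (z k 0 - z i 0), mul_self_pos.2 h]
    · push Not at hex
      exact ⟨0, fun m hm => absurd (hex m) hm⟩
  · obtain ⟨c, hc⟩ : ∃ c, i.val + n = c + 1 := ⟨i.val + n - 1, by omega⟩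
    -- The sum of the two sides at the vertex. Each is nonnegative on the other vertices, and only a
    -- neighbour can annihilate one of them, not both.
    refine ⟨step z (c + 1) + step z c, fun m hm => ?_⟩
    obtain ⟨a, ha, han, e⟩ := hlift m hm
    rw [e, hi, hc, wedge_add_left, step, step, ← cross_eq_wedge', ← cross_eq_wedge]
    rcases eq_or_ne a 1 with rfl | h1
    · have := hz.cyc_pos (i := c) (j := c + 1) (k := c + 1 + 1) (by omega) (by omega) (by omega)
      have e : cross (cyc z (c + 1)) (cyc z (c + 1 + 1)) (cyc z (c + 1 + 1)) = 0 := by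
        simp only [cross]; ring
      linarith
    · have p1 := hz.cyc_pos (i := c + 1) (j := c + 1 + 1) (k := c + 1 + a) (by omega) (by omega)
        (by omega)
      rcases eq_or_ne (a + 1) n with h2 | h2
      · rw [show c + 1 + a = c + n by omega, cyc_add_self] at p1 ⊢
        have e : cross (cyc z c) (cyc z (c + 1)) (cyc z c) = 0 := by
          simp only [cross]; ring
        linarith
      · have p2 := hz.cyc_pos (i := c) (j := c + 1) (k := c + 1 + a) (by omega) (by omega)
          (by omega)
        linarith

/-- In a convex polygon, a vertex that is between the lowest and the rightmost one is above the
former and on the right of it. -/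
lemma wedge_pos_of_between {e f a q b : Plane} (hef : 0 < wedge e f)
    (hq : 0 < wedge e (q - a)) (hqb : 0 < wedge (b - q) f)
    (hb : 0 < wedge e (b - a)) (hab : 0 < wedge (b - a) f) (h : 0 < cross a q b) :
    0 < wedge (q - a) f ∧ 0 < wedge e (b - q) := by
  have h1 := wedge_pluecker e (q - a) (b - a) f
  rw [← cross_eq_wedge] at h1
  have q1 : 0 < wedge (q - a) f := by
    have : 0 < wedge e (b - a) * wedge (q - a) f := by
      rw [h1]; have := mul_pos hq hab; have := mul_pos hef h; linarith
    exact pos_of_mul_pos_right this hb.le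
  refine ⟨q1, ?_⟩
  have h2 := wedge_pluecker e (q - a) (b - q) f
  rw [← cross_eq_wedge'] at h2
  have : 0 < wedge e (b - q) * wedge (q - a) f := by
    rw [h2]; have := mul_pos hq hqb; have := mul_pos hef h; linarith
  exact pos_of_mul_pos_left this q1.le

/-- The case of a step between two inner vertices of a block. One of the two signs must be right,
and the Plücker relation with a neighbouring vector then forces the other. -/
lemma wedge_pos_of_between₂ {e f a p q b : Plane} (hef : 0 < wedge e f)
    (hp : 0 < wedge e (p - a)) (hpb : 0 < wedge (b - p) f)
    (hq : 0 < wedge e (q - a)) (hqb : 0 < wedge (b - q) f)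
    (hb : 0 < wedge e (b - a)) (hab : 0 < wedge (b - a) f) (h1 : 0 < cross a p b)
    (h2 : 0 < cross a q b) (h3 : 0 < cross a p q) (h4 : 0 < cross p q b) :
    0 < wedge e (q - p) ∧ 0 < wedge (q - p) f := by
  obtain ⟨p1, p2⟩ := wedge_pos_of_between hef hp hpb hb hab h1
  obtain ⟨q1, q2⟩ := wedge_pos_of_between hef hq hqb hb hab h2
  have k1 := wedge_pluecker e (p - a) (q - p) f
  have k2 := wedge_pluecker e (q - p) (b - q) f
  have k3 := wedge_pluecker e (q - a) (b - q) f
  have k4 := wedge_pluecker e (q - a) (q - p) f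
  have e4 : wedge (q - a) (q - p) = cross a p q := by
    simp only [wedge, cross, PiLp.sub_apply]; ring
  rw [← cross_eq_wedge'] at k1 k2 k3
  rw [e4] at k4
  have m1 := mul_pos hef h3
  have m2 := mul_pos hef h4
  have m3 := mul_pos hef h2
  -- If both signs were wrong, multiplying the relations for the pairs (q-p, b-q), (q-a, q-p) and
  -- (q-a, b-q) by suitable factors would give a contradictory chain of inequalities.
  have one : 0 < wedge e (q - p) ∨ 0 < wedge (q - p) f := by
    by_contra! hc
    obtain ⟨c1, c2⟩ := hc
    have i1 : wedge e (b - q) * wedge (q - p) f * wedge (q - a) f >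
        wedge e (q - p) * wedge (b - q) f * wedge (q - a) f :=
      mul_lt_mul_of_pos_right (by linarith) q1
    have i2 : wedge e (q - p) * wedge (q - a) f * wedge (b - q) f ≥
        wedge e (q - a) * wedge (q - p) f * wedge (b - q) f :=
      mul_le_mul_of_nonneg_right (by linarith) hqb.le
    have i3 : (wedge e (b - q) * wedge (q - a) f) * wedge (q - p) f ≤
        (wedge e (q - a) * wedge (b - q) f) * wedge (q - p) f :=
      mul_le_mul_of_nonpos_right (by linarith) c2
    linarith
  rcases one with h | h
  · refine ⟨h, ?_⟩
    have : 0 < wedge e (b - q) * wedge (q - p) f := by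
      rw [k2]; have := mul_pos h hqb; linarith
    exact pos_of_mul_pos_right this q2.le
  · refine ⟨?_, h⟩
    have : 0 < wedge e (q - p) * wedge (p - a) f := by
      rw [k1]; have := mul_pos hp h; linarith
    exact pos_of_mul_pos_left this p1.le

/-! ### From a counterclockwise tuple to its blocks -/

section

variable {κ : ℕ} [NeZero κ] {n : ℕ} [NeZero n] {v : Fin κ → Plane} {z : Fin n → Plane}
variable (hκ : 3 ≤ κ) (hv : IsConvexPolygon v)

include hκ hv in
lemma vertices_injective : Function.Injective v := by
  have key : ∀ i j : Fin κ, i < j → v i ≠ v j := by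
    intro i j hij h
    rcases eq_or_lt_of_le (show i.val + 1 ≤ j.val from hij) with h1 | h1
    · have : i + 1 = j := by
        rw [← Fin.ofNat_val_eq_self j, ← h1, ofNat_succ, Fin.ofNat_val_eq_self]
      have hp := sideLength_pos hκ hv i
      rw [sideLength, this, h, dist_self] at hp
      exact lt_irrefl _ hp
    · have := hv i ⟨i.val + 1, by omega⟩ j (by simp [Fin.lt_def]) (by simpa [Fin.lt_def] using h1)
      rw [h] at this
      have e : ∀ x, cross (v j) x (v j) = 0 := fun x => by simp only [cross]; ring
      rw [e] at this
      exact lt_irrefl _ this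
  intro i j h
  rcases lt_trichotomy i j with hij | hij | hij
  · exact absurd h (key i j hij)
  · exact hij
  · exact absurd h.symm (key j i hij)

include hκ hv in
/-- The open sectors between the directions of consecutive sides are disjoint. -/
lemma cone_unique {j m : Fin κ} {d : Plane} (hj : 0 < wedge (edge v j) d)
    (hj' : 0 < wedge d (edge v (j + 1))) (hm : 0 < wedge (edge v m) d)
    (hm' : 0 < wedge d (edge v (m + 1))) : j = m := by
  -- For d in the open sector j, the functional d ∧ · has its only minimum among the vertices at v
  -- (j+1), so d determines j.
  have key : ∀ {j : Fin κ}, 0 < wedge (edge v j) d → 0 < wedge d (edge v (j + 1)) → ∀ k,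
      0 ≤ wedge d (v k - v (j + 1)) ∧ (wedge d (v k - v (j + 1)) = 0 → v k = v (j + 1)) := by
    intro j h1 h2 k
    have hT := turn_pos hκ hv j
    have a1 := signedDist_vertex_nonneg hκ hv j k
    have a2 := signedDist_vertex_nonneg hκ hv (j + 1) k
    have b1 := signedDist_sub v j (v k) (v (j + 1))
    have b2 := signedDist_sub v (j + 1) (v k) (v (j + 1))
    rw [signedDist_succ_self, sub_zero] at b1
    rw [signedDist_self, sub_zero] at b2
    have e : wedge d (v k - v (j + 1)) = wedge d (edge v (j + 1)) / turn v j * signedDist v j (v k)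
        + wedge (edge v j) d / turn v j * signedDist v (j + 1) (v k) := by
      conv_lhs => rw [eq_smul_add_smul hT.ne' d]
      rw [wedge_add_left, wedge_smul_left, wedge_smul_left, ← b1, ← b2]; rfl
    have c1 := div_pos h2 hT
    have c2 := div_pos h1 hT
    rw [e]
    refine ⟨by positivity, fun h => ?_⟩
    have d1 := mul_nonneg c1.le a1
    have d2 := mul_nonneg c2.le a2
    have z1 : signedDist v j (v k) = 0 :=
      (mul_eq_zero.1 (by linarith)).resolve_left c1.ne'
    have z2 : signedDist v (j + 1) (v k) = 0 :=
      (mul_eq_zero.1 (by linarith)).resolve_left c2.ne'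
    exact eq_of_signedDist_eq hκ hv (z1.trans (signedDist_succ_self v j).symm)
      (z2.trans (signedDist_self v (j + 1)).symm)
  have k1 := key hj hj' (m + 1)
  have k2 := key hm hm' (j + 1)
  have e : wedge d (v (j + 1) - v (m + 1)) = -wedge d (v (m + 1) - v (j + 1)) := by
    simp only [wedge_sub_right]; ring
  have := k1.2 (by linarith [k1.1, k2.1])
  exact (add_left_injective 1 (vertices_injective hκ hv this)).symm

variable (hz : IsCCW z)
  (hc : ∀ j, ∀ i, i ≠ contactIndex v z j →
    signedDist v j (z (contactIndex v z j)) < signedDist v j (z i))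

omit [NeZero κ] in
lemma cyc_shift (k : Fin n) (m : ℕ) : cyc (fun i => z (i + k)) m = cyc z (k.val + m) := by
  rw [cyc, cyc, ofNat_add', Fin.ofNat_val_eq_self, add_comm]

lemma step_shift (k : Fin n) (m : ℕ) : step (fun i => z (i + k)) m = step z (k.val + m) := by
  rw [step, step, cyc_shift, cyc_shift, add_assoc]

lemma sizeVector_lt (j : Fin κ) : sizeVector v z j < n := Fin.isLt _

/-- The sizes are differences of consecutive contact indices in `Fin n`, hence their partial sums
telescope. -/
lemma ofNat_contact (m : ℕ) :
    Fin.ofNat n ((contactIndex v z 0).val + partialSum (sizeVector v z) m) =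
      contactIndex v z (Fin.ofNat κ m) := by
  induction m with
  | zero => rw [partialSum_zero, add_zero, Fin.ofNat_val_eq_self]; rfl
  | succ m ih =>
    rw [partialSum_succ, ← add_assoc, ofNat_add', ih, cyc, sizeVector, Fin.ofNat_val_eq_self,
      add_sub_cancel, ofNat_succ]

include hκ hv hz hc

/-- The block runs from the strict minimum for the side m to the strict minimum for the side m+1.
These two extremalities and the counterclockwise order confine its steps to the sector, with
separate cases for the first, the last and the inner steps. -/
lemma step_cone (m t : ℕ) (ht : t < cyc (sizeVector v z) m) :
    0 < wedge (cyc (edge v) m)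
      (step z ((contactIndex v z 0).val + partialSum (sizeVector v z) m + t)) ∧
    0 < wedge (step z ((contactIndex v z 0).val + partialSum (sizeVector v z) m + t))
      (cyc (edge v) (m + 1)) := by
  have hsn : cyc (sizeVector v z) m < n := sizeVector_lt _
  have hT := cyc_turn_pos hκ hv m
  have hK := ofNat_contact (v := v) (z := z) m
  have hK' := ofNat_contact (v := v) (z := z) (m + 1)
  rw [partialSum_succ, ← add_assoc] at hK'
  set K := (contactIndex v z 0).val + partialSum (sizeVector v z) m
  set c := cyc (sizeVector v z) m
  have ha : ∀ i, 0 < i → i < n → 0 < wedge (cyc (edge v) m) (cyc z (K + i) - cyc z K) := by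
    intro i h0 hi
    have : Fin.ofNat n (K + i) ≠ contactIndex v z (Fin.ofNat κ m) := by
      rw [← hK, Ne, ofNat_eq_iff]
      intro h
      have h' := Nat.ModEq.add_left_cancel' K (h.trans (by rw [add_zero] : K ≡ K + 0 [MOD n]))
      rw [Nat.ModEq, Nat.mod_eq_of_lt hi] at h'
      simp at h'; omega
    have h := hc _ _ this
    rw [← sub_pos, signedDist_sub, ← hK] at h
    exact h
  have hb : ∀ i, i < c → 0 < wedge (cyc z (K + c) - cyc z (K + i)) (cyc (edge v) (m + 1)) := by
    intro i hi
    have : Fin.ofNat n (K + i) ≠ contactIndex v z (Fin.ofNat κ (m + 1)) := by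
      rw [← hK', Ne, ofNat_eq_iff]
      intro h
      have h' := Nat.ModEq.add_left_cancel' K h
      rw [Nat.ModEq, Nat.mod_eq_of_lt (hi.trans hsn), Nat.mod_eq_of_lt hsn] at h'
      omega
    have h := hc _ _ this
    rw [← sub_pos, signedDist_sub, ← hK', wedge_comm, ← neg_sub, ← neg_one_smul ℝ (_ - _),
      wedge_smul_left, neg_one_mul, neg_neg] at h
    exact h
  have hb0 := hb 0 (by omega)
  rw [add_zero] at hb0
  rw [step, add_assoc]
  rcases Nat.eq_zero_or_pos t with rfl | ht0
  · rcases eq_or_lt_of_le (show 0 + 1 ≤ c from ht) with h1 | h1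
    · refine ⟨ha _ (by omega) (by omega), ?_⟩
      rw [h1]; exact hb0
    · refine ⟨ha _ (by omega) (by omega), ?_⟩
      exact (wedge_pos_of_between hT (ha _ (by omega) (by omega)) (hb _ h1)
        (ha _ (by omega) hsn) hb0 (hz.cyc_pos (by omega) (by omega) (by omega))).1
  · rcases eq_or_lt_of_le (show t + 1 ≤ c from ht) with h1 | h1
    · rw [h1]
      refine ⟨?_, hb _ ht⟩
      exact (wedge_pos_of_between hT (ha _ (by omega) (by omega)) (hb _ ht)
        (ha _ (by omega) hsn) hb0 (hz.cyc_pos (by omega) (by omega) (by omega))).2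
    · exact wedge_pos_of_between₂ hT (ha _ ht0 (by omega)) (hb _ ht) (ha _ (by omega) (by omega))
        (hb _ h1) (ha _ (by omega) hsn) hb0 (hz.cyc_pos (by omega) (by omega) (by omega))
        (hz.cyc_pos (by omega) (by omega) (by omega)) (hz.cyc_pos (by omega) (by omega) (by omega))
        (hz.cyc_pos (by omega) (by omega) (by omega))

lemma isBlockChain_shift :
    IsBlockChain v (sizeVector v z) (fun i => z (i + contactIndex v z 0)) := by
  intro j t ht
  have hcone := step_cone hκ hv hz hc j.val t (by rwa [cyc_val])
  have hsn : sizeVector v z j < n := sizeVector_lt j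
  simp only [step_shift, ← add_assoc]
  rw [cyc, cyc, ofNat_succ, Fin.ofNat_val_eq_self] at hcone
  refine ⟨hcone.2, ?_⟩
  by_cases h0 : t = 0
  · rw [if_pos h0]; exact hcone.1
  · rw [if_neg h0]
    obtain ⟨u, rfl⟩ := Nat.exists_eq_succ_of_ne_zero h0
    rw [show partialSum (sizeVector v z) j + u.succ - 1 = partialSum (sizeVector v z) j + u by omega,
      ← add_assoc]
    have := hz.cyc_pos (i := (contactIndex v z 0).val + partialSum (sizeVector v z) j + u)
      (j := (contactIndex v z 0).val + partialSum (sizeVector v z) j + u + 1)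
      (k := (contactIndex v z 0).val + partialSum (sizeVector v z) j + u + 1 + 1)
      (by omega) (by omega) (by omega)
    rw [cross_eq_wedge'] at this
    exact this

lemma sizeVector_mem (hfull : IsFullSided v z) : sizeVector v z ∈ sizeVectors κ n := by
  have hfull := (isFullSided_iff hκ hv).1 hfull
  have hne : ∀ j, sizeVector v z (j - 1) + sizeVector v z j ≠ 0 := by
    intro j h
    -- Two consecutive zeros would merge three contact points, and then c_{j+1} = 0, against
    -- full-sidedness.
    obtain ⟨j, rfl⟩ : ∃ i, i + 1 = j := ⟨j - 1, sub_add_cancel _ _⟩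
    rw [add_sub_cancel_right] at h
    have e : ∀ i, sizeVector v z i = 0 → contactIndex v z (i + 1) = contactIndex v z i :=
      fun i hi => sub_eq_zero.1 (Fin.ext hi)
    have e1 := e j (by omega)
    have e2 := e (j + 1) (by omega)
    have hm : ∀ i, minDist v z i = signedDist v i (z (contactIndex v z i)) := fun i => by
      apply minDist_eq_of_forall_le
      intro k
      by_cases hk : k = contactIndex v z i
      · rw [hk]
      · exact (hc i k hk).le
    have := add_eq_cOf hκ hv (hm (j + 1)).symm
    rw [hm j, hm (j + 1 + 1), e2, e1, sub_self, sub_self, zero_div, zero_div, add_zero] at this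
    exact (hfull (j + 1)).ne this
  refine ⟨?_, hne⟩
  set K := (contactIndex v z 0).val
  -- Disjointness of the sectors prevents a step from belonging to two blocks, so the sizes add up
  -- to at most n.
  have hinj : Function.Injective (fun p : Σ j : Fin κ, Fin (sizeVector v z j) =>
      Fin.ofNat n (K + partialSum (sizeVector v z) p.1 + p.2)) := by
    rintro ⟨j, t⟩ ⟨m, u⟩ h
    have hmod := (ofNat_eq_iff _ _).1 h
    have h1 := step_cone hκ hv hz hc j.val t.val (by rw [cyc_val]; exact t.isLt)
    have h2 := step_cone hκ hv hz hc m.val u.val (by rw [cyc_val]; exact u.isLt)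
    rw [← step_congr hmod] at h2
    simp only [cyc, ofNat_succ, Fin.ofNat_val_eq_self] at h1 h2
    obtain rfl := cone_unique hκ hv h1.1 h1.2 h2.1 h2.2
    have h3 := Nat.ModEq.add_left_cancel' _ hmod
    rw [Nat.ModEq, Nat.mod_eq_of_lt (t.isLt.trans (sizeVector_lt j)),
      Nat.mod_eq_of_lt (u.isLt.trans (sizeVector_lt j))] at h3
    rw [Fin.ext h3]
  have hle := Fintype.card_le_of_injective _ hinj
  rw [Fintype.card_sigma, Fintype.card_fin] at hle
  simp only [Fintype.card_fin] at hle
  -- After κ sides the contact index is back at its start, so the sum of the sizes is a multiple of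
  -- n. Being positive and at most n, it is n.
  have hdvd : n ∣ ∑ j, sizeVector v z j := by
    have h := ofNat_contact (v := v) (z := z) κ
    rw [Fin.ofNat_self, partialSum_self] at h
    have h' : Fin.ofNat n (K + ∑ j, sizeVector v z j) = Fin.ofNat n (K + 0) := by
      rw [h, add_zero, Fin.ofNat_val_eq_self]
    exact (Nat.modEq_zero_iff_dvd).1 (Nat.ModEq.add_left_cancel' _ ((ofNat_eq_iff _ _).1 h'))
  have hpos : ∑ j, sizeVector v z j ≠ 0 := by
    intro h
    rw [Finset.sum_eq_zero_iff] at h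
    exact hne 0 (by simp [h])
  exact le_antisymm hle (Nat.le_of_dvd (Nat.pos_of_ne_zero hpos) hdvd)

end

/-! ### Truncated powers and their convolution -/

/-- The truncated power `x₊ ^ m / m!`. -/
def truncPow (m : ℕ) (x : ℝ) : ENNReal := if 0 < x then ENNReal.ofReal (x ^ m / m !) else 0

lemma measurable_truncPow (m : ℕ) : Measurable (truncPow m) := by
  unfold truncPow
  exact Measurable.ite measurableSet_Ioi (by fun_prop) measurable_const

lemma truncPow_of_pos (m : ℕ) {x : ℝ} (hx : 0 < x) :
    truncPow m x = ENNReal.ofReal (x ^ m / m !) := if_pos hx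

lemma truncPow_of_nonpos (m : ℕ) {x : ℝ} (hx : x ≤ 0) : truncPow m x = 0 := if_neg (not_lt.2 hx)

lemma truncPow_mul (m : ℕ) {r x : ℝ} (hr : 0 < r) :
    truncPow m (r * x) = ENNReal.ofReal (r ^ m) * truncPow m x := by
  unfold truncPow
  by_cases hx : 0 < x
  · rw [if_pos hx, if_pos (mul_pos hr hx), ← ENNReal.ofReal_mul (by positivity), mul_pow,
      mul_div_assoc]
  · rw [if_neg hx, if_neg, mul_zero]
    intro h
    exact hx (pos_of_mul_pos_right h hr.le)

/-- The Beta integral: integration by parts moves one power from x to c - x, with b kept general. -/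
lemma integral_pow_mul_pow (c : ℝ) (a b : ℕ) :
    ∫ x in (0 : ℝ)..c, x ^ a / a ! * ((c - x) ^ b / b !) = c ^ (a + b + 1) / (a + b + 1)! := by
  induction a generalizing b with
  | zero =>
    have h : ∀ x ∈ Set.uIcc 0 c, HasDerivAt (fun x : ℝ => -((c - x) ^ (b + 1) / (b + 1)!))
        (x ^ 0 / 0 ! * ((c - x) ^ b / b !)) x := by
      intro x _
      have h1 := (((hasDerivAt_id x).const_sub c).pow (b + 1)).div_const ((b + 1)! : ℝ) |>.neg
      refine h1.congr_deriv ?_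
      rw [Nat.factorial_succ]; push_cast
      have : ((b : ℝ) + 1) ≠ 0 := by positivity
      have : (b ! : ℝ) ≠ 0 := by positivity
      simp; field_simp
    rw [intervalIntegral.integral_eq_sub_of_hasDerivAt h (by
      apply Continuous.intervalIntegrable; fun_prop)]
    simp
  | succ a ih =>
    have hu : ∀ x ∈ Set.uIcc 0 c, HasDerivAt (fun x : ℝ => x ^ (a + 1) / (a + 1)!)
        (x ^ a / a !) x := by
      intro x _
      refine ((hasDerivAt_pow (a + 1) x).div_const _).congr_deriv ?_
      rw [Nat.factorial_succ]; push_cast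
      have : ((a : ℝ) + 1) ≠ 0 := by positivity
      have : (a ! : ℝ) ≠ 0 := by positivity
      field_simp
    have hv : ∀ x ∈ Set.uIcc 0 c, HasDerivAt (fun x : ℝ => -((c - x) ^ (b + 1) / (b + 1)!))
        ((c - x) ^ b / b !) x := by
      intro x _
      have h1 := (((hasDerivAt_id x).const_sub c).pow (b + 1)).div_const ((b + 1)! : ℝ) |>.neg
      refine h1.congr_deriv ?_
      rw [Nat.factorial_succ]; push_cast
      have : ((b : ℝ) + 1) ≠ 0 := by positivity
      have : (b ! : ℝ) ≠ 0 := by positivity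
      simp; field_simp
    rw [intervalIntegral.integral_mul_deriv_eq_deriv_mul hu hv
      (by apply Continuous.intervalIntegrable; fun_prop)
      (by apply Continuous.intervalIntegrable; fun_prop)]
    simp only [mul_neg, intervalIntegral.integral_neg, ih]
    rw [show a + (b + 1) + 1 = a + 1 + b + 1 by ring]
    simp

/-- Truncated powers form a convolution semigroup. As they vanish at 0, even for exponent 0, the
integrand is supported in the open interval (0, c). -/
lemma lintegral_truncPow_mul_truncPow (a b : ℕ) (c : ℝ) :
    ∫⁻ x, truncPow a x * truncPow b (c - x) = truncPow (a + b + 1) c := by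
  have h0 : ∀ x, truncPow a x * truncPow b (c - x) =
      (Set.Ioo 0 c).indicator (fun x => ENNReal.ofReal (x ^ a / a ! * ((c - x) ^ b / b !))) x := by
    intro x
    by_cases hx : x ∈ Set.Ioo 0 c
    · rw [Set.indicator_of_mem hx, truncPow_of_pos a hx.1, truncPow_of_pos b (sub_pos.2 hx.2),
        ENNReal.ofReal_mul (by have := hx.1; positivity)]
    · rw [Set.indicator_of_notMem hx]
      rw [Set.mem_Ioo, not_and_or, not_lt, not_lt] at hx
      rcases hx with hx | hx
      · rw [truncPow_of_nonpos a hx, zero_mul]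
      · rw [truncPow_of_nonpos b (sub_nonpos.2 hx), mul_zero]
  simp only [h0]
  rw [lintegral_indicator measurableSet_Ioo]
  rcases le_or_gt c 0 with hc | hc
  · rw [Set.Ioo_eq_empty (not_lt.2 hc), truncPow_of_nonpos _ hc]; simp
  · rw [truncPow_of_pos _ hc, ← integral_pow_mul_pow, intervalIntegral.integral_of_le hc.le,
      integral_Ioc_eq_integral_Ioo,
      ofReal_integral_eq_lintegral_ofReal]
    · refine (Continuous.integrableOn_Icc (a := 0) (b := c) ?_).mono_set Set.Ioo_subset_Icc_self
      fun_prop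
    · refine (ae_restrict_mem measurableSet_Ioo).mono fun x hx => ?_
      have h1 := hx.1
      have h2 := sub_pos.2 hx.2
      change 0 ≤ x ^ a / a ! * ((c - x) ^ b / b !)
      positivity

/-! ### Linear coordinates of the plane -/

/-- The point with coordinates `p` in the frame with origin `o` and basis `d, f`. -/
def frame (o d f : Plane) (p : ℝ × ℝ) : Plane := o + (p.1 • d + p.2 • f)

lemma continuous_frame (o d f : Plane) : Continuous (frame o d f) := by
  unfold frame; fun_prop

lemma volume_eq_map_frame (o d f : Plane) (h : 0 < wedge d f) :
    (volume : Measure Plane) = ENNReal.ofReal (wedge d f) • Measure.map (frame o d f) volume := by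
  set M : Matrix (Fin 2) (Fin 2) ℝ := !![d 0, f 0; d 1, f 1] with hM
  have hdet : M.det = wedge d f := by
    rw [hM, Matrix.det_fin_two_of, wedge]; ring
  have h1 := Real.map_matrix_volume_pi_eq_smul_volume_pi (M := M) (by rw [hdet]; exact h.ne')
  have h2 := (EuclideanSpace.volume_preserving_symm_measurableEquiv_toLp (Fin 2)).symm
  have h3 := (volume_preserving_finTwoArrow ℝ).symm
  have e : frame o d f = (fun x => o + x) ∘ (MeasurableEquiv.toLp 2 (Fin 2 → ℝ)) ∘
      (Matrix.toLin' M) ∘ (MeasurableEquiv.finTwoArrow (α := ℝ)).symm := by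
    funext p
    apply plane_ext <;>
      simp [frame, hM, MeasurableEquiv.finTwoArrow]
  have m1 : Measurable (Matrix.toLin' M) :=
    (LinearMap.continuous_of_finiteDimensional (Matrix.toLin' M)).measurable
  have m2 : Measurable (MeasurableEquiv.toLp 2 (Fin 2 → ℝ)) := MeasurableEquiv.measurable _
  have m3 : Measurable (MeasurableEquiv.finTwoArrow (α := ℝ)).symm := MeasurableEquiv.measurable _
  have m4 : Measurable (fun x : Plane => o + x) := by fun_prop
  rw [e, ← Measure.map_map m4 (m2.comp (m1.comp m3)), ← Measure.map_map m2 (m1.comp m3),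
    ← Measure.map_map m1 m3, h3.map_eq, h1, Measure.map_smul, Measure.map_smul]
  have h2' := h2.map_eq
  rw [MeasurableEquiv.symm_symm] at h2'
  rw [h2', map_add_left_eq_self, smul_smul, hdet, abs_of_pos (inv_pos.2 h), ← ENNReal.ofReal_mul h.le,
    mul_inv_cancel₀ h.ne', ENNReal.ofReal_one, one_smul]

lemma lintegral_frame (o d f : Plane) (h : 0 < wedge d f) {F : Plane → ENNReal}
    (hF : Measurable F) :
    ∫⁻ w, F w = ENNReal.ofReal (wedge d f) * ∫⁻ x : ℝ, ∫⁻ y : ℝ, F (o + (x • d + y • f)) := by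
  rw [volume_eq_map_frame o d f h, lintegral_smul_measure, smul_eq_mul,
    lintegral_map hF (continuous_frame o d f).measurable]
  congr 1
  exact lintegral_prod _ (hF.comp (continuous_frame o d f).measurable).aemeasurable

/-! ### The volume of convex chains -/

/-- The points `q` are the intermediate vertices of a convex chain from `a` to `b`, whose steps turn
to the left, starting from the direction `d` and not reaching the direction `f`. -/
def IsChain (f : Plane) : (m : ℕ) → (d a b : Plane) → (Fin m → Plane) → Prop
  | 0, d, a, b, _ => 0 < wedge (b - a) f ∧ 0 < wedge d (b - a)
  | m + 1, d, a, b, q => (0 < wedge (q 0 - a) f ∧ 0 < wedge d (q 0 - a)) ∧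
      IsChain f m (q 0 - a) (q 0) b (Fin.tail q)

/-- The recursive form serves the induction on the volume, while the sequence P with both ends
included matches the steps of a block. -/
lemma isChain_iff (f : Plane) (m : ℕ) (d a b : Plane) (q : Fin m → Plane) (P : ℕ → Plane)
    (h0 : P 0 = a) (hq : ∀ t : Fin m, P (t + 1) = q t) (hb : P (m + 1) = b) :
    IsChain f m d a b q ↔ ∀ t, t < m + 1 → 0 < wedge (P (t + 1) - P t) f ∧
      0 < wedge (if t = 0 then d else P t - P (t - 1)) (P (t + 1) - P t) := by
  induction m generalizing d a P with
  | zero =>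
    rw [IsChain, ← h0, ← hb]
    constructor
    · intro h t ht
      obtain rfl : t = 0 := by omega
      simpa using h
    · intro h
      simpa using h 0 (by omega)
  | succ m ih =>
    have hq0 : P 1 = q 0 := hq 0
    rw [IsChain, ih (q 0 - a) (q 0) (Fin.tail q) (fun t => P (t + 1)) hq0
      (fun t => hq t.succ) hb]
    constructor
    · rintro ⟨h1, h2⟩ t ht
      rcases t with _ | t
      · simpa [hq0, h0] using h1
      · have := h2 t (by omega)
        refine ⟨this.1, ?_⟩
        rcases t with _ | t
        · simpa [hq0, h0] using this.2
        · simpa using this.2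
    · intro h
      refine ⟨by simpa [hq0, h0] using h 0 (by omega), fun t ht => ?_⟩
      have := h (t + 1) (by omega)
      refine ⟨this.1, ?_⟩
      rcases t with _ | t
      · simpa [hq0, h0] using this.2
      · simpa using this.2

lemma measurable_wedge {α : Type*} [MeasurableSpace α] {f g : α → Plane} (hf : Measurable f)
    (hg : Measurable g) : Measurable fun x => wedge (f x) (g x) := by
  have h : ∀ i : Fin 2, Measurable fun p : Plane => p i := fun i => by fun_prop
  have hf' := fun i => (h i).comp hf
  have hg' := fun i => (h i).comp hg
  exact ((hf' 0).mul (hg' 1)).sub ((hf' 1).mul (hg' 0))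

lemma measurableSet_wedge_pos {α : Type*} [MeasurableSpace α] {f g : α → Plane} (hf : Measurable f)
    (hg : Measurable g) : MeasurableSet {x | 0 < wedge (f x) (g x)} :=
  measurableSet_lt measurable_const (measurable_wedge hf hg)

lemma measurableSet_isChain {α : Type*} [MeasurableSpace α] (f : Plane) (m : ℕ)
    {d a b : α → Plane} {q : α → Fin m → Plane} (hd : Measurable d) (ha : Measurable a)
    (hb : Measurable b) (hq : Measurable q) :
    MeasurableSet {x | IsChain f m (d x) (a x) (b x) (q x)} := by
  induction m generalizing d a with
  | zero =>
    exact (measurableSet_wedge_pos (hb.sub ha) measurable_const).inter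
      (measurableSet_wedge_pos hd (hb.sub ha))
  | succ m ih =>
    have hq0 : Measurable fun x => q x 0 := (measurable_pi_apply 0).comp hq
    have ht : Measurable fun x => Fin.tail (q x) :=
      measurable_pi_lambda _ fun i => (measurable_pi_apply _).comp hq
    exact ((measurableSet_wedge_pos (hq0.sub ha) measurable_const).inter
      (measurableSet_wedge_pos hd (hq0.sub ha))).inter (ih (hq0.sub ha) hq0 ht)

lemma lintegral_truncPow_zero_mul (m : ℕ) {r : ℝ} (hr : 0 < r) (Y : ℝ) :
    ∫⁻ y, truncPow 0 y * truncPow m (Y - r * y) = ENNReal.ofReal r⁻¹ * truncPow (m + 1) Y := by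
  have h1 := lintegral_truncPow_mul_truncPow 0 m Y
  have h2 : ∫⁻ y, truncPow 0 (r * y) * truncPow m (Y - r * y) =
      ∫⁻ y, truncPow 0 y * truncPow m (Y - y) ∂(Measure.map (fun y => r * y) volume) := by
    rw [lintegral_map _ (measurable_const_mul r)]
    exact (measurable_truncPow 0).mul ((measurable_truncPow m).comp (by fun_prop))
  have h3 : ∀ y, truncPow 0 (r * y) = truncPow 0 y := fun y => by
    rw [truncPow_mul 0 hr]; simp
  simp only [h3] at h2
  rw [h2, Real.map_volume_mul_left hr.ne', lintegral_smul_measure, h1,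
    abs_of_pos (inv_pos.2 hr), zero_add, smul_eq_mul]

/-- The integral over the first vertex a + x d + y f. The y-integral yields the factor x / X; the
powers of x cancel except for that one, and a Beta integral in x remains. -/
lemma lintegral_chain_step (m : ℕ) {X : ℝ} (Y : ℝ) :
    ∫⁻ x, ∫⁻ y, truncPow 0 x * truncPow 0 y *
      (ENNReal.ofReal (x ^ m) * truncPow m ((X - x) / x) * truncPow m (Y - X / x * y)) =
    ENNReal.ofReal (1 / (m + 2)) * truncPow (m + 1) X * truncPow (m + 1) Y := by
  rcases le_or_gt X 0 with hX | hX
  · rw [truncPow_of_nonpos _ hX, mul_zero, zero_mul]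
    have : ∀ x y, truncPow 0 x * truncPow 0 y *
      (ENNReal.ofReal (x ^ m) * truncPow m ((X - x) / x) * truncPow m (Y - X / x * y)) = 0 := by
      intro x y
      rcases le_or_gt x 0 with hx | hx
      · rw [truncPow_of_nonpos 0 hx]; simp
      · rw [truncPow_of_nonpos m (div_nonpos_of_nonpos_of_nonneg (by linarith) hx.le)]; simp
    simp [this]
  · have h1 : ∀ x, ∫⁻ y, truncPow 0 x * truncPow 0 y *
        (ENNReal.ofReal (x ^ m) * truncPow m ((X - x) / x) * truncPow m (Y - X / x * y)) =
        ENNReal.ofReal X⁻¹ * truncPow (m + 1) Y * (truncPow 1 x * truncPow m (X - x)) := by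
      intro x
      rcases le_or_gt x 0 with hx | hx
      · simp [truncPow_of_nonpos _ hx]
      · have e : truncPow m ((X - x) / x) = ENNReal.ofReal ((x ^ m)⁻¹) * truncPow m (X - x) := by
          rw [div_eq_inv_mul, truncPow_mul m (inv_pos.2 hx), inv_pow]
        have e' : ∀ y, truncPow 0 x * truncPow 0 y *
            (ENNReal.ofReal (x ^ m) * truncPow m ((X - x) / x) * truncPow m (Y - X / x * y)) =
            truncPow m (X - x) * (truncPow 0 y * truncPow m (Y - X / x * y)) := by
          intro y
          rw [e, ← mul_assoc (ENNReal.ofReal (x ^ m)), ← ENNReal.ofReal_mul (by positivity),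
            mul_inv_cancel₀ (by positivity), truncPow_of_pos 0 hx]
          simp; ring
        simp only [e']
        rw [lintegral_const_mul _ (by
          exact (measurable_truncPow 0).mul ((measurable_truncPow m).comp (by fun_prop))),
          lintegral_truncPow_zero_mul m (div_pos hX hx), truncPow_of_pos 1 hx]
        rw [inv_div, div_eq_mul_inv, mul_comm x, ENNReal.ofReal_mul (by positivity)]
        simp; ring
    simp only [h1]
    rw [lintegral_const_mul _ (by
      exact (measurable_truncPow 1).mul ((measurable_truncPow m).comp (by fun_prop))),
      lintegral_truncPow_mul_truncPow, truncPow_of_pos _ hX, truncPow_of_pos _ hX]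
    have : X⁻¹ * (X ^ (1 + m + 1) / (1 + m + 1)!) = 1 / (m + 2) * (X ^ (m + 1) / (m + 1)!) := by
      rw [show 1 + m + 1 = (m + 1) + 1 by ring, Nat.factorial_succ (m + 1)]
      push_cast
      field_simp
      ring
    rw [mul_right_comm, ← ENNReal.ofReal_mul (by positivity), this,
      ENNReal.ofReal_mul (by positivity)]

/-- The volume of the set of convex chains with `m` intermediate vertices. -/
theorem volume_isChain (f : Plane) (m : ℕ) (d a b : Plane) (h : 0 < wedge d f) :
    volume {q : Fin m → Plane | IsChain f m d a b q} =
      ENNReal.ofReal (wedge d f ^ m / (m + 1)!) * truncPow m (wedge (b - a) f / wedge d f) *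
        truncPow m (wedge d (b - a) / wedge d f) := by
  induction m generalizing d a with
  | zero =>
    have e : ∀ x : ℝ, truncPow 0 (x / wedge d f) = if 0 < x then 1 else 0 := by
      intro x
      simp only [truncPow, div_pos_iff_of_pos_right h]; simp
    rw [e, e]
    by_cases hc : 0 < wedge (b - a) f ∧ 0 < wedge d (b - a)
    · have : {q : Fin 0 → Plane | IsChain f 0 d a b q} = Set.univ :=
        Set.eq_univ_of_forall fun _ => hc
      rw [this, if_pos hc.1, if_pos hc.2]
      simp [volume_pi]
    · have : {q : Fin 0 → Plane | IsChain f 0 d a b q} = ∅ :=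
        Set.eq_empty_of_forall_notMem fun _ => hc
      rw [this]
      rw [not_and_or] at hc
      rcases hc with hc | hc <;> simp [hc]
  | succ m ih =>
    have hS : MeasurableSet {q : Fin (m + 1) → Plane | IsChain f (m + 1) d a b q} :=
      measurableSet_isChain f _ measurable_const measurable_const measurable_const measurable_id
    have hmp := (volume_preserving_piFinSuccAbove (fun _ : Fin (m + 1) => Plane) 0).symm
    have hS' : MeasurableSet ((MeasurableEquiv.piFinSuccAbove (fun _ : Fin (m + 1) => Plane) 0).symm ⁻¹'
      {q : Fin (m + 1) → Plane | IsChain f (m + 1) d a b q}) :=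
      (MeasurableEquiv.measurable _) hS
    rw [← hmp.measure_preimage hS.nullMeasurableSet, Measure.volume_eq_prod,
      Measure.prod_apply hS']
    have hmeas := measurable_measure_prodMk_left (ν := (volume : Measure (Fin m → Plane))) hS'
    rw [lintegral_frame a d f h hmeas]
    have hK := h
    set K := wedge d f
    set X := wedge (b - a) f / K with hX
    set Y := wedge d (b - a) / K with hY
    -- After the step w = x d + y f the frame is (w, f), with w ∧ f = x K. The remaining
    -- displacement has coordinates (X - x)/x and Y - (X/x) y.
    have key : ∀ x y : ℝ, volume (Prod.mk (a + (x • d + y • f)) ⁻¹'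
        ((MeasurableEquiv.piFinSuccAbove (fun _ : Fin (m + 1) => Plane) 0).symm ⁻¹'
          {q : Fin (m + 1) → Plane | IsChain f (m + 1) d a b q})) =
        ENNReal.ofReal (K ^ m / (m + 1)!) * (truncPow 0 x * truncPow 0 y *
          (ENNReal.ofReal (x ^ m) * truncPow m ((X - x) / x) * truncPow m (Y - X / x * y))) := by
      intro x y
      have w1 : wedge (x • d + y • f) f = x * K := by
        rw [wedge_add_left, wedge_smul_left, wedge_smul_left, wedge_self]; ring
      have w2 : wedge d (x • d + y • f) = y * K := by
        rw [wedge_add_right, wedge_smul_right, wedge_smul_right, wedge_self]; ring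
      have hset : (Prod.mk (a + (x • d + y • f)) ⁻¹'
          ((MeasurableEquiv.piFinSuccAbove (fun _ : Fin (m + 1) => Plane) 0).symm ⁻¹'
            {q : Fin (m + 1) → Plane | IsChain f (m + 1) d a b q})) =
          {q : Fin m → Plane | (0 < x ∧ 0 < y) ∧
            IsChain f m (x • d + y • f) (a + (x • d + y • f)) b q} := by
        ext q
        have e0 : (MeasurableEquiv.piFinSuccAbove (fun _ : Fin (m + 1) => Plane) 0).symm
            (a + (x • d + y • f), q) = Fin.cons (a + (x • d + y • f)) q := by
          simp [MeasurableEquiv.piFinSuccAbove, Fin.insertNthEquiv]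
        simp only [Set.mem_preimage, Set.mem_ofPred_eq, e0, IsChain, Fin.cons_zero, Fin.tail_cons,
          add_sub_cancel_left, w1, w2, mul_pos_iff_of_pos_right hK]
      rw [hset]
      by_cases hx : 0 < x
      · by_cases hy : 0 < y
        · simp only [hx, hy, true_and]
          rw [ih _ _ (by rw [w1]; positivity), w1, truncPow_of_pos 0 hx, truncPow_of_pos 0 hy]
          have d1 : wedge (b - (a + (x • d + y • f))) f / (x * K) = (X - x) / x := by
            rw [← sub_sub, wedge_sub_left, w1, hX]; field_simp
          have d2 : wedge (x • d + y • f) (b - (a + (x • d + y • f))) / (x * K) =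
              Y - X / x * y := by
            rw [← sub_sub, wedge_sub_right, wedge_self, wedge_add_left, wedge_smul_left,
              wedge_smul_left, wedge_comm f, hX, hY]
            field_simp; ring
          rw [d1, d2, mul_pow, mul_comm (x ^ m), mul_div_right_comm,
            ENNReal.ofReal_mul (by positivity)]
          simp; ring
        · rw [truncPow_of_nonpos 0 (not_lt.1 hy)]
          simp [hy]
      · rw [truncPow_of_nonpos 0 (not_lt.1 hx)]
        simp [hx]
    simp only [key]
    have hm : ∀ x, Measurable fun y => truncPow 0 x * truncPow 0 y *
          (ENNReal.ofReal (x ^ m) * truncPow m ((X - x) / x) * truncPow m (Y - X / x * y)) :=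
      fun x => (measurable_const.mul (measurable_truncPow 0)).mul
        (measurable_const.mul ((measurable_truncPow m).comp (by fun_prop)))
    simp only [lintegral_const_mul _ (hm _)]
    rw [lintegral_const_mul' _ _ ENNReal.ofReal_ne_top, lintegral_chain_step, ← mul_assoc, ← mul_assoc,
      ← mul_assoc, ← ENNReal.ofReal_mul hK.le, ← ENNReal.ofReal_mul (by positivity)]
    congr 3
    rw [Nat.factorial_succ (m + 1)]
    push_cast
    field_simp
    ring

/-! ### Product measures -/

lemma prod_subtype_eq_ite {ι M : Type*} [Fintype ι] [CommMonoid M] (p : ι → Prop) [DecidablePred p]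
    (f : ι → M) : ∏ x : {x // p x}, f x = ∏ x, if p x then f x else 1 := by
  rw [← Finset.prod_filter]
  exact (Finset.prod_subtype _ (by simp) f).symm

lemma lintegral_fin_prod {n : ℕ} (f : Fin n → ℝ → ENNReal) (hf : ∀ i, Measurable (f i)) :
    ∫⁻ x : Fin n → ℝ, ∏ i, f i (x i) = ∏ i, ∫⁻ t, f i t := by
  induction n with
  | zero => simp [volume_pi]
  | succ n ih =>
    have hmp := (volume_preserving_piFinSuccAbove (fun _ : Fin (n + 1) => ℝ) 0).symm
    have hm : Measurable fun x : Fin n → ℝ => ∏ i, f i.succ (x i) :=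
      Finset.measurable_prod _ fun i _ => (hf _).comp (measurable_pi_apply i)
    have hF : Measurable fun x : Fin (n + 1) → ℝ => ∏ i, f i (x i) :=
      Finset.measurable_prod _ fun i _ => (hf i).comp (measurable_pi_apply i)
    rw [← hmp.lintegral_comp hF, Measure.volume_eq_prod, Fin.prod_univ_succ, ← ih _ fun i => hf i.succ,
      ← lintegral_prod_mul (hf 0).aemeasurable hm.aemeasurable]
    refine lintegral_congr fun p => ?_
    have e0 : (MeasurableEquiv.piFinSuccAbove (fun _ : Fin (n + 1) => ℝ) 0).symm p =
        Fin.cons p.1 p.2 := by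
      simp [MeasurableEquiv.piFinSuccAbove, Fin.insertNthEquiv]
    rw [e0, Fin.prod_univ_succ]
    simp

/-- Tonelli's theorem for a product of functions of one variable. -/
lemma lintegral_fintype_prod {ι : Type*} [Fintype ι] (f : ι → ℝ → ENNReal)
    (hf : ∀ i, Measurable (f i)) :
    ∫⁻ x : ι → ℝ, ∏ i, f i (x i) = ∏ i, ∫⁻ t, f i t := by
  have e := (Fintype.equivFin ι).symm
  have hmp := volume_measurePreserving_piCongrLeft (fun _ : ι => ℝ) e
  have hF : Measurable fun x : ι → ℝ => ∏ i, f i (x i) :=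
    Finset.measurable_prod _ fun i _ => (hf i).comp (measurable_pi_apply i)
  rw [← hmp.lintegral_comp hF, ← e.prod_comp, ← lintegral_fin_prod _ fun i => hf (e i)]
  refine lintegral_congr fun x => ?_
  rw [← e.prod_comp]
  refine Finset.prod_congr rfl fun i _ => ?_
  rw [MeasurableEquiv.piCongrLeft_apply_apply]

/-- The points `z` given by two families, one of them in groups. -/
def assemble {X I J T : Type*} {K : J → Type*} (g : T ≃ I ⊕ (Σ j, K j))
    (p : (I → X) × (∀ j, K j → X)) (t : T) : X :=
  Sum.elim p.1 (fun i => p.2 i.1 i.2) (g t)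

lemma measurePreserving_assemble {X I J T : Type*} {K : J → Type*} [Fintype I] [Fintype J]
    [Fintype T] [∀ j, Fintype (K j)] [MeasureSpace X] [SigmaFinite (volume : Measure X)]
    (g : T ≃ I ⊕ (Σ j, K j)) :
    MeasurePreserving (assemble (X := X) g) volume volume := by
  have hm : Measurable (assemble (X := X) g) := by
    refine measurable_pi_lambda _ fun t => ?_
    rcases h : g t with i | i
    · have : (fun p => assemble (X := X) g p t) = fun p => p.1 i := by
        funext p; rw [assemble, h]; rfl
      rw [this]; fun_prop
    · have : (fun p => assemble (X := X) g p t) = fun p => p.2 i.1 i.2 := by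
        funext p; rw [assemble, h]; rfl
      rw [this]; fun_prop
  refine ⟨hm, ?_⟩
  symm
  refine Measure.pi_eq fun s hs => ?_
  rw [Measure.map_apply hm (MeasurableSet.univ_pi hs)]
  have hset : assemble (X := X) g ⁻¹' (Set.univ.pi s) =
      (Set.univ.pi fun i => s (g.symm (Sum.inl i))) ×ˢ
        (Set.univ.pi fun j => Set.univ.pi fun k => s (g.symm (Sum.inr ⟨j, k⟩))) := by
    ext p
    simp only [Set.mem_preimage, Set.mem_univ_pi, Set.mem_prod, assemble]
    constructor
    · intro h
      exact ⟨fun i => by simpa using h (g.symm (Sum.inl i)),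
        fun j k => by simpa using h (g.symm (Sum.inr ⟨j, k⟩))⟩
    · rintro ⟨h1, h2⟩ t
      rcases h : g t with i | i
      · have : t = g.symm (Sum.inl i) := by rw [← h, Equiv.symm_apply_apply]
        rw [this]; exact h1 i
      · have : t = g.symm (Sum.inr i) := by rw [← h, Equiv.symm_apply_apply]
        rw [this]; exact h2 i.1 i.2
  rw [hset, Measure.volume_eq_prod, Measure.prod_prod, volume_pi_pi, volume_pi_pi]
  simp only [volume_pi_pi]
  rw [← g.symm.prod_comp, Fintype.prod_sum_type, Fintype.prod_sigma]

lemma volume_eq_map_pi {ι X Y : Type*} [Fintype ι] [MeasureSpace X] [MeasureSpace Y]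
    [SigmaFinite (volume : Measure X)] [SigmaFinite (volume : Measure Y)] {c : ι → ENNReal}
    {g : ι → X → Y} (hg : ∀ i, Measurable (g i))
    (h : ∀ i, (volume : Measure Y) = c i • Measure.map (g i) volume) :
    (volume : Measure (ι → Y)) =
      (∏ i, c i) • Measure.map (fun (p : ι → X) i => g i (p i)) volume := by
  refine Measure.pi_eq fun s hs => ?_
  have hm : Measurable fun (p : ι → X) i => g i (p i) :=
    measurable_pi_lambda _ fun i => (hg i).comp (measurable_pi_apply i)
  rw [Measure.smul_apply, Measure.map_apply hm (MeasurableSet.univ_pi hs), smul_eq_mul]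
  have : (fun (p : ι → X) i => g i (p i)) ⁻¹' (Set.univ.pi s) =
      Set.univ.pi fun i => g i ⁻¹' s i := by
    ext p; simp
  rw [this, volume_pi_pi, ← Finset.prod_mul_distrib]
  refine Finset.prod_congr rfl fun i _ => ?_
  rw [h i, Measure.smul_apply, Measure.map_apply (hg i) (hs i), smul_eq_mul]

/-- Splitting a family of real numbers into a family of pairs. -/
lemma measurePreserving_pairs {α β ι : Type*} [Fintype α] [Fintype β] [Fintype ι]
    (g : ι ⊕ ι ≃ α ⊕ β) :
    MeasurePreserving (fun (p : (α → ℝ) × (β → ℝ)) (j : ι) =>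
      ((Sum.elim p.1 p.2 (g (Sum.inl j)), Sum.elim p.1 p.2 (g (Sum.inr j))) : ℝ × ℝ))
      volume volume := by
  have h1 := volume_measurePreserving_sumPiEquivProdPi_symm (fun _ : α ⊕ β => ℝ)
  have h2 := volume_measurePreserving_piCongrLeft (fun _ : ι ⊕ ι => ℝ) g.symm
  have h3 := volume_measurePreserving_sumPiEquivProdPi (fun _ : ι ⊕ ι => ℝ)
  have h4 := (volume_measurePreserving_arrowProdEquivProdArrow ℝ ℝ ι).symm
  have h := h4.comp (h3.comp (h2.comp h1))
  have e : ∀ (f : α ⊕ β → ℝ) (i : ι ⊕ ι),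
      (MeasurableEquiv.piCongrLeft (fun _ : ι ⊕ ι => ℝ) g.symm) f i = f (g i) := by
    intro f i
    obtain ⟨k, rfl⟩ := g.symm.surjective i
    rw [MeasurableEquiv.piCongrLeft_apply_apply, Equiv.apply_symm_apply]
  have e2 : ∀ (q : ι ⊕ ι → ℝ) (j : ι), ((MeasurableEquiv.arrowProdEquivProdArrow ℝ ℝ ι).symm
      ((MeasurableEquiv.sumPiEquivProdPi (fun _ : ι ⊕ ι => ℝ)) q)) j =
      (q (Sum.inl j), q (Sum.inr j)) := fun q j => rfl
  have e3 : ∀ (p : (α → ℝ) × (β → ℝ)) i,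
      (MeasurableEquiv.sumPiEquivProdPi (fun _ : α ⊕ β => ℝ)).symm p i = Sum.elim p.1 p.2 i := by
    rintro p (i | i) <;> rfl
  have hfun : (fun (p : (α → ℝ) × (β → ℝ)) (j : ι) =>
      ((Sum.elim p.1 p.2 (g (Sum.inl j)), Sum.elim p.1 p.2 (g (Sum.inr j))) : ℝ × ℝ)) =
      (MeasurableEquiv.arrowProdEquivProdArrow ℝ ℝ ι).symm ∘
        (MeasurableEquiv.sumPiEquivProdPi (fun _ : ι ⊕ ι => ℝ)) ∘
        (MeasurableEquiv.piCongrLeft (fun _ : ι ⊕ ι => ℝ) g.symm) ∘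
        (MeasurableEquiv.sumPiEquivProdPi (fun _ : α ⊕ β => ℝ)).symm := by
    funext p j
    simp only [Function.comp_apply, e2, e, e3]
  rw [hfun]
  exact h

/-- The position on a side is (t - l)/r when t is the distance to the previous side, so each
integrated position costs a sine r. -/
lemma lintegral_truncPow_affine (a b : ℕ) (c l : ℝ) {r : ℝ} (hr : 0 < r) :
    ∫⁻ t, truncPow a ((t - l) / r) * truncPow b (c - (t - l) / r) =
      ENNReal.ofReal r * truncPow (a + b + 1) c := by
  have hm : Measurable fun y => truncPow a y * truncPow b (c - y) :=
    (measurable_truncPow a).mul ((measurable_truncPow b).comp (by fun_prop))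
  have h1 : ∫⁻ t, truncPow a ((t - l) / r) * truncPow b (c - (t - l) / r) =
      ∫⁻ t, truncPow a (t / r) * truncPow b (c - t / r) :=
    lintegral_sub_right_eq_self (fun t => truncPow a (t / r) * truncPow b (c - t / r)) l
  have h2 : ∫⁻ t, truncPow a (t / r) * truncPow b (c - t / r) =
      ∫⁻ y, truncPow a y * truncPow b (c - y) ∂(Measure.map (fun y => r⁻¹ * y) volume) := by
    rw [lintegral_map hm (measurable_const_mul _)]
    simp only [div_eq_inv_mul]
  rw [h1, h2, Real.map_volume_mul_left (inv_pos.2 hr).ne', lintegral_smul_measure,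
    lintegral_truncPow_mul_truncPow, inv_inv, abs_of_pos hr, smul_eq_mul]

/-! ### The volume of the block chains -/

section BlockVolume

variable {κ : ℕ} [NeZero κ] {n : ℕ} [NeZero n] {v : Fin κ → Plane} {s : Fin κ → ℕ}

section Index

variable (hs : s ∈ sizeVectors κ n)
include hs

omit [NeZero n] in
lemma partialSum_add_lt {j : Fin κ} {t : ℕ} (ht : t < s j) : partialSum s j + t < n := by
  have h1 : partialSum s (j.val + 1) ≤ partialSum s κ := partialSum_mono j.isLt
  rw [partialSum_succ, cyc_val, partialSum_self, hs.1] at h1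
  omega

omit hs [NeZero n] in
lemma partialSum_add_inj {j m : Fin κ} {t u : ℕ} (ht : t < s j) (hu : u < s m)
    (h : partialSum s j + t = partialSum s m + u) : j = m ∧ t = u := by
  have key : ∀ {j m : Fin κ} {t u : ℕ}, t < s j → j < m →
      partialSum s j + t < partialSum s m + u := by
    intro j m t u ht hjm
    have h1 : partialSum s (j.val + 1) ≤ partialSum s m := partialSum_mono hjm
    rw [partialSum_succ, cyc_val] at h1
    omega
  rcases lt_trichotomy j m with hjm | rfl | hjm
  · exact absurd h (key ht hjm).ne
  · exact ⟨rfl, by omega⟩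
  · exact absurd h (key hu hjm).ne'

/-- Injectivity suffices, by counting: a nonempty block has one first point and s_j - 1 others. For
an empty block the truncated difference s_j - 1 is also 0. -/
lemma indexMap_bijective : Function.Bijective
    (Sum.elim (fun j : {j // s j ≠ 0} => Fin.ofNat n (partialSum s j.1))
      (fun p : Σ j : Fin κ, Fin (s j - 1) => Fin.ofNat n (partialSum s p.1 + (p.2 + 1)))) := by
  rw [Fintype.bijective_iff_injective_and_card]
  constructor
  · have hlt1 : ∀ j : {j // s j ≠ 0}, partialSum s j.1 + 0 < n :=
      fun j => partialSum_add_lt hs (Nat.pos_of_ne_zero j.2)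
    have hlt2 : ∀ p : Σ j : Fin κ, Fin (s j - 1), partialSum s p.1 + (p.2 + 1) < n :=
      fun p => partialSum_add_lt hs (by have := p.2.isLt; omega)
    have heq : ∀ {a b : ℕ}, a < n → b < n → Fin.ofNat n a = Fin.ofNat n b → a = b := by
      intro a b ha hb h
      have := (ofNat_eq_iff _ _).1 h
      rwa [Nat.ModEq, Nat.mod_eq_of_lt ha, Nat.mod_eq_of_lt hb] at this
    rintro (j | p) (m | q) h
    · have := heq (hlt1 j) (hlt1 m) h
      have := partialSum_add_inj (Nat.pos_of_ne_zero j.2) (Nat.pos_of_ne_zero m.2) this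
      rw [Subtype.ext this.1]
    · have := heq (hlt1 j) (hlt2 q) h
      have := partialSum_add_inj (Nat.pos_of_ne_zero j.2) (by have := q.2.isLt; omega) this
      omega
    · have := heq (hlt2 p) (hlt1 m) h
      have := partialSum_add_inj (by have := p.2.isLt; omega) (Nat.pos_of_ne_zero m.2) this
      omega
    · have := heq (hlt2 p) (hlt2 q) h
      obtain ⟨p1, p2⟩ := p
      obtain ⟨q1, q2⟩ := q
      obtain ⟨rfl, h2⟩ := partialSum_add_inj (j := p1) (m := q1) (t := p2 + 1) (u := q2 + 1)
        (by have := p2.isLt; omega) (by have := q2.isLt; omega) this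
      have : p2 = q2 := Fin.ext (by omega)
      rw [this]
  · rw [Fintype.card_sum, Fintype.card_sigma, Fintype.card_subtype, Finset.card_filter,
      Fintype.card_fin]
    simp only [Fintype.card_fin]
    rw [← Finset.sum_add_distrib, ← hs.1]
    refine Finset.sum_congr rfl fun j _ => ?_
    split_ifs <;> omega

/-- The indices are those of the first points of the blocks and those of the other points. -/
def indexEquiv : Fin n ≃ {j // s j ≠ 0} ⊕ (Σ j : Fin κ, Fin (s j - 1)) :=
  (Equiv.ofBijective _ (indexMap_bijective hs)).symm

lemma indexEquiv_contact (j : {j // s j ≠ 0}) :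
    indexEquiv hs (Fin.ofNat n (partialSum s j.1)) = Sum.inl j := by
  rw [indexEquiv, Equiv.symm_apply_eq]; rfl

lemma indexEquiv_inner (j : Fin κ) (t : Fin (s j - 1)) :
    indexEquiv hs (Fin.ofNat n (partialSum s j + (t + 1))) = Sum.inr ⟨j, t⟩ := by
  rw [indexEquiv, Equiv.symm_apply_eq]; rfl

end Index

/-- The contact point of the side `j`, as a function of the first points of the blocks. -/
def contactPoint (c : {j // s j ≠ 0} → Plane) (j : Fin κ) : Plane :=
  -- An empty block makes two contact points coincide. The value 0 is never used for an admissible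
  -- s, which has no two consecutive zeros.
  if h : s j ≠ 0 then c ⟨j, h⟩ else if h' : s (j + 1) ≠ 0 then c ⟨j + 1, h'⟩ else 0

lemma measurable_contactPoint (j : Fin κ) :
    Measurable fun c : {j // s j ≠ 0} → Plane => contactPoint c j := by
  unfold contactPoint
  split_ifs <;> fun_prop

section

variable (hs : s ∈ sizeVectors κ n)

include hs in
omit [NeZero n] in
lemma succ_ne_zero_of_eq_zero {j : Fin κ} (h : s j = 0) : s (j + 1) ≠ 0 := by
  have := hs.2 (j + 1)
  rw [add_sub_cancel_right] at this
  omega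

include hs in
omit [NeZero n] in
lemma contactPoint_succ_of_eq_zero (c : {j // s j ≠ 0} → Plane) {j : Fin κ} (h : s j = 0) :
    contactPoint c (j + 1) = contactPoint c j := by
  have h' := succ_ne_zero_of_eq_zero hs h
  rw [contactPoint, contactPoint, dif_pos h', dif_neg (not_not.2 h), dif_pos h']

lemma assemble_contact (p : ({j // s j ≠ 0} → Plane) × (∀ j, Fin (s j - 1) → Plane)) (j : Fin κ) :
    assemble (indexEquiv hs) p (Fin.ofNat n (partialSum s j)) = contactPoint p.1 j := by
  have key : ∀ j (h : s j ≠ 0),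
      assemble (indexEquiv hs) p (Fin.ofNat n (partialSum s j)) = p.1 ⟨j, h⟩ := fun j h => by
    rw [assemble, indexEquiv_contact hs ⟨j, h⟩]; rfl
  by_cases h : s j = 0
  · have h' := succ_ne_zero_of_eq_zero hs h
    have e := ofNat_partialSum_succ hs j
    rw [h, add_zero] at e
    rw [← contactPoint_succ_of_eq_zero hs _ h, contactPoint, dif_pos h', ← e]
    exact key _ h'
  · rw [contactPoint, dif_pos h]
    exact key _ h

lemma isBlockChain_assemble (p : ({j // s j ≠ 0} → Plane) × (∀ j, Fin (s j - 1) → Plane)) :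
    IsBlockChain v s (assemble (indexEquiv hs) p) ↔ ∀ j, s j ≠ 0 →
      IsChain (edge v (j + 1)) (s j - 1) (edge v j) (contactPoint p.1 j)
        (contactPoint p.1 (j + 1)) (p.2 j) := by
  refine forall_congr' fun j => ?_
  by_cases h : s j = 0
  · simp [h]
  set z := assemble (indexEquiv hs) p
  have hj : s j - 1 + 1 = s j := by omega
  rw [isChain_iff (edge v (j + 1)) (s j - 1) (edge v j) _ _ _ (fun t => cyc z (partialSum s j + t))
    (assemble_contact hs p j) ?_ ?_, hj]
  · simp only [h, ne_eq, not_false_eq_true, forall_true_left]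
    refine forall₂_congr fun t ht => ?_
    refine and_congr Iff.rfl ?_
    rcases t with _ | t
    · exact Iff.rfl
    · exact Iff.rfl
  · intro t
    have := indexEquiv_inner hs j t
    change assemble (indexEquiv hs) p _ = _
    rw [assemble, this]; rfl
  · rw [hj, ← assemble_contact hs, ofNat_partialSum_succ hs]; rfl

end

/-! ### Coordinates for the contact points and integration -/

section

variable (hκ : 3 ≤ κ) (hv : IsConvexPolygon v) (hs : s ∈ sizeVectors κ n)

/-- The signed distances of the contact points to their sides. -/
def contactDist (v : Fin κ → Plane) (c : {j // s j ≠ 0} → Plane) (j : Fin κ) : ℝ :=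
  signedDist v j (contactPoint c j)

/-- The position of the contact point of the side `j` on this side. -/
def contactPos (v : Fin κ → Plane) (c : {j // s j ≠ 0} → Plane) (j : Fin κ) : ℝ :=
  (signedDist v (j - 1) (contactPoint c j) - contactDist v c (j - 1)) / turn v (j - 1)

include hκ hv in
-- For fixed contact points the inner points of different blocks are constrained separately, so the
-- set is a product of chain sets.
lemma volume_chains (c : {j // s j ≠ 0} → Plane) :
    volume {q : ∀ j, Fin (s j - 1) → Plane | ∀ j, s j ≠ 0 →
      IsChain (edge v (j + 1)) (s j - 1) (edge v j) (contactPoint c j)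
        (contactPoint c (j + 1)) (q j)} =
    ∏ j, if s j = 0 then 1 else ENNReal.ofReal (turn v j ^ (s j - 1) / (s j)!) *
      truncPow (s j - 1) (cOf v (contactDist v c) j - contactPos v c j) *
      truncPow (s j - 1) (contactPos v c (j + 1)) := by
  have hset : {q : ∀ j, Fin (s j - 1) → Plane | ∀ j, s j ≠ 0 →
      IsChain (edge v (j + 1)) (s j - 1) (edge v j) (contactPoint c j)
        (contactPoint c (j + 1)) (q j)} =
      Set.univ.pi fun j => {q | s j ≠ 0 → IsChain (edge v (j + 1)) (s j - 1) (edge v j)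
        (contactPoint c j) (contactPoint c (j + 1)) q} := by
    ext q; simp
  rw [hset, volume_pi_pi]
  refine Finset.prod_congr rfl fun j _ => ?_
  by_cases h : s j = 0
  · have hu : {q : Fin (s j - 1) → Plane | s j ≠ 0 → IsChain (edge v (j + 1)) (s j - 1) (edge v j)
        (contactPoint c j) (contactPoint c (j + 1)) q} = Set.univ :=
      Set.eq_univ_of_forall fun q h' => absurd h h'
    have : IsEmpty (Fin (s j - 1)) := ⟨fun i => by have := i.isLt; omega⟩
    rw [hu, if_pos h, volume_pi, Measure.pi_univ]
    simp
  · have hT := turn_pos hκ hv j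
    simp only [h, ne_eq, not_false_eq_true, forall_true_left, if_false]
    rw [volume_isChain _ _ _ _ _ hT, show s j - 1 + 1 = s j by omega]
    have hY : wedge (edge v j) (contactPoint c (j + 1) - contactPoint c j) /
        wedge (edge v j) (edge v (j + 1)) = contactPos v c (j + 1) := by
      rw [contactPos, add_sub_cancel_right, contactDist, signedDist_sub]; rfl
    have hX : wedge (contactPoint c (j + 1) - contactPoint c j) (edge v (j + 1)) /
        wedge (edge v j) (edge v (j + 1)) = cOf v (contactDist v c) j - contactPos v c j := by
      obtain ⟨i, rfl⟩ : ∃ i, i + 1 = j := ⟨j - 1, sub_add_cancel _ _⟩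
      rw [← add_eq_cOf hκ hv (l := contactDist v c) (x := contactPoint c (i + 1)) rfl,
        contactPos, add_sub_cancel_right, add_sub_cancel_left]
      congr 1
      rw [contactDist, signedDist_sub, ← neg_sub, ← neg_one_smul ℝ (_ - _), wedge_smul_left,
        wedge_comm (_ - _)]
      ring
    rw [hX, hY]; rfl

/-- The contribution of the side `j` to the volume. -/
def sideFactor (s : Fin κ → ℕ) (j : Fin κ) (c y : ℝ) : ENNReal :=
  (if s j = 0 then 1 else truncPow (s j - 1) (c - y)) *
    (if s (j - 1) = 0 then 1 else truncPow (s (j - 1) - 1) y)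

/-- Regroups the factors from blocks to sides: a block contributes to its own side and to the next
one. -/
lemma prod_sides (a : Fin κ → ENNReal) (c y : Fin κ → ℝ) :
    (∏ j, if s j = 0 then 1 else a j * truncPow (s j - 1) (c j - y j) *
      truncPow (s j - 1) (y (j + 1))) =
    (∏ j, if s j = 0 then 1 else a j) * ∏ j, sideFactor s j (c j) (y j) := by
  simp only [sideFactor, Finset.prod_mul_distrib]
  have : (∏ j, if s (j - 1) = 0 then 1 else truncPow (s (j - 1) - 1) (y j)) =
      ∏ j, if s j = 0 then 1 else truncPow (s j - 1) (y (j + 1)) := by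
    rw [← Equiv.prod_comp (Equiv.addRight (1 : Fin κ))
      (fun j => if s (j - 1) = 0 then 1 else truncPow (s (j - 1) - 1) (y j))]
    simp
  rw [this, ← Finset.prod_mul_distrib, ← Finset.prod_mul_distrib]
  refine Finset.prod_congr rfl fun j _ => ?_
  split_ifs <;> ring

/-- The points with given distances to their sides; for the others, the second coordinate is free. -/
def contactParam (v : Fin κ → Plane) (p : (Fin κ → ℝ) × ({j // s j ≠ 0 ∧ s (j - 1) ≠ 0} → ℝ))
    (j : {j // s j ≠ 0}) : Plane :=
  corner v (j.1 - 1) (if h : s (j.1 - 1) ≠ 0 then p.2 ⟨j.1, j.2, h⟩ else p.1 (j.1 - 1)) (p.1 j.1)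

/-- The coordinates of the points are the distances and the free coordinates. -/
def pairMap (s : Fin κ → ℕ) :
    {j // s j ≠ 0} ⊕ {j // s j ≠ 0} → Fin κ ⊕ {j // s j ≠ 0 ∧ s (j - 1) ≠ 0} :=
  Sum.elim (fun j => if h : s (j.1 - 1) ≠ 0 then Sum.inr ⟨j.1, j.2, h⟩ else Sum.inl (j.1 - 1))
    (fun j => Sum.inl j.1)

include hs in
omit [NeZero n] in
-- Each distance is a coordinate of exactly one point: ℓ_i belongs to the first point of the block
-- i, or to that of the block i+1 when the block i is empty.
lemma pairMap_bijective : Function.Bijective (pairMap s) := by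
  constructor
  · rintro (j | j) (m | m) h
    · simp only [pairMap, Sum.elim_inl] at h
      split_ifs at h with h1 h2 h2
      · have := Sum.inr_injective h
        rw [Subtype.mk.injEq] at this
        rw [Subtype.ext this]
      · have := sub_left_injective (Sum.inl_injective h)
        rw [Subtype.ext this]
    · simp only [pairMap, Sum.elim_inl, Sum.elim_inr] at h
      split_ifs at h with h1
      have := Sum.inl_injective h
      rw [this] at h1
      exact absurd m.2 h1
    · simp only [pairMap, Sum.elim_inl, Sum.elim_inr] at h
      split_ifs at h with h1
      have := Sum.inl_injective h
      rw [← this] at h1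
      exact absurd j.2 h1
    · simp only [pairMap, Sum.elim_inr] at h
      rw [Subtype.ext (Sum.inl_injective h)]
  · rintro (j | j)
    · by_cases h : s j = 0
      · refine ⟨Sum.inl ⟨j + 1, succ_ne_zero_of_eq_zero hs h⟩, ?_⟩
        simp [pairMap, h]
      · exact ⟨Sum.inr ⟨j, h⟩, rfl⟩
    · refine ⟨Sum.inl ⟨j.1, j.2.1⟩, ?_⟩
      simp [pairMap, j.2.2]

include hκ hv hs in
omit [NeZero n] in
-- Taking the distances to two consecutive sides as coordinates of a point has Jacobian 1 / sin.
-- There is one such factor per nonempty block.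
lemma volume_eq_map_contactParam :
    Measurable (contactParam (s := s) v) ∧
    (volume : Measure ({j // s j ≠ 0} → Plane)) =
      (∏ j : {j // s j ≠ 0}, ENNReal.ofReal (turn v (j.1 - 1))⁻¹) •
        Measure.map (contactParam v) volume := by
  set D : {j // s j ≠ 0} → Plane := fun j => (turn v (j.1 - 1))⁻¹ • edge v (j.1 - 1 + 1)
  set F : {j // s j ≠ 0} → Plane := fun j => (-(turn v (j.1 - 1))⁻¹) • edge v (j.1 - 1)
  have hDF : ∀ j, wedge (D j) (F j) = (turn v (j.1 - 1))⁻¹ := fun j => by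
    have hT := (turn_pos hκ hv (j.1 - 1)).ne'
    rw [wedge_smul_left, wedge_smul_right, wedge_comm, ← turn]
    field_simp
  have h1 := volume_eq_map_pi (ι := {j // s j ≠ 0})
    (g := fun j => frame (v (j.1 - 1 + 1)) (D j) (F j))
    (fun j => (continuous_frame _ _ _).measurable)
    (fun j => volume_eq_map_frame _ _ _ (by
      rw [hDF]; exact inv_pos.2 (turn_pos hκ hv _)))
  simp only [hDF] at h1
  have h2 := measurePreserving_pairs (Equiv.ofBijective _ (pairMap_bijective hs))
  have hm : Measurable fun (p : {j // s j ≠ 0} → ℝ × ℝ) j =>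
      frame (v (j.1 - 1 + 1)) (D j) (F j) (p j) :=
    measurable_pi_lambda _ fun j =>
      (continuous_frame _ _ _).measurable.comp (measurable_pi_apply j)
  have e : contactParam (s := s) v = (fun (p : {j // s j ≠ 0} → ℝ × ℝ) j =>
      frame (v (j.1 - 1 + 1)) (D j) (F j) (p j)) ∘ (fun p j =>
        ((Sum.elim p.1 p.2 (Equiv.ofBijective _ (pairMap_bijective hs) (Sum.inl j)),
          Sum.elim p.1 p.2 (Equiv.ofBijective _ (pairMap_bijective hs) (Sum.inr j))) : ℝ × ℝ)) := by
    funext p j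
    simp only [contactParam, corner, frame, Function.comp_apply, Equiv.ofBijective_apply, pairMap,
      Sum.elim_inl, Sum.elim_inr, D, F, smul_smul, neg_smul]
    split_ifs <;>
      simp only [Sum.elim_inr, Sum.elim_inl, smul_neg, smul_smul, div_eq_mul_inv, sub_eq_add_neg]
  refine ⟨by rw [e]; exact hm.comp h2.measurable, ?_⟩
  rw [e, ← Measure.map_map hm h2.measurable, h2.map_eq]
  exact h1

variable {l : Fin κ → ℝ} {b : {j // s j ≠ 0 ∧ s (j - 1) ≠ 0} → ℝ}

lemma contactPoint_param (j : Fin κ) (h : s (j + 1) ≠ 0) :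
    contactPoint (contactParam v (l, b)) (j + 1) =
      corner v j (if h' : s j ≠ 0 then b ⟨j + 1, h, by rwa [add_sub_cancel_right]⟩ else l j)
        (l (j + 1)) := by
  have e : j + 1 - 1 = j := add_sub_cancel_right j 1
  rw [contactPoint, dif_pos h, contactParam]
  simp only [e]

include hκ hv hs in
omit [NeZero n] in
lemma contactDist_param : contactDist v (contactParam (s := s) v (l, b)) = l := by
  funext j
  rw [contactDist]
  by_cases h : s j = 0
  · rw [← contactPoint_succ_of_eq_zero hs _ h,
      contactPoint_param _ (succ_ne_zero_of_eq_zero hs h), dif_neg (not_not.2 h),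
      signedDist_corner hκ hv]
  · obtain ⟨j, rfl⟩ : ∃ i, i + 1 = j := ⟨j - 1, sub_add_cancel _ _⟩
    rw [contactPoint_param _ h, signedDist_succ_corner hκ hv]

include hκ hv hs in
omit [NeZero n] in
lemma contactPos_of_eq_zero (c : {j // s j ≠ 0} → Plane) {j : Fin κ} (h : s j = 0) :
    contactPos v c j = cOf v (contactDist v c) j := by
  obtain ⟨j, rfl⟩ : ∃ i, i + 1 = j := ⟨j - 1, sub_add_cancel _ _⟩
  rw [← add_eq_cOf hκ hv (l := contactDist v c) (x := contactPoint c (j + 1)) rfl, contactPos,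
    add_sub_cancel_right, left_eq_add]
  rw [contactDist, contactPoint_succ_of_eq_zero hs c h, sub_self, zero_div]

include hs in
omit [NeZero n] in
lemma contactPos_of_pred_eq_zero (c : {j // s j ≠ 0} → Plane) {j : Fin κ} (h : s (j - 1) = 0) :
    contactPos v c j = 0 := by
  obtain ⟨j, rfl⟩ : ∃ i, i + 1 = j := ⟨j - 1, sub_add_cancel _ _⟩
  rw [add_sub_cancel_right] at h
  rw [contactPos, add_sub_cancel_right, contactDist, contactPoint_succ_of_eq_zero hs c h, sub_self,
    zero_div]

include hκ hv hs in
omit [NeZero n] in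
lemma contactPos_param {j : Fin κ} (h : s j ≠ 0 ∧ s (j - 1) ≠ 0) :
    contactPos v (contactParam v (l, b)) j = (b ⟨j, h⟩ - l (j - 1)) / turn v (j - 1) := by
  rw [contactPos, contactDist_param hκ hv hs]
  obtain ⟨j, rfl⟩ : ∃ i, i + 1 = j := ⟨j - 1, sub_add_cancel _ _⟩
  have h' := h.2
  simp only [add_sub_cancel_right] at h' ⊢
  rw [contactPoint_param _ h.1, signedDist_corner hκ hv, dif_pos h']

include hκ hv hs in
omit [NeZero n] in
-- If both blocks at a side are nonempty, the position of the contact point is free and the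
-- convolution applies. Otherwise that point is a corner, and the single remaining factor already
-- has the exponent s_{j-1} + s_j - 1.
lemma lintegral_sides (l : Fin κ → ℝ) :
    ∫⁻ b : {j // s j ≠ 0 ∧ s (j - 1) ≠ 0} → ℝ, ∏ j, sideFactor s j (cOf v l j)
      (contactPos v (contactParam (s := s) v (l, b)) j) =
    (∏ j, if s j ≠ 0 ∧ s (j - 1) ≠ 0 then ENNReal.ofReal (turn v (j - 1)) else 1) *
      ∏ j, truncPow (s (j - 1) + s j - 1) (cOf v l j) := by
  set G : Fin κ → ℝ → ENNReal := fun j t =>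
    truncPow (s (j - 1) - 1) ((t - l (j - 1)) / turn v (j - 1)) *
      truncPow (s j - 1) (cOf v l j - (t - l (j - 1)) / turn v (j - 1)) with hG
  have h1 : ∀ b : {j // s j ≠ 0 ∧ s (j - 1) ≠ 0} → ℝ, (∏ j, sideFactor s j (cOf v l j)
      (contactPos v (contactParam (s := s) v (l, b)) j)) =
      (∏ j, if s j ≠ 0 ∧ s (j - 1) ≠ 0 then 1 else truncPow (s (j - 1) + s j - 1) (cOf v l j)) *
      ∏ j : {j // s j ≠ 0 ∧ s (j - 1) ≠ 0}, G j.1 (b j) := by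
    intro b
    have e : ∏ j : {j // s j ≠ 0 ∧ s (j - 1) ≠ 0}, G j.1 (b j) = ∏ j,
        if s j ≠ 0 ∧ s (j - 1) ≠ 0 then G j (if h : s j ≠ 0 ∧ s (j - 1) ≠ 0 then b ⟨j, h⟩ else 0)
        else 1 := by
      rw [← prod_subtype_eq_ite]
      refine Finset.prod_congr rfl fun j _ => ?_
      rw [dif_pos j.2]
    rw [e, ← Finset.prod_mul_distrib]
    refine Finset.prod_congr rfl fun j _ => ?_
    by_cases h : s j = 0
    · have h' : s (j - 1) ≠ 0 := fun h' => hs.2 j (by omega)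
      rw [contactPos_of_eq_zero hκ hv hs _ h, contactDist_param hκ hv hs]
      simp [sideFactor, h, h']
    by_cases h' : s (j - 1) = 0
    · rw [contactPos_of_pred_eq_zero hs _ h']
      simp [sideFactor, h, h']
    · have hh : s j ≠ 0 ∧ s (j - 1) ≠ 0 := ⟨h, h'⟩
      rw [contactPos_param hκ hv hs hh, sideFactor, if_neg h, if_neg h', if_pos hh, if_pos hh,
        dif_pos hh, one_mul, hG, mul_comm]
  have hm : ∀ j, Measurable (G j) := fun j =>
    ((measurable_truncPow _).comp (by fun_prop)).mul ((measurable_truncPow _).comp (by fun_prop))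
  simp only [h1]
  rw [lintegral_const_mul _ (Finset.measurable_prod _ fun j _ =>
      (hm j.1).comp (measurable_pi_apply j)),
    lintegral_fintype_prod (fun j : {j // s j ≠ 0 ∧ s (j - 1) ≠ 0} => G j.1) (fun j => hm j.1)]
  have h2 : ∀ j, ∫⁻ t, G j t = ENNReal.ofReal (turn v (j - 1)) *
      truncPow (s (j - 1) - 1 + (s j - 1) + 1) (cOf v l j) := fun j =>
    lintegral_truncPow_affine _ _ _ _ (turn_pos hκ hv _)
  simp only [h2]
  rw [prod_subtype_eq_ite (fun j => s j ≠ 0 ∧ s (j - 1) ≠ 0) (fun j =>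
    ENNReal.ofReal (turn v (j - 1)) * truncPow (s (j - 1) - 1 + (s j - 1) + 1) (cOf v l j)),
    ← Finset.prod_mul_distrib, ← Finset.prod_mul_distrib]
  refine Finset.prod_congr rfl fun j _ => ?_
  by_cases hh : s j ≠ 0 ∧ s (j - 1) ≠ 0
  · rw [if_pos hh, if_pos hh, if_pos hh, one_mul,
      show s (j - 1) - 1 + (s j - 1) + 1 = s (j - 1) + s j - 1 by omega]
  · rw [if_neg hh, if_neg hh, if_neg hh, one_mul, mul_one]

include hκ hv hs in
omit [NeZero n] in
-- The Jacobian factor of a nonempty block cancels with the substitution factor of its free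
-- position. If the previous block is empty there is no such position, and its sine stays with the
-- power -1.
lemma prod_constants :
    (∏ j : {j // s j ≠ 0}, ENNReal.ofReal (turn v (j.1 - 1))⁻¹) *
      ((∏ j, if s j = 0 then 1 else ENNReal.ofReal (turn v j ^ (s j - 1) / (s j)!)) *
        ∏ j, if s j ≠ 0 ∧ s (j - 1) ≠ 0 then ENNReal.ofReal (turn v (j - 1)) else 1) =
    ∏ j, ENNReal.ofReal (turn v j ^ ((s j : ℤ) - 1) / (s j)!) := by
  have hT := turn_pos hκ hv
  rw [prod_subtype_eq_ite (fun j => s j ≠ 0) fun j => ENNReal.ofReal (turn v (j - 1))⁻¹,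
    mul_left_comm, ← Finset.prod_mul_distrib]
  have h1 : (∏ j, (if s j ≠ 0 then ENNReal.ofReal (turn v (j - 1))⁻¹ else 1) *
      if s j ≠ 0 ∧ s (j - 1) ≠ 0 then ENNReal.ofReal (turn v (j - 1)) else 1) =
      ∏ j, if s j = 0 then ENNReal.ofReal (turn v j)⁻¹ else 1 := by
    rw [← (Equiv.subRight (1 : Fin κ)).prod_comp
      (fun j => if s j = 0 then ENNReal.ofReal (turn v j)⁻¹ else 1)]
    refine Finset.prod_congr rfl fun j _ => ?_
    rw [Equiv.subRight_apply]
    have h0 := hs.2 j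
    by_cases h : s (j - 1) = 0
    · have h' : s j ≠ 0 := by omega
      simp [h, h']
    · by_cases h' : s j = 0
      · simp [h, h']
      · rw [if_pos h', if_pos ⟨h', h⟩, if_neg h, ← ENNReal.ofReal_mul (inv_nonneg.2 (hT _).le),
          inv_mul_cancel₀ (hT _).ne', ENNReal.ofReal_one]
  rw [h1, ← Finset.prod_mul_distrib]
  refine Finset.prod_congr rfl fun j _ => ?_
  by_cases h : s j = 0
  · simp [h]
  · rw [if_neg h, if_neg h, mul_one]
    congr 2
    rw [← zpow_natCast]
    congr 1
    omega

lemma measurable_contactDist : Measurable (contactDist (s := s) v) :=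
  measurable_pi_lambda _ fun j => (continuous_signedDist v j).measurable.comp (measurable_contactPoint j)

lemma measurable_contactPos (j : Fin κ) :
    Measurable fun c : {j // s j ≠ 0} → Plane => contactPos v c j :=
  ((((continuous_signedDist v (j - 1)).measurable.comp (measurable_contactPoint j))).sub
    ((measurable_pi_apply (j - 1)).comp measurable_contactDist)).div_const _

lemma measurable_cOf (j : Fin κ) : Measurable fun l => cOf v l j := by
  unfold cOf; fun_prop

lemma measurable_cyc (k : ℕ) : Measurable fun z : Fin n → Plane => cyc z k :=
  measurable_pi_apply _

lemma measurable_step (k : ℕ) : Measurable fun z : Fin n → Plane => step z k :=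
  (measurable_cyc _).sub (measurable_cyc _)

lemma measurableSet_isBlockChain : MeasurableSet {z : Fin n → Plane | IsBlockChain v s z} := by
  simp only [IsBlockChain, Set.ofPred_forall]
  refine MeasurableSet.iInter fun j => MeasurableSet.iInter fun t => MeasurableSet.iInter fun _ => ?_
  refine (measurableSet_wedge_pos (measurable_step _) measurable_const).inter
    (measurableSet_wedge_pos ?_ (measurable_step _))
  split_ifs
  · exact measurable_const
  · exact measurable_step _

include hκ hv hs in
/-- The volume of the set of block chains whose contact points are at given distances. -/
theorem volume_isBlockChain {A : Set (Fin κ → ℝ)} (hA : MeasurableSet A) :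
    volume {z : Fin n → Plane | IsBlockChain v s z ∧
      (fun j : Fin κ => signedDist v j (z (Fin.ofNat n (partialSum s j)))) ∈ A} =
    (∏ j, ENNReal.ofReal (turn v j ^ ((s j : ℤ) - 1) / (s j)!)) *
      ∫⁻ l in A, ∏ j, truncPow (s (j - 1) + s j - 1) (cOf v l j) := by
  set S := {z : Fin n → Plane | IsBlockChain v s z ∧
      (fun j : Fin κ => signedDist v j (z (Fin.ofNat n (partialSum s j)))) ∈ A} with hS
  have hSm : MeasurableSet S := by
    refine measurableSet_isBlockChain.inter ((measurable_pi_lambda _ fun j => ?_) hA)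
    exact (continuous_signedDist v j).measurable.comp (measurable_pi_apply _)
  have hmp := measurePreserving_assemble (X := Plane) (indexEquiv hs)
  rw [← hmp.measure_preimage hSm.nullMeasurableSet, Measure.volume_eq_prod,
    Measure.prod_apply (hmp.measurable hSm)]
  set C := ∏ j, if s j = 0 then 1 else ENNReal.ofReal (turn v j ^ (s j - 1) / (s j)!)
  set H : ({j // s j ≠ 0} → Plane) → ENNReal := fun c =>
    A.indicator 1 (contactDist v c) *
      ∏ j, sideFactor s j (cOf v (contactDist v c) j) (contactPos v c j) with hH
  have h1 : ∀ c, volume (Prod.mk c ⁻¹' (assemble (X := Plane) (indexEquiv hs) ⁻¹' S)) = C * H c := by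
    intro c
    have e : Prod.mk c ⁻¹' (assemble (X := Plane) (indexEquiv hs) ⁻¹' S) =
        {q : ∀ j, Fin (s j - 1) → Plane | (∀ j, s j ≠ 0 →
          IsChain (edge v (j + 1)) (s j - 1) (edge v j) (contactPoint c j)
            (contactPoint c (j + 1)) (q j)) ∧ contactDist v c ∈ A} := by
      ext q
      have e1 := isBlockChain_assemble (v := v) hs (c, q)
      have e2 : (fun j : Fin κ => signedDist v j (assemble (indexEquiv hs) (c, q)
          (Fin.ofNat n (partialSum s j)))) = contactDist v c := by
        funext j; rw [assemble_contact]; rfl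
      exact and_congr e1 (by rw [e2])
    rw [e, hH]
    by_cases hc : contactDist v c ∈ A
    · simp only [hc, and_true]
      rw [volume_chains hκ hv, prod_sides]
      simp [hc, C]
    · simp [hc]
  have hHm : Measurable H := by
    refine ((measurable_one.indicator hA).comp measurable_contactDist).mul ?_
    refine Finset.measurable_prod _ fun j _ => ?_
    have hc : Measurable fun c => cOf v (contactDist (s := s) v c) j :=
      (measurable_cOf j).comp measurable_contactDist
    have hy := measurable_contactPos (v := v) (s := s) j
    unfold sideFactor
    refine Measurable.mul ?_ ?_
    · split_ifs
      · exact measurable_const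
      · exact (measurable_truncPow _).comp (hc.sub hy)
    · split_ifs
      · exact measurable_const
      · exact (measurable_truncPow _).comp hy
  simp only [h1]
  obtain ⟨hPm, hP⟩ := volume_eq_map_contactParam hκ hv hs
  rw [lintegral_const_mul _ hHm, hP, lintegral_smul_measure, lintegral_map hHm hPm,
    Measure.volume_eq_prod, lintegral_prod (fun p => H (contactParam v p)) (hHm.comp hPm).aemeasurable, smul_eq_mul]
  have h2 : ∀ l : Fin κ → ℝ, ∫⁻ b : {j // s j ≠ 0 ∧ s (j - 1) ≠ 0} → ℝ,
      H (contactParam v (l, b)) = (∏ j, if s j ≠ 0 ∧ s (j - 1) ≠ 0 then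
        ENNReal.ofReal (turn v (j - 1)) else 1) *
        A.indicator (fun l => ∏ j, truncPow (s (j - 1) + s j - 1) (cOf v l j)) l := by
    intro l
    simp only [hH, contactDist_param hκ hv hs]
    by_cases hl : l ∈ A
    · simp only [Set.indicator_of_mem hl, Pi.one_apply, one_mul]
      exact lintegral_sides hκ hv hs l
    · simp [hl]
  simp only [h2]
  have hm3 : Measurable fun l => ∏ j, truncPow (s (j - 1) + s j - 1) (cOf v l j) :=
    Finset.measurable_prod _ fun j _ => (measurable_truncPow _).comp (measurable_cOf j)
  rw [lintegral_const_mul _ (hm3.indicator hA), lintegral_indicator hA,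
    ← prod_constants hκ hv hs]
  ring

end

end BlockVolume

/-! ### Canonical order -/

section Order

variable {n : ℕ}

/-- The index `k` is that of the lowest point, the leftmost one among the lowest. -/
def IsLowest (z : Fin n → Plane) (k : Fin n) : Prop :=
  ∀ i, z k 1 < z i 1 ∨ (z k 1 = z i 1 ∧ z k 0 ≤ z i 0)

lemma IsLowest.lt {z : Fin n → Plane} {k : Fin n} (h : IsLowest z k)
    (hz : ∀ i j, i ≠ j → z i 1 ≠ z j 1) {i : Fin n} (hi : i ≠ k) : z k 1 < z i 1 :=
  (h i).resolve_right fun h' => hz _ _ hi h'.1.symm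

lemma exists_isLowest [NeZero n] (z : Fin n → Plane) : ∃ k, IsLowest z k := by
  obtain ⟨k, hk⟩ := Finite.exists_min (fun i => toLex (z i 1, z i 0))
  refine ⟨k, fun i => ?_⟩
  have := hk i
  rw [Prod.Lex.le_iff] at this
  exact this

/-- The decreasing function of the direction of `z i`, seen from `z k`, that sorts the points
counterclockwise. -/
def sortKey (z : Fin n → Plane) (k i : Fin n) : WithBot ℝ :=
  if i = k then ⊥ else ((-(z i 0 - z k 0) / (z i 1 - z k 1) : ℝ) : WithBot ℝ)

/-- The key is minus the cotangent of the direction seen from the lowest point, which increases with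
the angle on (0, π). -/
lemma sortKey_lt_iff {z : Fin n → Plane} {k i j : Fin n} (hi : z k 1 < z i 1)
    (hj : z k 1 < z j 1) : sortKey z k i < sortKey z k j ↔ 0 < cross (z k) (z i) (z j) := by
  have hik : i ≠ k := fun h => by rw [h] at hi; exact lt_irrefl _ hi
  have hjk : j ≠ k := fun h => by rw [h] at hj; exact lt_irrefl _ hj
  rw [sortKey, sortKey, if_neg hik, if_neg hjk, WithBot.coe_lt_coe,
    div_lt_div_iff₀ (sub_pos.2 hi) (sub_pos.2 hj), ← sub_pos, cross]
  ring_nf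

lemma sortKey_strictMono [NeZero n] {z : Fin n → Plane} (hz : ∀ i j, i ≠ j → z i 1 ≠ z j 1)
    {σ : Equiv.Perm (Fin n)} (hlow : IsLowest (fun i => z (σ i)) 0)
    (hccw : IsCCW fun i => z (σ i)) : StrictMono (sortKey z (σ 0) ∘ σ) := by
  have hlt : ∀ i, i ≠ 0 → z (σ 0) 1 < z (σ i) 1 := fun i hi =>
    hlow.lt (fun a b hab => hz _ _ fun h => hab (σ.injective h)) hi
  intro i j hij
  have hj0 : j ≠ 0 := fun h => by rw [h] at hij; exact Fin.not_lt_zero _ hij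
  rw [Function.comp_apply, Function.comp_apply]
  by_cases hi : i = 0
  · rw [hi, sortKey, if_pos rfl, sortKey, if_neg fun h => hj0 (σ.injective h)]
    exact WithBot.bot_lt_coe _
  · rw [sortKey_lt_iff (hlt i hi) (hlt j hj0)]
    exact hccw 0 i j (lt_of_le_of_ne (Fin.zero_le i) (Ne.symm hi)) hij

/-- Two increasing enumerations of the same keys coincide. -/
lemma perm_unique [NeZero n] {z : Fin n → Plane} (hz : ∀ i j, i ≠ j → z i 1 ≠ z j 1)
    {σ τ : Equiv.Perm (Fin n)} (hσ : IsLowest (fun i => z (σ i)) 0)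
    (hσ' : IsCCW fun i => z (σ i)) (hτ : IsLowest (fun i => z (τ i)) 0)
    (hτ' : IsCCW fun i => z (τ i)) : σ = τ := by
  have h0 : σ 0 = τ 0 := by
    by_contra h
    have h1 := hσ (σ.symm (τ 0))
    have h2 := hτ (τ.symm (σ 0))
    simp only [Equiv.apply_symm_apply] at h1 h2
    have hne := hz _ _ h
    rcases h1 with h1 | h1
    · rcases h2 with h2 | h2
      · exact lt_asymm h1 h2
      · exact hne h2.1.symm
    · exact hne h1.1
  have h1 := sortKey_strictMono hz hσ hσ'
  have h2 := sortKey_strictMono hz hτ hτ'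
  rw [← h0] at h2
  have h3 : sortKey z (σ 0) ∘ σ = sortKey z (σ 0) ∘ τ := by
    refine (StrictMono.range_inj h1 h2).1 ?_
    rw [EquivLike.range_comp, EquivLike.range_comp]
  have hinj : Function.Injective (sortKey z (σ 0)) := by
    have := h1.injective.comp σ.symm.injective
    simpa [Function.comp_assoc] using this
  exact Equiv.ext fun i => hinj (congrFun h3 i)

lemma cross_ne_zero {z : Fin n → Plane} (hc : ConvexIndependent ℝ z) {k i j : Fin n}
    (hi : z k 1 < z i 1) (hj : z k 1 < z j 1) (hij : z i 1 < z j 1) :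
    cross (z k) (z i) (z j) ≠ 0 := by
  intro h
  have hjk := sub_pos.2 hj
  have hik := sub_pos.2 hi
  have hji := sub_pos.2 hij
  have hmem := hc {k, j} i ?_
  · rcases hmem with rfl | rfl
    · exact lt_irrefl _ hi
    · exact lt_irrefl _ hij
  · rw [Set.image_pair, convexHull_pair]
    refine ⟨(z j 1 - z i 1) / (z j 1 - z k 1), (z i 1 - z k 1) / (z j 1 - z k 1), by positivity,
      by positivity, by field_simp; ring, ?_⟩
    rw [cross] at h
    apply plane_ext <;> simp only [PiLp.add_apply, PiLp.smul_apply, smul_eq_mul]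
    · field_simp; linarith
    · field_simp; ring

lemma exists_perm [NeZero n] {z : Fin n → Plane} (hz : ∀ i j, i ≠ j → z i 1 ≠ z j 1)
    (hc : ConvexIndependent ℝ z) :
    ∃ σ : Equiv.Perm (Fin n), IsLowest (fun i => z (σ i)) 0 ∧ IsCCW fun i => z (σ i) := by
  obtain ⟨k, hk⟩ := exists_isLowest z
  have hlt : ∀ i, i ≠ k → z k 1 < z i 1 := fun i hi => hk.lt hz hi
  have hinj : Function.Injective (sortKey z k) := by
    intro i j h
    by_contra hij
    by_cases hi : i = k
    · have hj : j ≠ k := fun h' => hij (hi.trans h'.symm)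
      rw [sortKey, sortKey, if_pos hi, if_neg hj] at h
      exact WithBot.bot_ne_coe h
    by_cases hj : j = k
    · rw [sortKey, sortKey, if_pos hj, if_neg hi] at h
      exact WithBot.coe_ne_bot h
    have h1 := (sortKey_lt_iff (hlt i hi) (hlt j hj)).not.1 h.not_lt
    have h2 := (sortKey_lt_iff (hlt j hj) (hlt i hi)).not.1 h.symm.not_lt
    have e : cross (z k) (z j) (z i) = -cross (z k) (z i) (z j) := by simp only [cross]; ring
    rcases lt_or_gt_of_ne (hz i j hij) with h' | h'
    · exact cross_ne_zero hc (hlt i hi) (hlt j hj) h' (by linarith)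
    · exact cross_ne_zero hc (hlt j hj) (hlt i hi) h' (by linarith)
  set σ := Tuple.sort (sortKey z k) with hσ
  have hmono : StrictMono (sortKey z k ∘ σ) :=
    (Tuple.monotone_sort _).strictMono_of_injective (hinj.comp σ.injective)
  have h0 : σ 0 = k := by
    apply hinj
    apply le_antisymm
    · have := hmono.monotone (Fin.zero_le (σ.symm k))
      simpa using this
    · rw [sortKey, if_pos rfl]; exact bot_le
  have hne : ∀ i, 0 < i → σ i ≠ k := fun i hi h => hi.ne (σ.injective (h0.trans h.symm))
  have hpos : ∀ i j, 0 < i → i < j → 0 < cross (z k) (z (σ i)) (z (σ j)) := fun i j hi hij =>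
    (sortKey_lt_iff (hlt _ (hne i hi)) (hlt _ (hne j (hi.trans hij)))).1 (hmono hij)
  refine ⟨σ, fun i => ?_, fun a b c hab hbc => ?_⟩
  · simp only [h0]; exact hk _
  · change 0 < cross (z (σ a)) (z (σ b)) (z (σ c))
    rcases (Fin.zero_le a).eq_or_lt with h | ha
    · rw [← h, h0]; exact hpos b c (by rwa [← h] at hab) hbc
    · by_contra hneg
      have p1 := hpos a b ha hab
      have p2 := hpos b c (ha.trans hab) hbc
      have T := hpos a c ha (hab.trans hbc)
      -- Were the triple not counterclockwise, the point b would lie in the triangle formed by the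
      -- lowest point, a and c, against convex independence.
      have hmem := hc {k, σ a, σ c} (σ b) ?_
      · rcases hmem with h | h | h
        · exact hne b (ha.trans hab) h
        · exact hab.ne' (σ.injective h)
        · exact hbc.ne (σ.injective h)
      · have hsub : ∀ i ∈ ({k, σ a, σ c} : Set (Fin n)),
            z i ∈ convexHull ℝ (z '' {k, σ a, σ c}) :=
          fun i hi => subset_convexHull ℝ _ ⟨i, hi, rfl⟩
        refine sum_three_mem (convex_convexHull ℝ _) (hsub k (by simp)) (hsub (σ a) (by simp))
          (hsub (σ c) (by simp)) (div_nonneg (neg_nonneg.2 (not_lt.1 hneg)) T.le)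
          (div_nonneg p2.le T.le) (div_nonneg p1.le T.le) ?_ ?_
        · field_simp; simp only [cross]; ring
        · apply plane_ext <;> simp only [PiLp.add_apply, PiLp.smul_apply, smul_eq_mul] <;>
            field_simp <;> simp only [cross] <;> ring

end Order

/-! ### Generic position -/

section Generic

variable {κ : ℕ} [NeZero κ] {n : ℕ} {v : Fin κ → Plane}

/-- No two points of `z` have the same height, or the same distance to a side. -/
def IsGeneric (v : Fin κ → Plane) (z : Fin n → Plane) : Prop :=
  ∀ i k, i ≠ k → z i 1 ≠ z k 1 ∧ ∀ j, signedDist v j (z i) ≠ signedDist v j (z k)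

/-- A tie is a linear condition, and a proper subspace is Lebesgue-null. Moving z i along the
quarter turn of d shows that it is proper. -/
lemma ae_wedge_sub_ne_zero {d : Plane} (hd : d ≠ 0) {i k : Fin n} (hik : i ≠ k) :
    ∀ᵐ z : Fin n → Plane, wedge d (z i - z k) ≠ 0 := by
  let S : Submodule ℝ (Fin n → Plane) :=
    { carrier := {z | wedge d (z i - z k) = 0}
      add_mem' := by
        intro a b ha hb
        have e : (a + b) i - (a + b) k = (a i - a k) + (b i - b k) := by
          simp only [Pi.add_apply]; abel
        change wedge d ((a + b) i - (a + b) k) = 0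
        rw [e, wedge_add_right, ha, hb, add_zero]
      zero_mem' := by simp
      smul_mem' := by
        intro t a ha
        change wedge d ((t • a) i - (t • a) k) = 0
        rw [Pi.smul_apply, Pi.smul_apply, ← smul_sub, wedge_smul_right, ha, mul_zero] }
  have hS : S ≠ ⊤ := by
    intro h
    have hmem : (Pi.single i (WithLp.toLp 2 ![-d 1, d 0]) : Fin n → Plane) ∈ S := by
      rw [h]; trivial
    have h0 : wedge d ((Pi.single i (WithLp.toLp 2 ![-d 1, d 0]) : Fin n → Plane) i -
        (Pi.single i (WithLp.toLp 2 ![-d 1, d 0]) : Fin n → Plane) k) = 0 := hmem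
    rw [Pi.single_eq_same, Pi.single_eq_of_ne hik.symm, sub_zero] at h0
    simp only [wedge, Matrix.cons_val_zero, Matrix.cons_val_one] at h0
    apply hd
    apply plane_ext
    · simp only [PiLp.zero_apply]; nlinarith [sq_nonneg (d 0), sq_nonneg (d 1)]
    · simp only [PiLp.zero_apply]; nlinarith [sq_nonneg (d 0), sq_nonneg (d 1)]
  exact measure_mono_null (fun z hz => not_not.1 hz) (Measure.addHaar_submodule volume S hS)

lemma ae_height_ne {i k : Fin n} (hik : i ≠ k) : ∀ᵐ z : Fin n → Plane, z i 1 ≠ z k 1 := by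
  have hd : (WithLp.toLp 2 ![1, 0] : Plane) ≠ 0 := by
    intro h
    have := congrArg (fun x : Plane => x 0) h
    simp at this
  filter_upwards [ae_wedge_sub_ne_zero hd hik] with z hz h
  apply hz
  simp [wedge, h]

lemma ae_isGeneric (hκ : 3 ≤ κ) (hv : IsConvexPolygon v) :
    ∀ᵐ z : Fin n → Plane, IsGeneric v z := by
  simp only [IsGeneric]
  refine ae_all_iff.2 fun i => ae_all_iff.2 fun k => ?_
  · by_cases hik : i = k
    · exact Filter.Eventually.of_forall fun z h => absurd hik h
    have h1 : ∀ᵐ z : Fin n → Plane, ∀ j, signedDist v j (z i) ≠ signedDist v j (z k) := by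
      refine ae_all_iff.2 fun j => ?_
      have hd : edge v j ≠ 0 := by
        intro h
        have := norm_edge hκ hv j
        rw [h, norm_zero] at this
        exact zero_ne_one this
      filter_upwards [ae_wedge_sub_ne_zero hd hik] with z hz h
      apply hz
      rw [← signedDist_sub, h, sub_self]
    filter_upwards [ae_height_ne hik, h1] with z hz1 hz2 _
    exact ⟨hz1, hz2⟩

lemma IsGeneric.injective {z : Fin n → Plane} (hz : IsGeneric v z) : Function.Injective z := by
  intro i k h
  by_contra hik
  exact (hz i k hik).1 (by rw [h])

lemma IsGeneric.contact_lt [NeZero n] {z : Fin n → Plane} (hz : IsGeneric v z) (j : Fin κ)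
    {i : Fin n} (hi : i ≠ contactIndex v z j) :
    signedDist v j (z (contactIndex v z j)) < signedDist v j (z i) := by
  obtain ⟨k, hk⟩ := Finite.exists_min fun i => signedDist v j (z i)
  have hlt : ∀ i, i ≠ k → signedDist v j (z k) < signedDist v j (z i) := fun i hi =>
    lt_of_le_of_ne (hk i) ((hz k i hi.symm).2 j)
  rw [contactIndex_eq hlt] at hi ⊢
  exact hlt i hi

lemma measurePreserving_perm (σ : Equiv.Perm (Fin n)) :
    MeasurePreserving (fun (z : Fin n → Plane) i => z (σ i)) volume volume := by
  have h := volume_measurePreserving_piCongrLeft (fun _ : Fin n => Plane) σ.symm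
  have e : (fun (z : Fin n → Plane) i => z (σ i)) =
      MeasurableEquiv.piCongrLeft (fun _ : Fin n => Plane) σ.symm := by
    funext z i
    obtain ⟨k, rfl⟩ := σ.symm.surjective i
    rw [MeasurableEquiv.piCongrLeft_apply_apply, Equiv.apply_symm_apply]
  rw [e]; exact h

lemma measurableSet_isLowest (k : Fin n) : MeasurableSet {z : Fin n → Plane | IsLowest z k} := by
  have hm : ∀ (i : Fin n) (a : Fin 2), Measurable fun z : Fin n → Plane => z i a := by
    intro i a; fun_prop
  simp only [IsLowest, Set.ofPred_forall]
  refine MeasurableSet.iInter fun i => ?_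
  exact (measurableSet_lt (hm k 1) (hm i 1)).union
    ((measurableSet_eq_fun (hm k 1) (hm i 1)).inter (measurableSet_le (hm k 0) (hm i 0)))

lemma measurableSet_isCCW : MeasurableSet {z : Fin n → Plane | IsCCW z} := by
  simp only [IsCCW, Set.ofPred_forall, cross_eq_wedge]
  refine MeasurableSet.iInter fun i => MeasurableSet.iInter fun j => MeasurableSet.iInter fun k =>
    MeasurableSet.iInter fun _ => MeasurableSet.iInter fun _ => ?_
  exact measurableSet_wedge_pos (by fun_prop) (by fun_prop)

lemma measurable_minDist [NeZero n] :
    Measurable fun z : Fin n → Plane => minDist v z := by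
  refine measurable_pi_lambda _ fun j => ?_
  exact Measurable.iInf fun i =>
    (continuous_signedDist v j).measurable.comp (measurable_pi_apply i)

lemma measurableSet_isFullSided [NeZero n] (hκ : 3 ≤ κ) (hv : IsConvexPolygon v) :
    MeasurableSet {z : Fin n → Plane | IsFullSided v z} := by
  simp only [isFullSided_iff hκ hv, Set.ofPred_forall]
  exact MeasurableSet.iInter fun j =>
    measurableSet_lt measurable_const ((measurable_cOf j).comp measurable_minDist)

lemma measurableSet_body (hκ : 3 ≤ κ) (hv : IsConvexPolygon v) : MeasurableSet (body v) := by
  rw [body_eq hκ hv]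
  simp only [Set.ofPred_forall]
  exact MeasurableSet.iInter fun j =>
    measurableSet_le measurable_const (continuous_signedDist v j).measurable

end Generic

/-! ### The decomposition of the canonical tuples -/

section Decomposition

variable {κ : ℕ} [NeZero κ] {n : ℕ} [NeZero n] {v : Fin κ → Plane} {s : Fin κ → ℕ}
  {z : Fin n → Plane}

/-- The canonical tuples with a full-sided parallel containing polygon. -/
def fullSidedTuples (v : Fin κ → Plane) (n : ℕ) [NeZero n] : Set (Fin n → Plane) :=
  canonicalTuples v n ∩ {z | IsFullSided v z}

/-- The block chains whose contact points have their distances to the sides in `A`. -/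
def blockChains (v : Fin κ → Plane) (n : ℕ) [NeZero n] (s : Fin κ → ℕ) (A : Set (Fin κ → ℝ)) :
    Set (Fin n → Plane) :=
  {z | IsBlockChain v s z ∧
    (fun j : Fin κ => signedDist v j (z (Fin.ofNat n (partialSum s j)))) ∈ A}

lemma measurableSet_blockChains {A : Set (Fin κ → ℝ)} (hA : MeasurableSet A) :
    MeasurableSet (blockChains v n s A) := by
  refine measurableSet_isBlockChain.inter ((measurable_pi_lambda _ fun j => ?_) hA)
  exact (continuous_signedDist v j).measurable.comp (measurable_pi_apply _)

section

variable (hκ : 3 ≤ κ) (hv : IsConvexPolygon v) (hs : s ∈ sizeVectors κ n) {k : Fin n}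
include hκ hv hs

lemma IsBlockChain.contactIndex_eq (hz : IsBlockChain v s fun i => z (i + k)) (j : Fin κ) :
    contactIndex v z j = Fin.ofNat n (partialSum s j) + k := by
  apply PCP.contactIndex_eq
  intro i hi
  have := hz.signedDist_lt_of_ne hκ hv hs j (i := i - k)
    fun h => hi (by rw [← h, sub_add_cancel])
  simpa only [sub_add_cancel] using this

lemma IsBlockChain.sizeVector_eq (hz : IsBlockChain v s fun i => z (i + k)) :
    sizeVector v z = s := by
  funext j
  rw [sizeVector, hz.contactIndex_eq hκ hv hs, hz.contactIndex_eq hκ hv hs,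
    ofNat_partialSum_succ hs, ofNat_add', add_sub_add_right_eq_sub, add_sub_cancel_left]
  exact Nat.mod_eq_of_lt (lt_of_mem_sizeVectors hκ hs j)

lemma IsBlockChain.minDist_shift (hz : IsBlockChain v s fun i => z (i + k)) :
    minDist v z = fun j : Fin κ => signedDist v j (z (Fin.ofNat n (partialSum s j) + k)) := by
  have h : minDist v (fun i => z (i + k)) = minDist v z := minDist_comp_equiv (Equiv.addRight k)
  rw [← h]
  funext j
  exact hz.minDist_eq hκ hv hs j

/-- The shift k is the index of cp_0. Containment in the polygon is equivalent to nonnegative side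
distances, the only constraint on a block chain that involves its position. -/
lemma mem_fullSidedTuples_iff (hg : IsGeneric v z) (A : Set (Fin κ → ℝ)) :
    (z ∈ fullSidedTuples v n ∧ sideDistance v z ∈ A ∧ sizeVector v z = s) ↔
      ∃ k, (fun i => z (i + k)) ∈ blockChains v n s (A ∩ {l | ∀ j, 0 ≤ l j}) ∧
        IsLowest z 0 := by
  constructor
  · rintro ⟨⟨⟨⟨hb, -⟩, hlow, hccw⟩, -⟩, hA, rfl⟩
    have hch := isBlockChain_shift hκ hv hccw fun j i hi => hg.contact_lt j hi
    have hmin := hch.minDist_shift hκ hv hs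
    refine ⟨contactIndex v z 0, ⟨hch, ?_⟩, hlow⟩
    rw [sideDistance_eq hκ hv hb] at hA
    rw [← hmin]
    refine ⟨hA, fun j => ?_⟩
    obtain ⟨i, hi⟩ := exists_minDist_eq (v := v) (z := z) j
    rw [← hi]
    have := hb i
    rw [body_eq hκ hv] at this
    exact this j
  · rintro ⟨k, ⟨hch, hA, h0⟩, hlow⟩
    have hmin := hch.minDist_shift hκ hv hs
    rw [← hmin] at hA h0
    have hb : ∀ i, z i ∈ body v := by
      intro i
      rw [body_eq hκ hv]
      exact fun j => (h0 j).trans (minDist_le _ _)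
    have hccw : IsCCW z := by
      simpa only [neg_add_cancel_right] using (hch.isCCW hκ hv hs).shift (-k)
    have hfull : IsFullSided v z := by
      rw [isFullSided_iff hκ hv]
      have h : minDist v (fun i => z (i + k)) = minDist v z :=
        minDist_comp_equiv (Equiv.addRight k)
      rw [← h]
      exact hch.cOf_pos hκ hv hs
    refine ⟨⟨⟨⟨hb, hccw.convexIndependent hg.injective⟩, hlow, hccw⟩, hfull⟩, ?_,
      hch.sizeVector_eq hκ hv hs⟩
    rwa [sideDistance_eq hκ hv hb]

/-- Both sets split according to the cyclic shift between cp_0 and the lowest point, and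
corresponding pieces have the same volume. -/
lemma volume_fullSidedTuples_inter {A : Set (Fin κ → ℝ)} (hA : MeasurableSet A) :
    volume (fullSidedTuples v n ∩ {z | sideDistance v z ∈ A ∧ sizeVector v z = s}) =
      volume (blockChains v n s (A ∩ {l | ∀ j, 0 ≤ l j})) := by
  set W := blockChains v n s (A ∩ {l | ∀ j, 0 ≤ l j}) with hW
  have hN : MeasurableSet {l : Fin κ → ℝ | ∀ j, 0 ≤ l j} := by
    simp only [Set.ofPred_forall]
    exact MeasurableSet.iInter fun j => measurableSet_le measurable_const (measurable_pi_apply j)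
  have hWm : MeasurableSet W := measurableSet_blockChains (hA.inter hN)
  -- After numbering from the index k, the lowest point z 0 sits at the index -k.
  set V : Fin n → Set (Fin n → Plane) := fun k => W ∩ {z | IsLowest z (-k)} with hV
  have hVm : ∀ k, MeasurableSet (V k) := fun k => hWm.inter (measurableSet_isLowest _)
  have hmp : ∀ k : Fin n,
      MeasurePreserving (fun (z : Fin n → Plane) i => z (i + k)) volume volume := fun k =>
    measurePreserving_perm (Equiv.addRight k)
  have hlow : ∀ (z : Fin n → Plane) (k : Fin n),
      IsLowest (fun i => z (i + k)) (-k) ↔ IsLowest z 0 := by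
    intro z k
    simp only [IsLowest, neg_add_cancel]
    refine ⟨fun h i => ?_, fun h i => h _⟩
    simpa only [sub_add_cancel] using h (i - k)
  have h1 : (fullSidedTuples v n ∩ {z | sideDistance v z ∈ A ∧ sizeVector v z = s} :
      Set (Fin n → Plane)) =ᵐ[volume] (⋃ k, (fun (z : Fin n → Plane) i => z (i + k)) ⁻¹' V k : Set (Fin n → Plane)) := by
    refine Filter.eventuallyEq_set.2 ?_
    filter_upwards [ae_isGeneric hκ hv] with z hg
    refine (mem_fullSidedTuples_iff hκ hv hs hg A).trans ?_
    rw [Set.mem_iUnion]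
    exact exists_congr fun k => and_congr_right fun _ => (hlow z k).symm
  have h2 : W = ⋃ k, V k := by
    rw [← Set.inter_iUnion, eq_comm, Set.inter_eq_left]
    intro z _
    obtain ⟨k, hk⟩ := exists_isLowest z
    exact Set.mem_iUnion.2 ⟨-k, by rw [neg_neg]; exact hk⟩
  rw [measure_congr h1, h2, measure_iUnion₀, measure_iUnion₀]
  · congr 1
    funext k
    exact (hmp k).measure_preimage (hVm k).nullMeasurableSet
  · intro k m hkm
    refine measure_mono_null ?_ (ae_isGeneric (n := n) hκ hv)
    rintro z ⟨hk, hm⟩ hg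
    have hlt := hk.2.lt (fun i j hij => (hg i j hij).1) (i := -m)
      fun h => hkm (neg_injective h).symm
    rcases hm.2 (-k) with h | h
    · exact lt_asymm h hlt
    · exact hlt.ne' h.1
  · exact fun k => (hVm k).nullMeasurableSet
  · intro k m hkm
    refine measure_mono_null ?_ (ae_isGeneric (n := n) hκ hv)
    rintro z ⟨hk, hm⟩ hg
    apply hkm
    have e1 := hk.1.1.contactIndex_eq hκ hv hs 0
    have e2 := hm.1.1.contactIndex_eq hκ hv hs 0
    exact add_left_cancel (e1.symm.trans e2)
  · exact fun k => ((hmp k).measurable (hVm k)).nullMeasurableSet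

end

/-! ### The symmetry -/

omit [NeZero κ] [NeZero n] in
lemma mem_convexTuples_comp_perm (σ : Equiv.Perm (Fin n)) (hz : z ∈ convexTuples v n) :
    (fun i => z (σ i)) ∈ convexTuples v n :=
  ⟨fun _ => hz.1 _, hz.2.comp_embedding σ.toEmbedding⟩

section

variable (hκ : 3 ≤ κ) (hv : IsConvexPolygon v)
include hκ hv

/-- For generic tuples the counterclockwise condition already implies convex independence, so up to
a null set only explicitly measurable conditions remain. -/
lemma nullMeasurableSet_canonicalTuples : NullMeasurableSet (canonicalTuples v n) volume := by
  have hb : MeasurableSet {z : Fin n → Plane | ∀ i, z i ∈ body v} := by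
    simp only [Set.ofPred_forall]
    exact MeasurableSet.iInter fun i => measurable_pi_apply i (measurableSet_body hκ hv)
  refine NullMeasurableSet.congr
    (hb.inter ((measurableSet_isLowest 0).inter measurableSet_isCCW)).nullMeasurableSet ?_
  refine Filter.eventuallyEq_set.2 ?_
  filter_upwards [ae_isGeneric hκ hv] with z hg
  exact ⟨fun h => ⟨⟨h.1, IsCCW.convexIndependent h.2.2 hg.injective⟩, h.2.1, h.2.2⟩,
    fun h => ⟨h.1.1, h.2.1, h.2.2⟩⟩

lemma nullMeasurableSet_fullSidedTuples : NullMeasurableSet (fullSidedTuples v n) volume :=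
  (nullMeasurableSet_canonicalTuples hκ hv).inter
    (measurableSet_isFullSided hκ hv).nullMeasurableSet

/-- Almost every convex tuple has exactly one canonical relabelling, and relabelling preserves the
volume. -/
lemma volume_convexTuples_isFullSided :
    volume {z : Fin n → Plane | z ∈ convexTuples v n ∧ IsFullSided v z} =
      n ! * volume (fullSidedTuples v n) := by
  have h : {z : Fin n → Plane | z ∈ convexTuples v n ∧ IsFullSided v z} =ᵐ[volume]
      (⋃ σ : Equiv.Perm (Fin n), (fun (z : Fin n → Plane) i => z (σ i)) ⁻¹' fullSidedTuples v n :
        Set (Fin n → Plane)) := by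
    refine Filter.eventuallyEq_set.2 ?_
    filter_upwards [ae_isGeneric hκ hv] with z hg
    rw [Set.mem_iUnion]
    constructor
    · rintro ⟨hz, hfull⟩
      obtain ⟨σ, h1, h2⟩ := exists_perm (fun i j hij => (hg i j hij).1) hz.2
      exact ⟨σ, ⟨mem_convexTuples_comp_perm σ hz, h1, h2⟩, (isFullSided_comp_equiv σ).2 hfull⟩
    · rintro ⟨σ, ⟨hz, -⟩, hfull⟩
      refine ⟨?_, (isFullSided_comp_equiv σ).1 hfull⟩
      simpa only [Equiv.apply_symm_apply] using mem_convexTuples_comp_perm σ.symm hz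
  rw [measure_congr h, measure_iUnion₀]
  · simp only [(measurePreserving_perm _).measure_preimage
      (nullMeasurableSet_fullSidedTuples hκ hv), tsum_fintype, Finset.sum_const, Finset.card_univ,
      Fintype.card_perm, Fintype.card_fin, nsmul_eq_mul]
  · intro σ τ hστ
    refine measure_mono_null ?_ (ae_isGeneric (n := n) hκ hv)
    rintro z ⟨hσ, hτ⟩ hg
    exact hστ (perm_unique (fun i j hij => (hg i j hij).1) hσ.1.2.1 hσ.1.2.2 hτ.1.2.1 hτ.1.2.2)
  · exact fun σ => (nullMeasurableSet_fullSidedTuples hκ hv).preimage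
      (measurePreserving_perm σ).quasiMeasurePreserving

end

end Decomposition

/-! ### The laws in terms of the Lebesgue measure -/

section Laws

variable {κ : ℕ} [NeZero κ] {n : ℕ} [NeZero n] {v : Fin κ → Plane} {s : Fin κ → ℕ}

omit [NeZero κ] in
lemma volume_body_ne_top : volume (body v) ≠ ⊤ :=
  ((Set.finite_range v).isCompact_convexHull (𝕜 := ℝ)).measure_lt_top.ne

omit [NeZero κ] [NeZero n] in
lemma uniformLaw_eq : uniformLaw v n =
    (volume (body v))⁻¹ ^ n • (volume : Measure (Fin n → Plane)).restrict
      (Set.univ.pi fun _ => body v) := by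
  refine Measure.pi_eq fun t _ => ?_
  rw [Measure.smul_apply, volume_pi, Measure.restrict_pi_pi, Measure.pi_pi]
  simp only [ProbabilityTheory.cond, Measure.smul_apply, smul_eq_mul, Finset.prod_mul_distrib, Finset.prod_const,
    Finset.card_univ, Fintype.card_fin]

lemma volume_body_ne_zero (hpos : 0 < fullSidedProb v n) : volume (body v) ≠ 0 := by
  intro h
  have h0 : uniformLaw v n = 0 := by
    rw [uniformLaw, ← Measure.measure_univ_eq_zero, Measure.pi_univ,
      cond_eq_zero_of_meas_eq_zero h]
    simp [NeZero.ne n]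
  rw [fullSidedProb, h0] at hpos
  simp at hpos

section

variable (hκ : 3 ≤ κ) (hv : IsConvexPolygon v)
include hκ hv

omit [NeZero n] in
lemma uniformLaw_apply {S : Set (Fin n → Plane)} (hS : ∀ z ∈ S, ∀ i, z i ∈ body v) :
    uniformLaw v n S = (volume (body v))⁻¹ ^ n * volume S := by
  rw [uniformLaw_eq, Measure.smul_apply, smul_eq_mul,
    Measure.restrict_apply' (MeasurableSet.univ_pi fun _ => measurableSet_body hκ hv),
    Set.inter_eq_left.2 fun z hz => Set.mem_univ_pi.2 (hS z hz)]

lemma uniformLaw_convexTuples_isFullSided :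
    uniformLaw v n {z | z ∈ convexTuples v n ∧ IsFullSided v z} =
      (volume (body v))⁻¹ ^ n * (n ! * volume (fullSidedTuples v n)) := by
  rw [uniformLaw_apply hκ hv fun z hz => hz.1.1, volume_convexTuples_isFullSided hκ hv]

variable (hpos : 0 < fullSidedProb v n)
include hpos

lemma volume_fullSidedTuples_ne_zero : volume (fullSidedTuples v n) ≠ 0 := by
  intro h
  rw [fullSidedProb, Measure.real, uniformLaw_convexTuples_isFullSided hκ hv, h] at hpos
  simp at hpos

omit hκ hv hpos in
lemma volume_fullSidedTuples_ne_top : volume (fullSidedTuples v n) ≠ ⊤ := by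
  refine ne_top_of_le_ne_top ?_ (measure_mono (t := Set.univ.pi fun _ => body v)
    fun z hz i _ => hz.1.1.1 i)
  rw [volume_pi_pi]
  exact ENNReal.prod_ne_top fun _ _ => volume_body_ne_top

/-- Successive conditionings combine, and all normalizing constants cancel: the law is the
normalized Lebesgue measure on the full-sided canonical tuples. -/
lemma fullSidedLaw_apply (B : Set (Fin n → Plane)) :
    fullSidedLaw v n B =
      (volume (fullSidedTuples v n))⁻¹ * volume (fullSidedTuples v n ∩ B) := by
  set c := (volume (body v))⁻¹ ^ n with hc
  have hc0 : c ≠ 0 := pow_ne_zero _ (ENNReal.inv_ne_zero.2 volume_body_ne_top)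
  have hct : c ≠ ⊤ := ENNReal.pow_ne_top (ENNReal.inv_ne_top.2 (volume_body_ne_zero hpos))
  have hCm : NullMeasurableSet (canonicalTuples v n) (uniformLaw v n) := by
    refine (nullMeasurableSet_canonicalTuples hκ hv).mono_ac ?_
    rw [uniformLaw_eq]
    exact Measure.smul_absolutelyContinuous.trans Measure.restrict_le_self.absolutelyContinuous
  have hU : ∀ X, uniformLaw v n (X ∩ canonicalTuples v n) =
      c * volume (X ∩ canonicalTuples v n) := fun X =>
    uniformLaw_apply hκ hv fun z hz => hz.2.1.1
  have hconv : ∀ X, convexLaw v n X =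
      (uniformLaw v n (canonicalTuples v n))⁻¹ * c * volume (X ∩ canonicalTuples v n) := by
    intro X
    rw [convexLaw, ProbabilityTheory.cond, Measure.smul_apply, Measure.restrict_apply₀' hCm, hU, smul_eq_mul,
      mul_assoc]
  have hUC : uniformLaw v n (canonicalTuples v n) = c * volume (canonicalTuples v n) :=
    uniformLaw_apply hκ hv fun z hz => hz.1.1
  have hUC0 : uniformLaw v n (canonicalTuples v n) ≠ 0 := by
    rw [hUC]
    refine mul_ne_zero hc0 fun h => volume_fullSidedTuples_ne_zero hκ hv hpos ?_
    exact measure_mono_null Set.inter_subset_left h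
  have hUCt : uniformLaw v n (canonicalTuples v n) ≠ ⊤ := by
    have : IsFiniteMeasure (uniformLaw v n) := by rw [uniformLaw]; infer_instance
    exact measure_ne_top _ _
  set a := (uniformLaw v n (canonicalTuples v n))⁻¹ * c with ha
  have ha0 : a ≠ 0 := mul_ne_zero (ENNReal.inv_ne_zero.2 hUCt) hc0
  have hat : a ≠ ⊤ := ENNReal.mul_ne_top (ENNReal.inv_ne_top.2 hUC0) hct
  rw [fullSidedLaw, cond_apply (measurableSet_isFullSided hκ hv), hconv, hconv,
    Set.inter_comm _ (canonicalTuples v n), Set.inter_comm _ (canonicalTuples v n),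
    ← Set.inter_assoc, ENNReal.mul_inv (Or.inl ha0) (Or.inl hat), mul_mul_mul_comm,
    ENNReal.inv_mul_cancel ha0 hat, one_mul]
  rfl

lemma isProbabilityMeasure_fullSidedLaw : IsProbabilityMeasure (fullSidedLaw v n) := by
  constructor
  rw [fullSidedLaw_apply hκ hv hpos, Set.inter_univ, ENNReal.inv_mul_cancel
    (volume_fullSidedTuples_ne_zero hκ hv hpos) (volume_fullSidedTuples_ne_top)]

lemma ae_fullSidedLaw {p : (Fin n → Plane) → Prop}
    (h : ∀ z ∈ fullSidedTuples v n, IsGeneric v z → p z) : ∀ᵐ z ∂fullSidedLaw v n, p z := by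
  rw [ae_iff, fullSidedLaw_apply hκ hv hpos]
  refine mul_eq_zero_of_right _ (measure_mono_null ?_ (ae_isGeneric (n := n) hκ hv))
  exact fun z hz hg => hz.2 (h z hz.1 hg)

end

/-! ### The density -/

section

variable (hκ : 3 ≤ κ) (hv : IsConvexPolygon v)
include hκ hv

lemma ae_cOf_ne_zero : ∀ᵐ l : Fin κ → ℝ, ∀ j, cOf v l j ≠ 0 := by
  refine ae_all_iff.2 fun j => ?_
  let S : AffineSubspace ℝ (Fin κ → ℝ) :=
    { carrier := {l | cOf v l j = 0}
      smul_vsub_vadd_mem' := by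
        intro c p q r hp hq hr
        change cOf v p j = 0 at hp
        change cOf v q j = 0 at hq
        change cOf v r j = 0 at hr
        have e : cOf v (c • (p -ᵥ q) +ᵥ r) j = c * (cOf v p j - cOf v q j) + cOf v r j := by
          simp only [cOf, vsub_eq_sub, vadd_eq_add, Pi.add_apply, Pi.smul_apply, Pi.sub_apply,
            smul_eq_mul]
          ring
        change cOf v (c • (p -ᵥ q) +ᵥ r) j = 0
        rw [e, hp, hq, hr, sub_self, mul_zero, add_zero] }
  have hS : S ≠ ⊤ := by
    intro h
    have h0 : (0 : Fin κ → ℝ) ∈ S := by rw [h]; trivial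
    have h1 : cOf v 0 j = 0 := h0
    simp [cOf, (sideLength_pos hκ hv j).ne'] at h1
  exact measure_mono_null (fun l hl => not_not.1 hl) (Measure.addHaar_affineSubspace volume S hS)

/-- Points with some c_j = 0 are excluded, because there a power with exponent 0 equals 1 in the
density whereas the truncated power vanishes. They form a null set. -/
lemma ofReal_jointDensity (hpos : 0 < fullSidedProb v n) {l : Fin κ → ℝ}
    (hl : ∀ j, cOf v l j ≠ 0) :
    ENNReal.ofReal (jointDensity v n l s) = (volume (fullSidedTuples v n))⁻¹ *
      (∏ j, ENNReal.ofReal (turn v j ^ ((s j : ℤ) - 1) / (s j)!)) *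
        Set.indicator {l | ∀ j, 0 ≤ l j}
          (fun l => ∏ j, truncPow (s (j - 1) + s j - 1) (cOf v l j)) l := by
  have hE0 := volume_fullSidedTuples_ne_zero hκ hv hpos
  have hEt := volume_fullSidedTuples_ne_top (v := v) (n := n)
  have hE : 0 < (volume (fullSidedTuples v n)).toReal := ENNReal.toReal_pos hE0 hEt
  have hB : 0 < (volume (body v)).toReal :=
    ENNReal.toReal_pos (volume_body_ne_zero hpos) volume_body_ne_top
  -- The area powers and the factorial cancel against those in the probability, which leaves the
  -- inverse volume of the canonical tuples.
  have hpre : (n ! : ℝ) / (volume.real (body v) ^ n * fullSidedProb v n) =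
      (volume (fullSidedTuples v n)).toReal⁻¹ := by
    rw [fullSidedProb, Measure.real, Measure.real, uniformLaw_convexTuples_isFullSided hκ hv,
      ENNReal.toReal_mul, ENNReal.toReal_mul, ENNReal.toReal_pow, ENNReal.toReal_inv,
      ENNReal.toReal_natCast, inv_pow]
    have := Nat.factorial_pos n
    field_simp
  rw [jointDensity, hpre]
  by_cases hadm : l ∈ admissible v
  · have hc : ∀ j, 0 < cOf v l j := fun j => lt_of_le_of_ne (hadm.2 j) (hl j).symm
    rw [Set.indicator_of_mem hadm, Set.indicator_of_mem (s := {l : Fin κ → ℝ | ∀ j, 0 ≤ l j}) hadm.1,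
      ENNReal.ofReal_mul (by positivity), ENNReal.ofReal_inv_of_pos hE, ENNReal.ofReal_toReal hEt,
      mul_assoc, ← Finset.prod_mul_distrib, ENNReal.ofReal_prod_of_nonneg]
    · congr 1
      refine Finset.prod_congr rfl fun j _ => ?_
      have := turn_pos hκ hv j
      rw [truncPow_of_pos _ (hc j), ← ENNReal.ofReal_mul (by positivity), sin_interiorAngle hκ hv,
        mul_div_mul_comm]
    · intro j _
      have := turn_pos hκ hv j
      have := (hc j).le
      rw [sin_interiorAngle hκ hv]
      positivity
  · rw [Set.indicator_of_notMem hadm, mul_zero, ENNReal.ofReal_zero]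
    symm
    by_cases h0 : ∀ j, 0 ≤ l j
    · obtain ⟨j, hj⟩ : ∃ j, cOf v l j < 0 := by
        by_contra! h
        exact hadm ⟨h0, h⟩
      rw [Set.indicator_of_mem (s := {l : Fin κ → ℝ | ∀ j, 0 ≤ l j}) h0]
      exact mul_eq_zero_of_right _
        (Finset.prod_eq_zero (Finset.mem_univ j) (truncPow_of_nonpos _ hj.le))
    · rw [Set.indicator_of_notMem (s := {l : Fin κ → ℝ | ∀ j, 0 ≤ l j}) h0, mul_zero]

lemma fullSidedLaw_sideDistance_sizeVector (hpos : 0 < fullSidedProb v n)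
    (hs : s ∈ sizeVectors κ n) {A : Set (Fin κ → ℝ)} (hA : MeasurableSet A) :
    fullSidedLaw v n {z | sideDistance v z ∈ A ∧ sizeVector v z = s} =
      ∫⁻ l in A, ENNReal.ofReal (jointDensity v n l s) := by
  have hN : MeasurableSet {l : Fin κ → ℝ | ∀ j, 0 ≤ l j} := by
    simp only [Set.ofPred_forall]
    exact MeasurableSet.iInter fun j => measurableSet_le measurable_const (measurable_pi_apply j)
  have hm : Measurable fun l : Fin κ → ℝ => ∏ j, truncPow (s (j - 1) + s j - 1) (cOf v l j) :=
    Finset.measurable_prod _ fun j _ => (measurable_truncPow _).comp (measurable_cOf j)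
  rw [lintegral_congr_ae (ae_restrict_of_ae ((ae_cOf_ne_zero hκ hv).mono fun l hl =>
      ofReal_jointDensity hκ hv hpos hl)), lintegral_const_mul _ (hm.indicator hN),
    setLIntegral_indicator hN, Set.inter_comm, mul_assoc, fullSidedLaw_apply hκ hv hpos,
    volume_fullSidedTuples_inter hκ hv hs hA, blockChains,
    volume_isBlockChain hκ hv hs (hA.inter hN)]

end

end Laws

end PCP
end

theorem mainTheorem5 {κ n : ℕ} [NeZero κ] [NeZero n] (hκ : 3 ≤ κ) (v : Fin κ → PCP.Plane)
    (hv : PCP.IsConvexPolygon v) (hpos : 0 < PCP.fullSidedProb v n) :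
    IsProbabilityMeasure (PCP.fullSidedLaw v n) ∧
    (∀ᵐ z ∂(PCP.fullSidedLaw v n), PCP.sizeVector v z ∈ PCP.sizeVectors κ n ∧
      ∀ j, PCP.pcpSideLength v z j = PCP.cOf v (PCP.sideDistance v z) j) ∧
    ∀ s ∈ PCP.sizeVectors κ n, ∀ A : Set (Fin κ → ℝ), MeasurableSet A →
      PCP.fullSidedLaw v n {z | PCP.sideDistance v z ∈ A ∧ PCP.sizeVector v z = s} =
        ∫⁻ l in A, ENNReal.ofReal (PCP.jointDensity v n l s) := by
  refine ⟨PCP.isProbabilityMeasure_fullSidedLaw hκ hv hpos,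
    PCP.ae_fullSidedLaw hκ hv hpos fun z hz hg => ⟨?_, fun j => ?_⟩,
    fun s hs A hA => PCP.fullSidedLaw_sideDistance_sizeVector hκ hv hpos hs hA⟩
  · exact PCP.sizeVector_mem hκ hv hz.1.2.2 (fun j i hi => hg.contact_lt j hi) hz.2
  · rw [PCP.sideDistance_eq hκ hv hz.1.1.1]
    exact PCP.pcpSideLength_eq_of_pos hκ hv ((PCP.isFullSided_iff hκ hv).1 hz.2) j
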